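/- Let $R$ be a commutative ring, unadorned $\otimes=\otimes_R$, and let $H$ be a Hopf algebra over $R$ with bijective antipode. Let $A$ be a right $H$-comodule algebra, i.e. an $R$-algebra with a coassociative and counital coaction $\delta:A\to A\otimes H$, $a\mapsto a_{(0)}\otimes a_{(1)}$, which is an algebra homomorphism, and let $B=A^{co\,H}=\{a:\delta(a)=a\otimes 1\}$. Then $A^{op}$ is an $H^{op}$-comodule algebra with the same coaction, where $H^{op}$ has the opposite product and the same comultiplication. The extension $A/B$ is called $H$-Galois if $A\otimes_BA\to A\otimes H$, $a\otimes b\mapsto ab_{(0)}\otimes b_{(1)}$, is bijective. A generalised quotient of $H$ is a quotient $\pi_Q:H\to Q=H/I$ by a right ideal coideal $I$; the set $\mathsf{Quot}_{gen}(H)$ of these is ordered by $H/I\le H/J$ iff $J\subseteq I$, and is a complete lattice. Put $\phi(Q)=A^{co\,Q}=\{a\in A: a_{(0)}\otimes\pi_Q(a_{(1)})=a\otimes\pi_Q(1)\}$, an $R$-subalgebra of $A$ containing $B$, and, for an $R$-subalgebra $S\subseteq A$, $\psi(S)=\bigvee\{Q\in\mathsf{Quot}_{gen}(H):S\subseteq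 A^{co\,Q}\}$. We say that the Galois connection exists if there is an order-reversing map $\psi'$ from subalgebras of $A$ to $\mathsf{Quot}_{gen}(H)$ with $S\subseteq\phi\psi'(S)$ and $Q\le\psi'\phi(Q)$ for all $S$ and $Q$; then necessarily $\psi'=\psi$. Let $\psi^{op}$ denote the map $\psi$ of the $H^{op}$-comodule algebra $A^{op}$. A generalised quotient $Q$ is called right (left) admissible if $Q$ is flat over $R$ and $H$ is faithfully coflat as a right (left) $Q$-comodule, i.e. the cotensor functor $H\,\square_Q-$ (respectively $-\,\square_Q H$) preserves and reflects exact sequences of comodules. A subalgebra $S$ with $B\subseteq S\subseteq A$ is called right admissible if $A$ is faithfully flat as a right $S$-module, the map $A\otimes_SA\to A\otimes\psi(S)$, $a\otimes b\mapsto ab_{(0)}\otimes\pi_{\psi(S)}(b_{(1)})$, is bijective, and $\psi(S)$ is flat over $R$. It is called left admissible if $A$ is faithfully flat as a left $S$-module, the corresponding map $A^{op}\otimes_{S^{op}}A^{op}\to A^{op}\otimes\psi^{op}(S^{op})$ for the $H^{op}$-comodule algebra $A^{op}$ is bijective, and $\psi(S)$ is flat over $R$. In both cases, admissible means both left and right admissible.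 **Theorem.** Assume that $A/B$ is $H$-Galois, that $A^{op}/B^{op}$ is $H^{op}$-Galois, that $A$ is faithfully flat both as a left and as a right $B$-module, that $A$ is faithfully flat over $R$, and that the Galois connection exists. Then $\psi$ and $\phi$ restrict to mutually inverse bijections 1. between left admissible subalgebras $B\subseteq S\subseteq A$ and left admissible generalised quotients of $H$; 2. between right admissible subalgebras $B\subseteq S\subseteq A$ and right admissible generalised quotients of $H$; 3. between admissible subalgebras $B\subseteq S\subseteq A$ and admissible generalised quotients of $H$. In particular all these objects are closed: $\phi\psi(S)=S$ and $\psi\phi(Q)=Q$. -/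

import Mathlib

open scoped TensorProduct
open MulOpposite

universe u

noncomputable section

namespace HopfGalois

/-! ### Tensor products over a noncommutative ring, faithful flatness -/

section Balanced

/-- The right module structure of `A` over a subalgebra `S`, given by `a · s = a * s`. -/
instance subalgebraModuleRight {R A : Type*} [CommRing R] [Ring A] [Algebra R A]
    (S : Subalgebra R A) : Module (↥S)ᵐᵒᵖ A :=
  Module.compHom A (RingHom.op S.val.toRingHom)

theorem op_smul_eq_mul {R A : Type*} [CommRing R] [Ring A] [Algebra R A]
    (S : Subalgebra R A) (s : S) (a : A) : op s • a = a * (s : A) := rfl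

variable (R S M N : Type*) [CommRing R] [Ring S]
  [AddCommGroup M] [Module R M] [Module Sᵐᵒᵖ M]
  [AddCommGroup N] [Module R N] [Module S N]

/-- The relations `m · s ⊗ n = m ⊗ s · n`. -/
def balancedRel : Submodule R (M ⊗[R] N) :=
  Submodule.span R {x | ∃ (m : M) (s : S) (n : N), x = (op s • m) ⊗ₜ[R] n - m ⊗ₜ[R] (s • n)}

/-- `M ⊗_S N` for a right `S`-module `M` and a left `S`-module `N`, where `S` is a (possibly
noncommutative) `R`-algebra: the quotient of `M ⊗_R N` by the relations
`m · s ⊗ n = m ⊗ s · n`. -/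
abbrev BalancedTensor : Type _ := (M ⊗[R] N) ⧸ balancedRel R S M N

variable {R S N}

/-- `M ⊗_S f` for a map `f` of left `S`-modules. -/
def BalancedTensor.mapRight [Algebra R S] [IsScalarTower R S N]
    {N' : Type*} [AddCommGroup N'] [Module R N'] [Module S N'] [IsScalarTower R S N']
    (f : N →ₗ[S] N') : BalancedTensor R S M N →ₗ[R] BalancedTensor R S M N' :=
  Submodule.mapQ _ _ ((f.restrictScalars R).lTensor M) (by
    rw [balancedRel, Submodule.span_le]
    rintro _ ⟨m, s, n, rfl⟩
    exact Submodule.subset_span ⟨m, s, f n, by simp⟩)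

variable {M} (N)

/-- `g ⊗_S N` for a map `g` of right `S`-modules. -/
def BalancedTensor.mapLeft [Algebra R S] [IsScalarTower R Sᵐᵒᵖ M]
    {M' : Type*} [AddCommGroup M'] [Module R M'] [Module Sᵐᵒᵖ M'] [IsScalarTower R Sᵐᵒᵖ M']
    (g : M →ₗ[Sᵐᵒᵖ] M') : BalancedTensor R S M N →ₗ[R] BalancedTensor R S M' N :=
  Submodule.mapQ _ _ ((g.restrictScalars R).rTensor N) (by
    rw [balancedRel, Submodule.span_le]
    rintro _ ⟨m, s, n, rfl⟩
    exact Submodule.subset_span ⟨g m, s, n, by simp⟩)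

end Balanced

section FaithfullyFlat

variable (R S M : Type u) [CommRing R] [Ring S] [Algebra R S] [AddCommGroup M] [Module R M]

/-- The right `S`-module `M` is faithfully flat: a sequence of left `S`-modules is exact if and
only if it is exact after applying `M ⊗_S -`. -/
def IsRightFaithfullyFlat [Module Sᵐᵒᵖ M] : Prop :=
  ∀ (X Y Z : Type u) [AddCommGroup X] [AddCommGroup Y] [AddCommGroup Z]
    [Module R X] [Module R Y] [Module R Z] [Module S X] [Module S Y] [Module S Z]
    [IsScalarTower R S X] [IsScalarTower R S Y] [IsScalarTower R S Z]
    (f : X →ₗ[S] Y) (g : Y →ₗ[S] Z),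
    Function.Exact f g ↔
      Function.Exact (BalancedTensor.mapRight (R := R) M f) (BalancedTensor.mapRight (R := R) M g)

/-- The left `S`-module `M` is faithfully flat: a sequence of right `S`-modules is exact if and
only if it is exact after applying `- ⊗_S M`. -/
def IsLeftFaithfullyFlat [Module S M] : Prop :=
  ∀ (X Y Z : Type u) [AddCommGroup X] [AddCommGroup Y] [AddCommGroup Z]
    [Module R X] [Module R Y] [Module R Z] [Module Sᵐᵒᵖ X] [Module Sᵐᵒᵖ Y] [Module Sᵐᵒᵖ Z]
    [IsScalarTower R Sᵐᵒᵖ X] [IsScalarTower R Sᵐᵒᵖ Y] [IsScalarTower R Sᵐᵒᵖ Z]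
    (f : X →ₗ[Sᵐᵒᵖ] Y) (g : Y →ₗ[Sᵐᵒᵖ] Z),
    Function.Exact f g ↔
      Function.Exact (BalancedTensor.mapLeft (R := R) M f) (BalancedTensor.mapLeft (R := R) M g)

end FaithfullyFlat

/-! ### Comodules, cotensor products, faithful coflatness -/

section Comodules

variable {R C M N : Type*} [CommRing R] [AddCommGroup C] [Module R C] [Coalgebra R C]
  [AddCommGroup M] [Module R M] [AddCommGroup N] [Module R N]

/-- `δ : M → M ⊗ C` is a coassociative and counital right coaction of the coalgebra `C`. -/
structure IsRightCoaction (δ : M →ₗ[R] M ⊗[R] C) : Prop where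
  coassoc : (TensorProduct.assoc R M C C).toLinearMap ∘ₗ δ.rTensor C ∘ₗ δ =
    (Coalgebra.comul (R := R) (A := C)).lTensor M ∘ₗ δ
  counit : (Coalgebra.counit (R := R) (A := C)).lTensor M ∘ₗ δ = (TensorProduct.mk R M R).flip 1

/-- `ρ : N → C ⊗ N` is a coassociative and counital left coaction of the coalgebra `C`. -/
structure IsLeftCoaction (ρ : N →ₗ[R] C ⊗[R] N) : Prop where
  coassoc : (TensorProduct.assoc R C C N).toLinearMap ∘ₗ
    (Coalgebra.comul (R := R) (A := C)).rTensor N ∘ₗ ρ = ρ.lTensor C ∘ₗ ρ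
  counit : (Coalgebra.counit (R := R) (A := C)).rTensor N ∘ₗ ρ = TensorProduct.mk R R N 1

/-- The cotensor product `M □_C N`: the equaliser of `δ ⊗ N` and `M ⊗ ρ` in `M ⊗ N`. -/
def cotensor (δ : M →ₗ[R] M ⊗[R] C) (ρ : N →ₗ[R] C ⊗[R] N) : Submodule R (M ⊗[R] N) :=
  LinearMap.eqLocus ((TensorProduct.assoc R M C N).toLinearMap ∘ₗ δ.rTensor N) (ρ.lTensor M)

/-- `M □_C f` for a map `f` of left `C`-comodules. -/
def cotensorMapRight (δ : M →ₗ[R] M ⊗[R] C) {N' : Type*} [AddCommGroup N'] [Module R N']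
    {ρ : N →ₗ[R] C ⊗[R] N} {ρ' : N' →ₗ[R] C ⊗[R] N'} (f : N →ₗ[R] N')
    (hf : ρ' ∘ₗ f = f.lTensor C ∘ₗ ρ) : cotensor δ ρ →ₗ[R] cotensor δ ρ' :=
  (f.lTensor M).restrict (by
    intro x hx
    have hx' : TensorProduct.assoc R M C N (δ.rTensor N x) = ρ.lTensor M x := hx
    change TensorProduct.assoc R M C N' (δ.rTensor N' (f.lTensor M x)) =
      ρ'.lTensor M (f.lTensor M x)
    rw [← LinearMap.lTensor_comp_apply, hf, LinearMap.lTensor_comp_apply, ← hx',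
      ← LinearMap.comp_apply (δ.rTensor N'), LinearMap.rTensor_comp_lTensor,
      ← LinearMap.lTensor_comp_rTensor, LinearMap.comp_apply]
    generalize δ.rTensor N x = y
    induction y with
    | zero => simp
    | add a b ha hb => simp only [map_add, ha, hb]
    | tmul a n =>
      induction a with
      | zero => simp
      | add a b ha hb => simp only [map_add, TensorProduct.add_tmul, ha, hb]
      | tmul m c => simp)

/-- `g □_C N` for a map `g` of right `C`-comodules. -/
def cotensorMapLeft (ρ : N →ₗ[R] C ⊗[R] N) {M' : Type*} [AddCommGroup M'] [Module R M']
    {δ : M →ₗ[R] M ⊗[R] C} {δ' : M' →ₗ[R] M' ⊗[R] C} (g : M →ₗ[R] M')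
    (hg : δ' ∘ₗ g = g.rTensor C ∘ₗ δ) : cotensor δ ρ →ₗ[R] cotensor δ' ρ :=
  (g.rTensor N).restrict (by
    intro x hx
    have hx' : TensorProduct.assoc R M C N (δ.rTensor N x) = ρ.lTensor M x := hx
    change TensorProduct.assoc R M' C N (δ'.rTensor N (g.rTensor N x)) =
      ρ.lTensor M' (g.rTensor N x)
    rw [← LinearMap.rTensor_comp_apply, hg, LinearMap.rTensor_comp_apply,
      ← LinearMap.comp_apply (ρ.lTensor M'), LinearMap.lTensor_comp_rTensor,
      ← LinearMap.rTensor_comp_lTensor, LinearMap.comp_apply, ← hx']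
    generalize δ.rTensor N x = y
    induction y with
    | zero => simp
    | add a b ha hb => simp only [map_add, ha, hb]
    | tmul a n =>
      induction a with
      | zero => simp
      | add a b ha hb => simp only [map_add, TensorProduct.add_tmul, ha, hb]
      | tmul m c => simp)

end Comodules

section FaithfullyCoflat

variable {R C M : Type u} [CommRing R] [AddCommGroup C] [Module R C] [Coalgebra R C]
  [AddCommGroup M] [Module R M]

/-- The right `C`-comodule `(M, δ)` is faithfully coflat: a sequence of left `C`-comodules is
exact if and only if it is exact after applying `M □_C -`. -/
def IsRightFaithfullyCoflat (δ : M →ₗ[R] M ⊗[R] C) : Prop :=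
  ∀ (X Y Z : Type u) [AddCommGroup X] [AddCommGroup Y] [AddCommGroup Z]
    [Module R X] [Module R Y] [Module R Z]
    (ρX : X →ₗ[R] C ⊗[R] X) (ρY : Y →ₗ[R] C ⊗[R] Y) (ρZ : Z →ₗ[R] C ⊗[R] Z),
    IsLeftCoaction ρX → IsLeftCoaction ρY → IsLeftCoaction ρZ →
    ∀ (f : X →ₗ[R] Y) (g : Y →ₗ[R] Z)
      (hf : ρY ∘ₗ f = f.lTensor C ∘ₗ ρX) (hg : ρZ ∘ₗ g = g.lTensor C ∘ₗ ρY),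
      Function.Exact f g ↔
        Function.Exact (cotensorMapRight δ f hf) (cotensorMapRight δ g hg)

/-- The left `C`-comodule `(M, ρ)` is faithfully coflat: a sequence of right `C`-comodules is
exact if and only if it is exact after applying `- □_C M`. -/
def IsLeftFaithfullyCoflat (ρ : M →ₗ[R] C ⊗[R] M) : Prop :=
  ∀ (X Y Z : Type u) [AddCommGroup X] [AddCommGroup Y] [AddCommGroup Z]
    [Module R X] [Module R Y] [Module R Z]
    (δX : X →ₗ[R] X ⊗[R] C) (δY : Y →ₗ[R] Y ⊗[R] C) (δZ : Z →ₗ[R] Z ⊗[R] C),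
    IsRightCoaction δX → IsRightCoaction δY → IsRightCoaction δZ →
    ∀ (f : X →ₗ[R] Y) (g : Y →ₗ[R] Z)
      (hf : δY ∘ₗ f = f.rTensor C ∘ₗ δX) (hg : δZ ∘ₗ g = g.rTensor C ∘ₗ δY),
      Function.Exact f g ↔
        Function.Exact (cotensorMapLeft ρ f hf) (cotensorMapLeft ρ g hg)

end FaithfullyCoflat

/-! ### Generalised quotients -/

section GenQuot

/-- A generalised quotient `H ⧸ ideal` of `H`, i.e. a quotient by a right ideal coideal, recorded
by its kernel. (Only the algebra and the coalgebra structure of `H` enter, so that this applies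
verbatim to the opposite Hopf algebra `Hᵐᵒᵖ`: opposite product, same comultiplication.) -/
@[ext]
structure GenQuot (R H : Type*) [CommRing R] [Ring H] [Algebra R H] [Coalgebra R H] where
  /-- the kernel of the quotient map -/
  ideal : Submodule R H
  isCoideal : ideal.IsCoideal
  mul_mem : ∀ x ∈ ideal, ∀ h : H, x * h ∈ ideal

namespace GenQuot

variable {R H : Type*} [CommRing R] [Ring H] [Algebra R H] [Coalgebra R H]

instance (Q : GenQuot R H) : Q.ideal.IsCoideal := Q.isCoideal

/-- Larger quotients have smaller kernels. -/
instance : PartialOrder (GenQuot R H) where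
  le Q₁ Q₂ := Q₂.ideal ≤ Q₁.ideal
  le_refl _ := le_refl (α := Submodule R H) _
  le_trans _ _ _ h₁ h₂ := le_trans (α := Submodule R H) h₂ h₁
  le_antisymm _ _ h₁ h₂ := GenQuot.ext (le_antisymm (α := Submodule R H) h₂ h₁)

theorem le_def (Q₁ Q₂ : GenQuot R H) : Q₁ ≤ Q₂ ↔ Q₂.ideal ≤ Q₁.ideal := Iff.rfl

/-- The supremum of a set of generalised quotients: its kernel is the sum of all right ideal
coideals contained in every kernel of the set. -/
instance : SupSet (GenQuot R H) where
  sSup T :=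
    { ideal := ⨆ (J : GenQuot R H) (_ : ∀ Q ∈ T, J.ideal ≤ Q.ideal), J.ideal
      isCoideal := by
        set P : Submodule R H :=
          ⨆ (J : GenQuot R H) (_ : ∀ Q ∈ T, J.ideal ≤ Q.ideal), J.ideal with hP
        have hle : ∀ J : GenQuot R H, (∀ Q ∈ T, J.ideal ≤ Q.ideal) → J.ideal ≤ P :=
          fun J hJ => le_iSup₂_of_le J hJ le_rfl
        have key : P ≤ LinearMap.ker (Coalgebra.counit (R := R) (A := H)) ⊓
            LinearMap.ker (TensorProduct.map P.mkQ P.mkQ ∘ₗ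
              Coalgebra.comul (R := R) (A := H)) := by
          conv_lhs => rw [hP]
          refine iSup₂_le fun J hJ x hx => ⟨?_, ?_⟩
          · exact Submodule.IsCoideal.counit_eq_zero hx
          · have h0 := Submodule.IsCoideal.map_mkQ_comul_eq_zero (I := J.ideal) hx
            have hf : P.mkQ = (Submodule.factor (hle J hJ)) ∘ₗ J.ideal.mkQ := by
              ext; rfl
            change TensorProduct.map P.mkQ P.mkQ (Coalgebra.comul x) = 0
            rw [hf, TensorProduct.map_comp,
              LinearMap.comp_apply, h0, map_zero]
        exact ⟨fun x hx => (key hx).1, fun x hx => (key hx).2⟩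
      mul_mem := by
        intro x hx h
        have key : (⨆ (J : GenQuot R H) (_ : ∀ Q ∈ T, J.ideal ≤ Q.ideal), J.ideal) ≤
            Submodule.comap (LinearMap.mulRight R h)
              (⨆ (J : GenQuot R H) (_ : ∀ Q ∈ T, J.ideal ≤ Q.ideal), J.ideal) := by
          refine iSup₂_le fun J hJ y hy => ?_
          exact (le_iSup₂_of_le (f := fun (J : GenQuot R H)
            (_ : ∀ Q ∈ T, J.ideal ≤ Q.ideal) => J.ideal)
            J hJ le_rfl) (J.mul_mem y hy h)
        exact key hx }

theorem isLUB_sSup (T : Set (GenQuot R H)) : IsLUB T (sSup T) := by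
  refine ⟨fun Q hQ => ?_, fun Q' hQ' => ?_⟩
  · exact (GenQuot.le_def _ _).2 (iSup₂_le fun J hJ => hJ Q hQ)
  · exact le_iSup₂_of_le (f := fun (J : GenQuot R H)
      (_ : ∀ Q ∈ T, J.ideal ≤ Q.ideal) => J.ideal)
      Q' (fun Q hQ => hQ' hQ) le_rfl

/-- The right `H`-module structure of `Q`: right multiplication by `h`. -/
def mulRight (Q : GenQuot R H) (h : H) : (H ⧸ Q.ideal) →ₗ[R] (H ⧸ Q.ideal) :=
  Submodule.mapQ _ _ (LinearMap.mulRight R h) fun x hx => Q.mul_mem x hx h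

theorem lTensor_mkQ_mul {A : Type*} [Ring A] [Algebra R A] (Q : GenQuot R H)
    {x x' : A ⊗[R] H} (hx : Q.ideal.mkQ.lTensor A x = Q.ideal.mkQ.lTensor A x')
    (y : A ⊗[R] H) :
    Q.ideal.mkQ.lTensor A (x * y) = Q.ideal.mkQ.lTensor A (x' * y) := by
  have key : ∀ (c : A) (h : H) (z : A ⊗[R] H), Q.ideal.mkQ.lTensor A (z * (c ⊗ₜ[R] h)) =
      TensorProduct.map (LinearMap.mulRight R c) (Q.mulRight h) (Q.ideal.mkQ.lTensor A z) := by
    intro c h z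
    induction z with
    | zero => simp
    | add a b ha hb => simp only [add_mul, map_add, ha, hb]
    | tmul a k =>
      have hk : Q.mulRight h (Q.ideal.mkQ k) = Q.ideal.mkQ (k * h) := rfl
      simp only [Algebra.TensorProduct.tmul_mul_tmul, LinearMap.lTensor_tmul,
        TensorProduct.map_tmul, LinearMap.mulRight_apply, hk]
  induction y with
  | zero => simp
  | add a b ha hb => simp only [mul_add, map_add, ha, hb]
  | tmul c h => rw [key, key, hx]

end GenQuot

variable {R H : Type u} [CommRing R] [Ring H] [Algebra R H] [Coalgebra R H]

/-- `Q` is right admissible: `Q` is `R`-flat, and `H`, with the right `Q`-coaction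
`h ↦ h₍₁₎ ⊗ π(h₍₂₎)`, is faithfully coflat over `Q`. -/
def GenQuot.IsRightAdmissible (Q : GenQuot R H) : Prop :=
  Module.Flat R (H ⧸ Q.ideal) ∧
    IsRightFaithfullyCoflat (Q.ideal.mkQ.lTensor H ∘ₗ Coalgebra.comul (R := R) (A := H))

/-- `Q` is left admissible: `Q` is `R`-flat, and `H`, with the left `Q`-coaction
`h ↦ π(h₍₁₎) ⊗ h₍₂₎`, is faithfully coflat over `Q`. -/
def GenQuot.IsLeftAdmissible (Q : GenQuot R H) : Prop :=
  Module.Flat R (H ⧸ Q.ideal) ∧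
    IsLeftFaithfullyCoflat (Q.ideal.mkQ.rTensor H ∘ₗ Coalgebra.comul (R := R) (A := H))

end GenQuot

/-! ### Comodule algebras: coinvariants, canonical maps, the Galois connection -/

section ComoduleAlgebra

variable {R H A : Type*} [CommRing R] [Ring H] [Algebra R H] [Ring A] [Algebra R A]

/-- The subalgebra `A^{co H} = {a | δ a = a ⊗ 1}`. -/
def coinvariants (δ : A →ₐ[R] A ⊗[R] H) : Subalgebra R A :=
  AlgHom.equalizer δ Algebra.TensorProduct.includeLeft

/-- The coaction of the opposite algebra `Hᵐᵒᵖ` on `Aᵐᵒᵖ`, `a ↦ a₍₀₎ ⊗ a₍₁₎`. -/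
def opCoaction (δ : A →ₐ[R] A ⊗[R] H) : Aᵐᵒᵖ →ₐ[R] Aᵐᵒᵖ ⊗[R] Hᵐᵒᵖ :=
  (Algebra.TensorProduct.opAlgEquiv R R A H).symm.toAlgHom.comp (AlgHom.op δ)

/-- For a linear map `d : A → A ⊗ Q` which is left linear over the subalgebra `S`, the map
`A ⊗_S A → A ⊗ Q`, `a ⊗ b ↦ a d(b)`. -/
def canonicalMap {Q : Type*} [AddCommGroup Q] [Module R Q] (d : A →ₗ[R] A ⊗[R] Q)
    (S : Subalgebra R A) (hd : ∀ s ∈ S, ∀ b, d (s * b) = s • d b) :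
    BalancedTensor R S A A →ₗ[R] A ⊗[R] Q :=
  (balancedRel R S A A).liftQ
    (TensorProduct.lift (LinearMap.mk₂ R (fun a b => a • d b)
      (fun _ _ _ => add_smul _ _ _) (fun _ _ _ => smul_assoc _ _ _)
      (fun _ _ _ => by rw [map_add, smul_add])
      (fun _ _ _ => by rw [map_smul, smul_comm]))) (by
    rw [balancedRel, Submodule.span_le]
    rintro _ ⟨m, s, n, rfl⟩
    have h : d (s • n) = (s : A) • d n := hd s s.2 n
    simp only [SetLike.mem_coe, LinearMap.mem_ker, map_sub, TensorProduct.lift.tmul,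
      LinearMap.mk₂_apply, h, op_smul_eq_mul, mul_smul, sub_self])

theorem coaction_mul_of_mem (δ : A →ₐ[R] A ⊗[R] H) :
    ∀ s ∈ coinvariants δ, ∀ b, δ.toLinearMap (s * b) = s • δ.toLinearMap b := by
  intro s hs b
  have hs' : δ s = s ⊗ₜ[R] 1 := hs
  simp only [AlgHom.toLinearMap_apply, map_mul, hs']
  generalize δ b = y
  induction y with
  | zero => simp
  | add a b ha hb => simp only [mul_add, smul_add, ha, hb]
  | tmul a h => simp [TensorProduct.smul_tmul']

/-- `A / A^{co H}` is `H`-Galois: `A ⊗_{A^{co H}} A → A ⊗ H`, `a ⊗ b ↦ a b₍₀₎ ⊗ b₍₁₎`, is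
bijective. -/
def IsHopfGalois (δ : A →ₐ[R] A ⊗[R] H) : Prop :=
  Function.Bijective (canonicalMap δ.toLinearMap (coinvariants δ) (coaction_mul_of_mem δ))

variable [Coalgebra R H]

/-- The induced `Q`-coaction `a ↦ a₍₀₎ ⊗ π(a₍₁₎)` on `A`. -/
def quotCoaction (δ : A →ₐ[R] A ⊗[R] H) (Q : GenQuot R H) : A →ₗ[R] A ⊗[R] (H ⧸ Q.ideal) :=
  Q.ideal.mkQ.lTensor A ∘ₗ δ.toLinearMap

/-- `φ(Q) = A^{co Q} = {a | a₍₀₎ ⊗ π(a₍₁₎) = a ⊗ π(1)}`. -/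
def phi (δ : A →ₐ[R] A ⊗[R] H) (Q : GenQuot R H) : Subalgebra R A where
  carrier := {a | quotCoaction δ Q a = a ⊗ₜ[R] Q.ideal.mkQ 1}
  algebraMap_mem' r := by
    simp [quotCoaction, Algebra.TensorProduct.algebraMap_apply]
  add_mem' {a b} ha hb := by
    have ha' : quotCoaction δ Q a = a ⊗ₜ[R] Q.ideal.mkQ 1 := ha
    have hb' : quotCoaction δ Q b = b ⊗ₜ[R] Q.ideal.mkQ 1 := hb
    change quotCoaction δ Q (a + b) = (a + b) ⊗ₜ[R] Q.ideal.mkQ 1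
    rw [map_add, ha', hb', TensorProduct.add_tmul]
  mul_mem' {a b} ha hb := by
    have ha' : Q.ideal.mkQ.lTensor A (δ a) = Q.ideal.mkQ.lTensor A (a ⊗ₜ[R] (1 : H)) := ha
    have hb' : Q.ideal.mkQ.lTensor A (δ b) = b ⊗ₜ[R] Q.ideal.mkQ 1 := hb
    have hs : ∀ y : A ⊗[R] H, Q.ideal.mkQ.lTensor A ((a ⊗ₜ[R] (1 : H)) * y) =
        a • Q.ideal.mkQ.lTensor A y := by
      intro y
      induction y with
      | zero => simp
      | add a b ha hb => simp only [mul_add, map_add, smul_add, ha, hb]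
      | tmul a h => simp [TensorProduct.smul_tmul']
    change Q.ideal.mkQ.lTensor A (δ (a * b)) = (a * b) ⊗ₜ[R] Q.ideal.mkQ 1
    rw [map_mul, Q.lTensor_mkQ_mul ha', hs, hb', TensorProduct.smul_tmul', smul_eq_mul]

theorem quotCoaction_mul_of_mem (δ : A →ₐ[R] A ⊗[R] H) (Q : GenQuot R H) {S : Subalgebra R A}
    (hS : S ≤ phi δ Q) :
    ∀ s ∈ S, ∀ b, quotCoaction δ Q (s * b) = s • quotCoaction δ Q b := by
  intro s hs b
  have ha' : Q.ideal.mkQ.lTensor A (δ s) = Q.ideal.mkQ.lTensor A (s ⊗ₜ[R] (1 : H)) := hS hs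
  change Q.ideal.mkQ.lTensor A (δ (s * b)) = s • Q.ideal.mkQ.lTensor A (δ b)
  rw [map_mul, Q.lTensor_mkQ_mul ha']
  generalize δ b = y
  induction y with
  | zero => simp
  | add a b ha hb => simp only [mul_add, map_add, smul_add, ha, hb]
  | tmul a h => simp [TensorProduct.smul_tmul']

/-- `ψ(S) = ⋁ {Q | S ⊆ A^{co Q}}`. -/
def psi (δ : A →ₐ[R] A ⊗[R] H) (S : Subalgebra R A) : GenQuot R H :=
  sSup {Q | S ≤ phi δ Q}

/-- There is an antitone Galois connection between subalgebras of `A` and generalised quotients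
of `H` one of whose maps is `φ`. (The other map is then unique, and equal to `psi δ`.) -/
def GaloisConnectionExists (δ : A →ₐ[R] A ⊗[R] H) : Prop :=
  ∃ ψ : Subalgebra R A → GenQuot R H, Antitone (phi δ) ∧ Antitone ψ ∧
    (∀ S, S ≤ phi δ (ψ S)) ∧ (∀ Q, Q ≤ ψ (phi δ Q))

/-- `can_S : A ⊗_S A → A ⊗ ψ(S)`, `a ⊗ b ↦ a b₍₀₎ ⊗ π(b₍₁₎)`, is well defined (which means
`S ⊆ A^{co ψ(S)}`, automatic when the Galois connection exists) and bijective. -/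
def CanBijective (δ : A →ₐ[R] A ⊗[R] H) (S : Subalgebra R A) : Prop :=
  ∃ hS : S ≤ phi δ (psi δ S), Function.Bijective
    (canonicalMap (quotCoaction δ (psi δ S)) S (quotCoaction_mul_of_mem δ (psi δ S) hS))

end ComoduleAlgebra

section Admissible

variable {R H A : Type u} [CommRing R] [Ring H] [Algebra R H] [Coalgebra R H]
  [Ring A] [Algebra R A]

/-- Right admissible subalgebras `A^{co H} ⊆ S ⊆ A`. -/
structure IsRightAdmissible (δ : A →ₐ[R] A ⊗[R] H) (S : Subalgebra R A) : Prop where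
  coinvariants_le : coinvariants δ ≤ S
  faithfullyFlat : IsRightFaithfullyFlat R S A
  can_bijective : CanBijective δ S
  flat : Module.Flat R (H ⧸ (psi δ S).ideal)

/-- Left admissible subalgebras `A^{co H} ⊆ S ⊆ A`; here the canonical map is that of
`S^op ⊆ A^op` for the coaction of `H^op`. -/
structure IsLeftAdmissible (δ : A →ₐ[R] A ⊗[R] H) (S : Subalgebra R A) : Prop where
  coinvariants_le : coinvariants δ ≤ S
  faithfullyFlat : IsLeftFaithfullyFlat R S A
  can_bijective : CanBijective (opCoaction δ) S.op
  flat : Module.Flat R (H ⧸ (psi δ S).ideal)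

/-- `ψ` and `φ` restrict to mutually inverse bijections between the set `s` of subalgebras and
the set `t` of generalised quotients. -/
def RestrictsToBijection (δ : A →ₐ[R] A ⊗[R] H) (s : Set (Subalgebra R A))
    (t : Set (GenQuot R H)) : Prop :=
  Set.BijOn (psi δ) s t ∧ Set.BijOn (phi δ) t s ∧ Set.InvOn (phi δ) (psi δ) s t

end Admissible

end HopfGalois

end

open HopfGalois

noncomputable section

namespace HopfGalois

/-! ### Balanced tensor products -/

namespace BalancedTensor

section General

variable {R S M N P : Type*} [CommRing R] [Ring S]
  [AddCommGroup M] [Module R M] [Module Sᵐᵒᵖ M]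
  [AddCommGroup N] [Module R N] [Module S N] [AddCommGroup P] [Module R P]

variable (R S) in
/-- The class of `m ⊗ n` in `M ⊗_S N`. -/
def tmul (m : M) (n : N) : BalancedTensor R S M N :=
  (balancedRel R S M N).mkQ (m ⊗ₜ[R] n)

theorem mkQ_tmul (m : M) (n : N) :
    (balancedRel R S M N).mkQ (m ⊗ₜ[R] n) = tmul R S m n := rfl

theorem op_smul_tmul (m : M) (s : S) (n : N) :
    tmul R S (op s • m) n = tmul R S m (s • n) := by
  rw [← sub_eq_zero, ← mkQ_tmul, ← mkQ_tmul, ← map_sub]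
  exact (Submodule.Quotient.mk_eq_zero _).2 (Submodule.subset_span ⟨m, s, n, rfl⟩)

theorem tmul_add (m : M) (n n' : N) : tmul R S m (n + n') = tmul R S m n + tmul R S m n' := by
  simp only [tmul, TensorProduct.tmul_add, map_add]

theorem add_tmul (m m' : M) (n : N) : tmul R S (m + m') n = tmul R S m n + tmul R S m' n := by
  simp only [tmul, TensorProduct.add_tmul, map_add]

variable (R S N) in
/-- `n ↦ m ⊗ n` as a linear map. -/
def mkRight (m : M) : N →ₗ[R] BalancedTensor R S M N :=
  (balancedRel R S M N).mkQ ∘ₗ TensorProduct.mk R M N m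

@[simp]
theorem mkRight_apply (m : M) (n : N) : mkRight R S N m n = tmul R S m n := rfl

theorem tmul_zero (m : M) : tmul R S m (0 : N) = 0 := (mkRight R S N m).map_zero

theorem induction_on {p : BalancedTensor R S M N → Prop} (z : BalancedTensor R S M N)
    (zero : p 0) (tmul : ∀ m n, p (tmul R S m n)) (add : ∀ x y, p x → p y → p (x + y)) : p z := by
  obtain ⟨z, rfl⟩ := Submodule.mkQ_surjective _ z
  induction z with
  | zero => simpa using zero
  | tmul m n => exact tmul m n
  | add x y hx hy => rw [map_add]; exact add _ _ hx hy

theorem linearMap_ext {f g : BalancedTensor R S M N →ₗ[R] P}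
    (h : ∀ m n, f (tmul R S m n) = g (tmul R S m n)) : f = g :=
  Submodule.linearMap_qext _ (TensorProduct.ext' h)

/-- Linear maps out of `M ⊗_S N` from balanced bilinear maps. -/
def lift (f : M →ₗ[R] N →ₗ[R] P) (hf : ∀ m (s : S) n, f (op s • m) n = f m (s • n)) :
    BalancedTensor R S M N →ₗ[R] P :=
  (balancedRel R S M N).liftQ (TensorProduct.lift f) (by
    rw [balancedRel, Submodule.span_le]
    rintro _ ⟨m, s, n, rfl⟩
    simp [hf])

@[simp]
theorem lift_tmul (f : M →ₗ[R] N →ₗ[R] P) (hf : ∀ m (s : S) n, f (op s • m) n = f m (s • n))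
    (m : M) (n : N) : lift f hf (tmul R S m n) = f m n := by
  simp [lift, tmul]

end General

section MapRight

variable {R S M : Type*} [CommRing R] [Ring S] [Algebra R S]
  [AddCommGroup M] [Module R M] [Module Sᵐᵒᵖ M]
  {N N' N'' : Type*} [AddCommGroup N] [Module R N] [Module S N] [IsScalarTower R S N]
  [AddCommGroup N'] [Module R N'] [Module S N'] [IsScalarTower R S N']
  [AddCommGroup N''] [Module R N''] [Module S N''] [IsScalarTower R S N'']

@[simp]
theorem mapRight_tmul (f : N →ₗ[S] N') (m : M) (n : N) :
    mapRight (R := R) M f (tmul R S m n) = tmul R S m (f n) := rfl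

theorem mapRight_comp_apply (f : N →ₗ[S] N') (g : N' →ₗ[S] N'') (z : BalancedTensor R S M N) :
    mapRight (R := R) M (g ∘ₗ f) z = mapRight M g (mapRight M f z) := by
  induction z using induction_on with
  | zero => simp
  | tmul m n => simp
  | add x y hx hy => simp only [map_add, hx, hy]

theorem mapRight_zero_apply (z : BalancedTensor R S M N) :
    mapRight (R := R) M (0 : N →ₗ[S] N') z = 0 := by
  induction z using induction_on with
  | zero => simp
  | tmul m n => rw [mapRight_tmul, LinearMap.zero_apply, tmul_zero]
  | add x y hx hy => simp only [map_add, hx, hy, add_zero]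

theorem mapRight_surjective {f : N →ₗ[S] N'} (hf : Function.Surjective f) :
    Function.Surjective (mapRight (R := R) M f) := by
  intro z
  induction z using induction_on with
  | zero => exact ⟨0, map_zero _⟩
  | tmul m n =>
    obtain ⟨n, rfl⟩ := hf n
    exact ⟨tmul R S m n, rfl⟩
  | add x y hx hy =>
    obtain ⟨x, rfl⟩ := hx
    obtain ⟨y, rfl⟩ := hy
    exact ⟨x + y, map_add _ _ _⟩

theorem mapRight_sub_apply (f g : N →ₗ[S] N') (z : BalancedTensor R S M N) :
    mapRight (R := R) M (f - g) z = mapRight M f z - mapRight M g z := by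
  induction z using induction_on with
  | zero => simp
  | tmul m n =>
    rw [mapRight_tmul, mapRight_tmul, mapRight_tmul, LinearMap.sub_apply, sub_eq_add_neg,
      tmul_add, sub_eq_add_neg, ← mkRight_apply (n := - g n), map_neg, mkRight_apply]
  | add x y hx hy => simp only [map_add, hx, hy]; abel

/-- Right exactness of `M ⊗_S -`. -/
theorem mapRight_exact {f : N →ₗ[S] N'} {g : N' →ₗ[S] N''} (hfg : Function.Exact f g)
    (hg : Function.Surjective g) :
    Function.Exact (mapRight (R := R) M f) (mapRight (R := R) M g) := by
  intro z
  constructor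
  · intro hz
    obtain ⟨z, rfl⟩ := Submodule.mkQ_surjective _ z
    have hz' : (g.restrictScalars R).lTensor M z ∈ balancedRel R S M N'' :=
      (Submodule.Quotient.mk_eq_zero _).1 hz
    have hle : balancedRel R S M N'' ≤
        (balancedRel R S M N').map ((g.restrictScalars R).lTensor M) := by
      refine Submodule.span_le.2 ?_
      rintro _ ⟨m, s, n, rfl⟩
      obtain ⟨n, rfl⟩ := hg n
      exact ⟨_, Submodule.subset_span ⟨m, s, n, rfl⟩, by simp⟩
    obtain ⟨w, hw, hwz⟩ := hle hz'
    have hex : Function.Exact ((f.restrictScalars R).lTensor M)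
        ((g.restrictScalars R).lTensor M) := lTensor_exact M hfg hg
    obtain ⟨y, hy⟩ := (hex (z - w)).1 (by rw [map_sub, hwz, sub_self])
    refine ⟨(balancedRel R S M N).mkQ y, ?_⟩
    change (balancedRel R S M N').mkQ ((f.restrictScalars R).lTensor M y) = _
    rw [hy, map_sub, sub_eq_self]
    exact (Submodule.Quotient.mk_eq_zero _).2 hw
  · rintro ⟨y, rfl⟩
    rw [← mapRight_comp_apply, hfg.linearMap_comp_eq_zero, mapRight_zero_apply]

end MapRight

section ActionLeft

variable {R A V : Type*} [CommRing R] [Ring A] [Algebra R A] (S : Subalgebra R A)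
  [AddCommGroup V] [Module R V] [Module S V]

variable (V) in
/-- Left multiplication by an element on `A ⊗_S V`. -/
def lmul (a : A) : Module.End R (BalancedTensor R S A V) :=
  Submodule.mapQ _ _ ((LinearMap.mulLeft R a).rTensor V) (by
    rw [balancedRel, Submodule.span_le]
    rintro _ ⟨m, s, n, rfl⟩
    refine Submodule.subset_span ⟨a * m, s, n, ?_⟩
    simp [op_smul_eq_mul, mul_assoc])

theorem lmul_tmul (a b : A) (v : V) : lmul V S a (tmul R S b v) = tmul R S (a * b) v := rfl

variable (V) in
/-- Left multiplication on `A ⊗_S V`, as an algebra homomorphism. -/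
def lmulHom : A →ₐ[R] Module.End R (BalancedTensor R S A V) :=
  AlgHom.ofLinearMap
    { toFun := lmul V S
      map_add' a a' := linearMap_ext fun b v => by
        simp only [LinearMap.add_apply, lmul_tmul, add_mul, add_tmul]
      map_smul' c a := linearMap_ext fun b v => by
        simp only [RingHom.id_apply, LinearMap.smul_apply, lmul_tmul]
        simp only [tmul, smul_mul_assoc, ← TensorProduct.smul_tmul', map_smul] }
    (linearMap_ext fun b v => by
      simp only [LinearMap.coe_mk, AddHom.coe_mk, lmul_tmul, one_mul, Module.End.one_apply])
    (fun a a' => linearMap_ext fun b v => by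
      simp only [LinearMap.coe_mk, AddHom.coe_mk, lmul_tmul, mul_assoc, Module.End.mul_apply])

instance moduleLeft : Module A (BalancedTensor R S A V) :=
  Module.compHom _ (lmulHom V S).toRingHom

variable {S}

@[simp]
theorem smul_tmul (a b : A) (v : V) : a • tmul R S b v = tmul R S (a * b) v := rfl

instance isScalarTowerLeft : IsScalarTower R A (BalancedTensor R S A V) where
  smul_assoc r a z := by
    change lmulHom V S (r • a) z = r • lmulHom V S a z
    rw [map_smul, LinearMap.smul_apply]

theorem tmul_eq_smul (a : A) (v : V) : tmul R S a v = a • tmul R S 1 v := by simp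

theorem mapRight_smul [IsScalarTower R S V] {V' : Type*} [AddCommGroup V'] [Module R V']
    [Module S V'] [IsScalarTower R S V'] (f : V →ₗ[S] V') (a : A)
    (z : BalancedTensor R S A V) :
    mapRight (R := R) A f (a • z) = a • mapRight (R := R) A f z := by
  induction z using induction_on with
  | zero => simp
  | tmul m n => simp
  | add x y hx hy => simp only [map_add, smul_add, hx, hy]

end ActionLeft

end BalancedTensor

/-! ### Consequences of faithful flatness -/

section FaithfullyFlat

variable {R S M : Type u} [CommRing R] [Ring S] [Algebra R S] [AddCommGroup M] [Module R M]
  [Module Sᵐᵒᵖ M]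

theorem IsRightFaithfullyFlat.exact_iff (h : IsRightFaithfullyFlat R S M)
    {X Y Z : Type u} [AddCommGroup X] [AddCommGroup Y] [AddCommGroup Z]
    [Module R X] [Module R Y] [Module R Z] [Module S X] [Module S Y] [Module S Z]
    [IsScalarTower R S X] [IsScalarTower R S Y] [IsScalarTower R S Z]
    (f : X →ₗ[S] Y) (g : Y →ₗ[S] Z) :
    Function.Exact f g ↔ Function.Exact (BalancedTensor.mapRight (R := R) M f)
      (BalancedTensor.mapRight (R := R) M g) :=
  h X Y Z f g

theorem IsRightFaithfullyFlat.mapRight_injective (h : IsRightFaithfullyFlat R S M)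
    {X Y : Type u} [AddCommGroup X] [AddCommGroup Y] [Module R X] [Module R Y] [Module S X]
    [Module S Y] [IsScalarTower R S X] [IsScalarTower R S Y] {f : X →ₗ[S] Y}
    (hf : Function.Injective f) : Function.Injective (BalancedTensor.mapRight (R := R) M f) := by
  have h1 : Function.Exact (0 : (PUnit : Type u) →ₗ[S] X) f := by
    intro x
    constructor
    · intro hx
      exact ⟨0, by rw [map_zero, hf (hx.trans (map_zero f).symm)]⟩
    · rintro ⟨y, rfl⟩
      simp
  have h2 := (h _ _ _ _ _).1 h1
  refine (injective_iff_map_eq_zero _).2 fun z hz => ?_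
  obtain ⟨y, rfl⟩ := (h2 z).1 hz
  exact BalancedTensor.mapRight_zero_apply y

/-- A right faithfully flat overring `A` of `S` detects elements of left `S`-modules. -/
theorem IsRightFaithfullyFlat.tmul_one_injective {A : Type u} [Ring A] [Algebra R A]
    {S : Subalgebra R A} (h : IsRightFaithfullyFlat R S A)
    {Y : Type u} [AddCommGroup Y] [Module R Y] [Module S Y] [IsScalarTower R S Y] {y : Y}
    (hy : BalancedTensor.tmul R S (1 : A) y = 0) : y = 0 := by
  let N : Submodule S Y := Submodule.span S {y}
  have hz : ∀ z : BalancedTensor R S A N, z = 0 := by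
    intro z
    apply h.mapRight_injective (f := N.subtype) Subtype.val_injective
    rw [map_zero]
    induction z using BalancedTensor.induction_on with
    | zero => simp
    | tmul a n =>
      obtain ⟨n, hn⟩ := n
      obtain ⟨s, rfl⟩ := Submodule.mem_span_singleton.1 hn
      rw [BalancedTensor.mapRight_tmul, Submodule.subtype_apply, BalancedTensor.tmul_eq_smul,
        ← BalancedTensor.op_smul_tmul, op_smul_eq_mul, one_mul, BalancedTensor.tmul_eq_smul, hy,
        smul_zero, smul_zero]
    | add x y hx hy => simp only [map_add, hx, hy, add_zero]
  have h2 : Function.Exact (LinearMap.id : N →ₗ[S] N) (LinearMap.id : N →ₗ[S] N) := by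
    refine (h _ _ _ _ _).2 fun z => ?_
    exact ⟨fun _ => ⟨0, by rw [hz z, map_zero]⟩, fun _ => hz _⟩
  have h3 := (h2 ⟨y, Submodule.mem_span_singleton_self y⟩).2 ⟨_, rfl⟩
  exact congrArg Subtype.val h3

/-- Faithfully flat descent of elements. -/
theorem IsRightFaithfullyFlat.mem_of_tmul_eq {A : Type u} [Ring A] [Algebra R A]
    {S : Subalgebra R A} (h : IsRightFaithfullyFlat R S A) {a : A}
    (ha : BalancedTensor.tmul R S (1 : A) a = BalancedTensor.tmul R S a (1 : A)) : a ∈ S := by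
  let N : Submodule S A := Submodule.span S {1}
  have h1 : BalancedTensor.tmul R S (1 : A) (N.mkQ a) = 0 := by
    have := congrArg (BalancedTensor.mapRight (R := R) A N.mkQ) ha
    rw [BalancedTensor.mapRight_tmul, BalancedTensor.mapRight_tmul] at this
    rw [this, show N.mkQ (1 : A) = 0 from
      (Submodule.Quotient.mk_eq_zero _).2 (Submodule.mem_span_singleton_self 1),
      BalancedTensor.tmul_zero]
  obtain ⟨s, rfl⟩ := Submodule.mem_span_singleton.1
    ((Submodule.Quotient.mk_eq_zero _).1 (h.tmul_one_injective h1))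
  rw [Subalgebra.smul_def, smul_eq_mul, mul_one]
  exact s.2

end FaithfullyFlat

/-! ### Comparing exactness of sequences embedded in a common one -/

section Embeddings

variable {R : Type*} [CommRing R] {U₁ U₂ U₃ V₁ V₂ V₃ W₁ W₂ W₃ : Type*}
  [AddCommGroup U₁] [AddCommGroup U₂] [AddCommGroup U₃]
  [AddCommGroup V₁] [AddCommGroup V₂] [AddCommGroup V₃]
  [AddCommGroup W₁] [AddCommGroup W₂] [AddCommGroup W₃]
  [Module R U₁] [Module R U₂] [Module R U₃] [Module R V₁] [Module R V₂] [Module R V₃]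
  [Module R W₁] [Module R W₂] [Module R W₃]

theorem exact_of_range_eq {f : U₁ →ₗ[R] U₂} {g : U₂ →ₗ[R] U₃} {f' : V₁ →ₗ[R] V₂}
    {g' : V₂ →ₗ[R] V₃} {a : W₁ →ₗ[R] W₂} {b : W₂ →ₗ[R] W₃}
    {j₁ : U₁ →ₗ[R] W₁} {j₂ : U₂ →ₗ[R] W₂} {j₃ : U₃ →ₗ[R] W₃}
    {k₁ : V₁ →ₗ[R] W₁} {k₂ : V₂ →ₗ[R] W₂} {k₃ : V₃ →ₗ[R] W₃}
    (hj₂ : Function.Injective j₂) (hj₃ : Function.Injective j₃)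
    (hk₂ : Function.Injective k₂) (hk₃ : Function.Injective k₃)
    (h₁ : LinearMap.range j₁ = LinearMap.range k₁) (h₂ : LinearMap.range j₂ = LinearMap.range k₂)
    (hf : ∀ x, j₂ (f x) = a (j₁ x)) (hg : ∀ x, j₃ (g x) = b (j₂ x))
    (hf' : ∀ x, k₂ (f' x) = a (k₁ x)) (hg' : ∀ x, k₃ (g' x) = b (k₂ x))
    (h : Function.Exact f g) : Function.Exact f' g' := by
  intro y
  obtain ⟨x, hx⟩ : k₂ y ∈ LinearMap.range j₂ := h₂ ▸ ⟨y, rfl⟩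
  have e : g' y = 0 ↔ g x = 0 := by
    rw [← hk₃.eq_iff, ← hj₃.eq_iff, hg', hg, hx, map_zero, map_zero]
  rw [e, h x]
  constructor
  · rintro ⟨u, rfl⟩
    obtain ⟨v, hv⟩ : j₁ u ∈ LinearMap.range k₁ := h₁ ▸ ⟨u, rfl⟩
    exact ⟨v, hk₂ (by rw [hf', hv, ← hf, hx])⟩
  · rintro ⟨v, rfl⟩
    obtain ⟨u, hu⟩ : k₁ v ∈ LinearMap.range j₁ := h₁ ▸ ⟨v, rfl⟩
    exact ⟨u, hj₂ (by rw [hf, hu, ← hf', hx])⟩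

theorem exact_iff_of_range_eq {f : U₁ →ₗ[R] U₂} {g : U₂ →ₗ[R] U₃} {f' : V₁ →ₗ[R] V₂}
    {g' : V₂ →ₗ[R] V₃} (a : W₁ →ₗ[R] W₂) (b : W₂ →ₗ[R] W₃)
    {j₁ : U₁ →ₗ[R] W₁} {j₂ : U₂ →ₗ[R] W₂} {j₃ : U₃ →ₗ[R] W₃}
    {k₁ : V₁ →ₗ[R] W₁} {k₂ : V₂ →ₗ[R] W₂} {k₃ : V₃ →ₗ[R] W₃}
    (hj₂ : Function.Injective j₂) (hj₃ : Function.Injective j₃)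
    (hk₂ : Function.Injective k₂) (hk₃ : Function.Injective k₃)
    (h₁ : LinearMap.range j₁ = LinearMap.range k₁) (h₂ : LinearMap.range j₂ = LinearMap.range k₂)
    (hf : ∀ x, j₂ (f x) = a (j₁ x)) (hg : ∀ x, j₃ (g x) = b (j₂ x))
    (hf' : ∀ x, k₂ (f' x) = a (k₁ x)) (hg' : ∀ x, k₃ (g' x) = b (k₂ x)) :
    Function.Exact f g ↔ Function.Exact f' g' :=
  ⟨exact_of_range_eq hj₂ hj₃ hk₂ hk₃ h₁ h₂ hf hg hf' hg',
    exact_of_range_eq hk₂ hk₃ hj₂ hj₃ h₁.symm h₂.symm hf' hg' hf hg⟩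

end Embeddings

/-! ### Associativity of balanced tensor products with a module over the base -/

namespace BalancedTensor

variable {R A : Type*} [CommRing R] [Ring A] [Algebra R A] {S : Subalgebra R A} {M X : Type*}
  [AddCommGroup M] [Module R M] [Module Sᵐᵒᵖ M]
  [AddCommGroup X] [Module R X]

theorem smul_tmul_left (s : S) (a : A) (x : X) : s • (a ⊗ₜ[R] x) = (s • a) ⊗ₜ[R] x := rfl

variable (R S M X) in
/-- `M ⊗_S (A ⊗ X) → (M ⊗_S A) ⊗ X`. -/
def assocHom : BalancedTensor R S M (A ⊗[R] X) →ₗ[R] BalancedTensor R S M A ⊗[R] X :=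
  lift (LinearMap.rTensorHom X ∘ₗ (TensorProduct.mk R M A).compr₂ (balancedRel R S M A).mkQ) (by
    intro m s n
    induction n with
    | zero => simp
    | tmul n x =>
      simp only [LinearMap.comp_apply, LinearMap.coe_rTensorHom, smul_tmul_left,
        LinearMap.rTensor_tmul, LinearMap.compr₂_apply, TensorProduct.mk_apply, mkQ_tmul,
        op_smul_tmul]
    | add x y hx hy => simp only [map_add, smul_add, hx, hy])

@[simp]
theorem assocHom_tmul (m : M) (n : A) (x : X) :
    assocHom R S M X (tmul R S m (n ⊗ₜ x)) = tmul R S m n ⊗ₜ x := by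
  simp only [assocHom, lift_tmul]
  rfl

variable (R S M X) in
/-- `(M ⊗_S A) ⊗ X → M ⊗_S (A ⊗ X)`. -/
def assocInv : BalancedTensor R S M A ⊗[R] X →ₗ[R] BalancedTensor R S M (A ⊗[R] X) :=
  TensorProduct.lift (lift
    (LinearMap.mk₂ R (fun m n => mkRight R S (A ⊗[R] X) m ∘ₗ TensorProduct.mk R A X n)
      (fun m m' n => by ext x; simp [add_tmul])
      (fun c m n => by
        ext x
        simp only [LinearMap.comp_apply, mkRight_apply, LinearMap.smul_apply, tmul,
          ← TensorProduct.smul_tmul', map_smul])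
      (fun m n n' => by ext x; simp [tmul_add])
      (fun c m n => by ext x; simp))
    (by
      intro m s n
      ext x
      simp [op_smul_tmul, smul_tmul_left]))

@[simp]
theorem assocInv_tmul (m : M) (n : A) (x : X) :
    assocInv R S M X (tmul R S m n ⊗ₜ x) = tmul R S m (n ⊗ₜ x) := by
  simp [assocInv]

theorem assocInv_assocHom (z : BalancedTensor R S M (A ⊗[R] X)) :
    assocInv R S M X (assocHom R S M X z) = z := by
  induction z using induction_on with
  | zero => simp
  | tmul m n =>
    induction n with
    | zero => simp [tmul_zero]
    | tmul n x => simp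
    | add x y hx hy => simp only [tmul_add, map_add, hx, hy]
  | add x y hx hy => simp only [map_add, hx, hy]

theorem assocHom_assocInv (z : BalancedTensor R S M A ⊗[R] X) :
    assocHom R S M X (assocInv R S M X z) = z := by
  induction z with
  | zero => simp
  | tmul m x =>
    induction m using induction_on with
    | zero => simp
    | tmul m n => simp
    | add x y hx hy => simp only [TensorProduct.add_tmul, map_add, hx, hy]
  | add x y hx hy => simp only [map_add, hx, hy]

variable (R S M X) in
/-- `M ⊗_S (A ⊗ X) ≃ (M ⊗_S A) ⊗ X`. -/
def assocEquiv : BalancedTensor R S M (A ⊗[R] X) ≃ₗ[R] BalancedTensor R S M A ⊗[R] X :=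
  LinearEquiv.ofLinearMap (assocHom R S M X) (assocInv R S M X)
    (LinearMap.ext assocHom_assocInv) (LinearMap.ext assocInv_assocHom)

end BalancedTensor

/-! ### Cotensor products over Galois-type extensions -/

theorem canonicalMap_tmul {R A Q : Type*} [CommRing R] [Ring A] [Algebra R A]
    [AddCommGroup Q] [Module R Q] (d : A →ₗ[R] A ⊗[R] Q)
    (S : Subalgebra R A) (hd : ∀ s ∈ S, ∀ b, d (s * b) = s • d b) (a b : A) :
    canonicalMap d S hd (BalancedTensor.tmul R S a b) = a • d b := by
  simp [canonicalMap, BalancedTensor.tmul]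

section CotensorKernel

variable {R A Q X : Type*} [CommRing R] [Ring A] [Algebra R A]
  [AddCommGroup Q] [Module R Q] [AddCommGroup X] [Module R X]

theorem smul_rTensor_assoc {S : Subalgebra R A} (d : A →ₗ[R] A ⊗[R] Q)
    (hd : ∀ s ∈ S, ∀ b, d (s * b) = s • d b) (s : S) (z : A ⊗[R] X) :
    TensorProduct.assoc R A Q X (d.rTensor X (s • z)) =
      s • TensorProduct.assoc R A Q X (d.rTensor X z) := by
  have key : ∀ (y : A ⊗[R] Q) (x : X), TensorProduct.assoc R A Q X (((s : A) • y) ⊗ₜ[R] x) =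
      s • TensorProduct.assoc R A Q X (y ⊗ₜ[R] x) := by
    intro y x
    induction y with
    | zero => simp
    | tmul a q => simp [TensorProduct.smul_tmul', Subalgebra.smul_def]
    | add y z hy hz => simp only [smul_add, TensorProduct.add_tmul, map_add, hy, hz]
  induction z with
  | zero => simp
  | tmul a x =>
    rw [BalancedTensor.smul_tmul_left, LinearMap.rTensor_tmul, LinearMap.rTensor_tmul,
      Subalgebra.smul_def, smul_eq_mul, hd s s.2, key]
  | add x y hx hy => simp only [smul_add, map_add, hx, hy]

/-- `A ⊗ f` as a map of modules over a subalgebra of `A`. -/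
def lTensorOver (S : Subalgebra R A) {Y : Type*} [AddCommGroup Y] [Module R Y] (f : X →ₗ[R] Y) :
    A ⊗[R] X →ₗ[S] A ⊗[R] Y where
  toFun := f.lTensor A
  map_add' := map_add _
  map_smul' s z := (TensorProduct.AlgebraTensorModule.lTensor A A f).map_smul (s : A) z

@[simp]
theorem lTensorOver_apply (S : Subalgebra R A) {Y : Type*} [AddCommGroup Y] [Module R Y]
    (f : X →ₗ[R] Y) (z : A ⊗[R] X) : lTensorOver S f z = f.lTensor A z := rfl

/-- The map `A ⊗ X → A ⊗ Q ⊗ X` with kernel the cotensor product, as a map of `S`-modules. -/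
def cotensorDiff {S : Subalgebra R A} (d : A →ₗ[R] A ⊗[R] Q)
    (hd : ∀ s ∈ S, ∀ b, d (s * b) = s • d b) (ρ : X →ₗ[R] Q ⊗[R] X) :
    A ⊗[R] X →ₗ[S] A ⊗[R] (Q ⊗[R] X) where
  toFun z := TensorProduct.assoc R A Q X (d.rTensor X z) - ρ.lTensor A z
  map_add' x y := by simp only [map_add]; abel
  map_smul' s z := by
    rw [smul_rTensor_assoc d hd, RingHom.id_apply, smul_sub]
    congr 1
    exact (lTensorOver S ρ).map_smul s z

end CotensorKernel

section CotensorGalois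

variable {R A Q C : Type u} [CommRing R] [Ring A] [Algebra R A]
  [AddCommGroup Q] [Module R Q] [AddCommGroup C] [Module R C]
  {S : Subalgebra R A} {d : A →ₗ[R] A ⊗[R] C} (hd : ∀ s ∈ S, ∀ b, d (s * b) = s • d b)
  {δQ : A →ₗ[R] A ⊗[R] Q} (hδQ : ∀ s ∈ S, ∀ b, δQ (s * b) = s • δQ b)
  {ρC : C →ₗ[R] C ⊗[R] Q}
  (hρ : (TensorProduct.assoc R A C Q).toLinearMap ∘ₗ d.rTensor Q ∘ₗ δQ = ρC.lTensor A ∘ₗ d)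

variable (X Y : Type u) [AddCommGroup X] [Module R X] [AddCommGroup Y] [Module R Y]

/-- `A ⊗_S (A ⊗ X) → A ⊗ (C ⊗ X)`, `a ⊗ b ⊗ x ↦ a d(b) ⊗ x`. -/
def canTensor : BalancedTensor R S A (A ⊗[R] X) →ₗ[R] A ⊗[R] (C ⊗[R] X) :=
  (TensorProduct.assoc R A C X).toLinearMap ∘ₗ (canonicalMap d S hd).rTensor X ∘ₗ
    BalancedTensor.assocHom R S A X

variable {X}

theorem canTensor_tmul (a b : A) (x : X) :
    canTensor hd X (BalancedTensor.tmul R S a (b ⊗ₜ x)) =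
      TensorProduct.assoc R A C X ((a • d b) ⊗ₜ x) := by
  simp only [canTensor, LinearMap.comp_apply, BalancedTensor.assocHom_tmul,
    LinearMap.rTensor_tmul, canonicalMap_tmul, LinearEquiv.coe_coe]

theorem canTensor_bijective (h : Function.Bijective (canonicalMap d S hd)) :
    Function.Bijective (canTensor hd X) := by
  have := ((BalancedTensor.assocEquiv R S A X).trans
    ((LinearEquiv.rTensor X (LinearEquiv.ofBijective _ h)).trans
      (TensorProduct.assoc R A C X))).bijective
  exact this

theorem canTensor_mapRight {Y : Type u} [AddCommGroup Y] [Module R Y] (f : X →ₗ[R] Y)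
    (z : BalancedTensor R S A (A ⊗[R] X)) :
    canTensor hd Y (BalancedTensor.mapRight (R := R) A
      (lTensorOver S f) z) =
      (f.lTensor C).lTensor A (canTensor hd X z) := by
  induction z using BalancedTensor.induction_on with
  | zero => simp
  | add x y hx hy => simp only [map_add, hx, hy]
  | tmul a n =>
    induction n with
    | zero => simp [BalancedTensor.tmul_zero]
    | add x y hx hy => simp only [map_add, BalancedTensor.tmul_add] at hx hy ⊢; rw [hx, hy]
    | tmul b x =>
      rw [BalancedTensor.mapRight_tmul, lTensorOver_apply, LinearMap.lTensor_tmul,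
        canTensor_tmul, canTensor_tmul]
      generalize a • d b = y
      induction y with
      | zero => simp
      | add x y hx hy => simp only [map_add, TensorProduct.add_tmul, hx, hy]
      | tmul a c => simp

include hρ in
theorem canTensor_cotensorDiff (ρ : X →ₗ[R] Q ⊗[R] X) (z : BalancedTensor R S A (A ⊗[R] X)) :
    canTensor hd (Q ⊗[R] X) (BalancedTensor.mapRight (R := R) A (cotensorDiff δQ hδQ ρ) z) =
      ((TensorProduct.assoc R C Q X).toLinearMap ∘ₗ ρC.rTensor X - ρ.lTensor C).lTensor A
        (canTensor hd X z) := by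
  have key : ∀ (a b : A) (x : X), canTensor hd (Q ⊗[R] X) (BalancedTensor.tmul R S a
      (TensorProduct.assoc R A Q X (δQ b ⊗ₜ x))) =
      ((TensorProduct.assoc R C Q X).toLinearMap ∘ₗ ρC.rTensor X).lTensor A
        (TensorProduct.assoc R A C X ((a • d b) ⊗ₜ x)) := by
    intro a b x
    have e1 : ∀ y : A ⊗[R] Q, canTensor hd (Q ⊗[R] X) (BalancedTensor.tmul R S a
        (TensorProduct.assoc R A Q X (y ⊗ₜ x))) =
        a • (TensorProduct.assoc R C Q X).toLinearMap.lTensor A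
          (TensorProduct.assoc R A (C ⊗[R] Q) X
            (TensorProduct.assoc R A C Q (d.rTensor Q y) ⊗ₜ x)) := by
      intro y
      induction y with
      | zero => simp [BalancedTensor.tmul_zero]
      | add y z hy hz =>
        simp only [TensorProduct.add_tmul, map_add, BalancedTensor.tmul_add, smul_add, hy, hz]
      | tmul b q =>
        rw [TensorProduct.assoc_tmul, canTensor_tmul, LinearMap.rTensor_tmul]
        generalize d b = w
        induction w with
        | zero => simp
        | add y z hy hz =>
          simp only [TensorProduct.add_tmul, map_add, smul_add, hy, hz]
        | tmul b' c => simp [TensorProduct.smul_tmul']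
    have e2 : TensorProduct.assoc R A C Q (d.rTensor Q (δQ b)) = ρC.lTensor A (d b) :=
      LinearMap.congr_fun hρ b
    rw [e1, e2]
    generalize d b = w
    induction w with
    | zero => simp
    | add y z hy hz => simp only [TensorProduct.add_tmul, map_add, smul_add, hy, hz]
    | tmul b' c =>
      simp only [LinearMap.lTensor_tmul, TensorProduct.assoc_tmul, TensorProduct.smul_tmul',
        LinearMap.comp_apply, LinearMap.rTensor_tmul]
  have e3 := canTensor_mapRight hd ρ z
  rw [LinearMap.lTensor_sub, LinearMap.sub_apply, ← e3]
  clear e3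
  induction z using BalancedTensor.induction_on with
  | zero => simp
  | add x y hx hy => simp only [map_add, hx, hy]; abel
  | tmul a n =>
    rw [BalancedTensor.mapRight_tmul, BalancedTensor.mapRight_tmul, eq_sub_iff_add_eq, ← map_add,
      ← BalancedTensor.tmul_add]
    have : cotensorDiff δQ hδQ ρ n + lTensorOver S ρ n =
      TensorProduct.assoc R A Q X (δQ.rTensor X n) := sub_add_cancel _ _
    rw [this]
    induction n with
    | zero => simp [BalancedTensor.tmul_zero]
    | add x y hx hy =>
      simp only [map_add, BalancedTensor.tmul_add]
      rw [hx (sub_add_cancel _ _), hy (sub_add_cancel _ _)]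
    | tmul b x => rw [LinearMap.rTensor_tmul, key, canTensor_tmul]

/-- The embedding of `A ⊗_S (A □_Q X)` into `A ⊗ (C ⊗ X)`. -/
def cotensorEmb (ρ : X →ₗ[R] Q ⊗[R] X) :
    BalancedTensor R S A (LinearMap.ker (cotensorDiff δQ hδQ ρ)) →ₗ[R] A ⊗[R] (C ⊗[R] X) :=
  canTensor hd X ∘ₗ BalancedTensor.mapRight (R := R) A
    (LinearMap.ker (cotensorDiff δQ hδQ ρ)).subtype

theorem cotensorEmb_injective (hS : IsRightFaithfullyFlat R S A)
    (h : Function.Bijective (canonicalMap d S hd)) (ρ : X →ₗ[R] Q ⊗[R] X) :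
    Function.Injective (cotensorEmb hd hδQ ρ) :=
  (canTensor_bijective hd h).1.comp (hS.mapRight_injective Subtype.val_injective)

theorem exact_cotensor_subtype (ρC : C →ₗ[R] C ⊗[R] Q) (ρ : X →ₗ[R] Q ⊗[R] X) :
    Function.Exact (cotensor ρC ρ).subtype
      ((TensorProduct.assoc R C Q X).toLinearMap ∘ₗ ρC.rTensor X - ρ.lTensor C) := by
  rw [LinearMap.exact_iff, Submodule.range_subtype]
  ext z
  rw [LinearMap.mem_ker, LinearMap.sub_apply, sub_eq_zero]
  rfl

theorem mem_range_cotensorEmb (hS : IsRightFaithfullyFlat R S A)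
    (h : Function.Bijective (canonicalMap d S hd)) (ρ : X →ₗ[R] Q ⊗[R] X)
    (z : BalancedTensor R S A (A ⊗[R] X)) :
    canTensor hd X z ∈ LinearMap.range (cotensorEmb hd hδQ ρ) ↔
      BalancedTensor.mapRight (R := R) A (cotensorDiff δQ hδQ ρ) z = 0 := by
  have h1 := (hS.exact_iff (X := LinearMap.ker (cotensorDiff δQ hδQ ρ))
    (LinearMap.ker (cotensorDiff δQ hδQ ρ)).subtype
    (cotensorDiff δQ hδQ ρ)).1 (LinearMap.exact_subtype_ker_map _)
  refine Iff.trans ?_ (h1 z).symm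
  exact exists_congr fun y => (canTensor_bijective hd h).1.eq_iff

include hρ in
theorem range_cotensorEmb [Module.Flat R A] (hS : IsRightFaithfullyFlat R S A)
    (h : Function.Bijective (canonicalMap d S hd)) (ρ : X →ₗ[R] Q ⊗[R] X) :
    LinearMap.range (cotensorEmb hd hδQ ρ) =
      LinearMap.range ((cotensor ρC ρ).subtype.lTensor A) := by
  have h3 := Module.Flat.lTensor_exact A (exact_cotensor_subtype ρC ρ)
  ext w
  obtain ⟨z, rfl⟩ := (canTensor_bijective hd h).2 w
  rw [mem_range_cotensorEmb hd hδQ hS h]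
  refine Iff.trans ?_ (h3 _)
  rw [← canTensor_cotensorDiff hd hδQ hρ, ← (canTensor_bijective hd h).1.eq_iff, map_zero]

include hd hδQ hρ in
/-- Cotensoring with `A` or with `C` detects exactness alike, if `A ⊗_S A ≃ A ⊗ C`. -/
theorem cotensor_exact_iff (hA : Module.FaithfullyFlat R A) (hS : IsRightFaithfullyFlat R S A)
    (h : Function.Bijective (canonicalMap d S hd))
    {X Y Z : Type u} [AddCommGroup X] [AddCommGroup Y] [AddCommGroup Z]
    [Module R X] [Module R Y] [Module R Z]
    {ρX : X →ₗ[R] Q ⊗[R] X} {ρY : Y →ₗ[R] Q ⊗[R] Y} {ρZ : Z →ₗ[R] Q ⊗[R] Z}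
    (f : X →ₗ[R] Y) (g : Y →ₗ[R] Z)
    (hf : ρY ∘ₗ f = f.lTensor Q ∘ₗ ρX) (hg : ρZ ∘ₗ g = g.lTensor Q ∘ₗ ρY) :
    Function.Exact (cotensorMapRight δQ f hf) (cotensorMapRight δQ g hg) ↔
      Function.Exact (cotensorMapRight ρC f hf) (cotensorMapRight ρC g hg) := by
  have mem : ∀ {X : Type u} [AddCommGroup X] [Module R X] (ρ : X →ₗ[R] Q ⊗[R] X) (z : A ⊗[R] X),
      z ∈ LinearMap.ker (cotensorDiff δQ hδQ ρ) ↔ z ∈ cotensor δQ ρ :=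
    fun ρ z => sub_eq_zero
  let f' : LinearMap.ker (cotensorDiff δQ hδQ ρX) →ₗ[S] LinearMap.ker (cotensorDiff δQ hδQ ρY) :=
    (lTensorOver S f).restrict fun z hz =>
      (mem _ _).2 (cotensorMapRight δQ f hf ⟨z, (mem _ _).1 hz⟩).2
  let g' : LinearMap.ker (cotensorDiff δQ hδQ ρY) →ₗ[S] LinearMap.ker (cotensorDiff δQ hδQ ρZ) :=
    (lTensorOver S g).restrict fun z hz =>
      (mem _ _).2 (cotensorMapRight δQ g hg ⟨z, (mem _ _).1 hz⟩).2
  have e1 : Function.Exact (cotensorMapRight δQ f hf) (cotensorMapRight δQ g hg) ↔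
      Function.Exact f' g' := by
    constructor
    · intro H y
      have := H ⟨y.1, (mem _ _).1 y.2⟩
      rw [Subtype.ext_iff] at this ⊢
      refine this.trans ⟨?_, ?_⟩
      · rintro ⟨x, hx⟩
        exact ⟨⟨x.1, (mem _ _).2 x.2⟩, Subtype.ext (by have := congrArg Subtype.val hx; exact this)⟩
      · rintro ⟨x, hx⟩
        exact ⟨⟨x.1, (mem _ _).1 x.2⟩, Subtype.ext (by have := congrArg Subtype.val hx; exact this)⟩
    · intro H y
      have := H ⟨y.1, (mem _ _).2 y.2⟩
      rw [Subtype.ext_iff] at this ⊢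
      refine this.trans ⟨?_, ?_⟩
      · rintro ⟨x, hx⟩
        exact ⟨⟨x.1, (mem _ _).1 x.2⟩, Subtype.ext (by have := congrArg Subtype.val hx; exact this)⟩
      · rintro ⟨x, hx⟩
        exact ⟨⟨x.1, (mem _ _).2 x.2⟩, Subtype.ext (by have := congrArg Subtype.val hx; exact this)⟩
  refine e1.trans ((hS.exact_iff (X := LinearMap.ker (cotensorDiff δQ hδQ ρX))
    (Y := LinearMap.ker (cotensorDiff δQ hδQ ρY)) (Z := LinearMap.ker (cotensorDiff δQ hδQ ρZ))
    f' g').trans (Iff.trans ?_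
    (Module.FaithfullyFlat.lTensor_exact_iff_exact R A _ _)))
  refine exact_iff_of_range_eq ((f.lTensor C).lTensor A) ((g.lTensor C).lTensor A)
    (cotensorEmb_injective hd hδQ hS h ρY) (cotensorEmb_injective hd hδQ hS h ρZ)
    (Module.Flat.lTensor_preserves_injective_linearMap (cotensor ρC ρY).subtype
      Subtype.val_injective)
    (Module.Flat.lTensor_preserves_injective_linearMap (cotensor ρC ρZ).subtype
      Subtype.val_injective)
    (range_cotensorEmb hd hδQ hρ hS h ρX) (range_cotensorEmb hd hδQ hρ hS h ρY) ?_ ?_ ?_ ?_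
  · intro x
    change canTensor hd _ _ = _
    rw [← BalancedTensor.mapRight_comp_apply]
    refine Eq.trans ?_ (canTensor_mapRight hd f _)
    rw [← BalancedTensor.mapRight_comp_apply]
    rfl
  · intro x
    change canTensor hd _ _ = _
    rw [← BalancedTensor.mapRight_comp_apply]
    refine Eq.trans ?_ (canTensor_mapRight hd g _)
    rw [← BalancedTensor.mapRight_comp_apply]
    rfl
  · intro x
    rw [← LinearMap.lTensor_comp_apply, ← LinearMap.lTensor_comp_apply]
    rfl
  · intro x
    rw [← LinearMap.lTensor_comp_apply, ← LinearMap.lTensor_comp_apply]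
    rfl

end CotensorGalois

/-! ### Skew antipodes and twisted coactions -/

/-- `σ` behaves like the inverse of the antipode of a Hopf algebra. -/
structure IsSkewAntipode {R H : Type*} [CommRing R] [Ring H] [Bialgebra R H]
    (σ : H →ₗ[R] H) : Prop where
  map_one : σ 1 = 1
  map_mul : ∀ g h, σ (g * h) = σ h * σ g
  counit : ∀ h, Coalgebra.counit (R := R) (σ h) = Coalgebra.counit h
  comul : ∀ h, Coalgebra.comul (R := R) (σ h) =
    TensorProduct.comm R H H (TensorProduct.map σ σ (Coalgebra.comul h))
  mul_rTensor_comm : ∀ h, LinearMap.mul' R H (σ.rTensor H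
    (TensorProduct.comm R H H (Coalgebra.comul h))) = algebraMap R H (Coalgebra.counit h)
  mul_lTensor_comm : ∀ h, LinearMap.mul' R H (σ.lTensor H
    (TensorProduct.comm R H H (Coalgebra.comul h))) = algebraMap R H (Coalgebra.counit h)

section Twist

variable {R H A : Type*} [CommRing R] [Ring H] [Bialgebra R H] [Ring A] [Algebra R A]

/-- The left coaction `a ↦ σ(a₍₁₎) ⊗ a₍₀₎`. -/
def twist (σ : H →ₗ[R] H) (δ : A →ₐ[R] A ⊗[R] H) : A →ₗ[R] H ⊗[R] A :=
  (TensorProduct.comm R A H).toLinearMap ∘ₗ σ.lTensor A ∘ₗ δ.toLinearMap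

theorem twist_apply (σ : H →ₗ[R] H) (δ : A →ₐ[R] A ⊗[R] H) (a : A) :
    twist σ δ a = TensorProduct.comm R A H (σ.lTensor A (δ a)) := rfl

variable {σ : H →ₗ[R] H} {δ : A →ₐ[R] A ⊗[R] H}

theorem IsRightCoaction.rTensor_apply {M C : Type*} [AddCommGroup M] [Module R M]
    [AddCommGroup C] [Module R C] [Coalgebra R C] {d : M →ₗ[R] M ⊗[R] C} (hd : IsRightCoaction d)
    (a : M) : d.rTensor C (d a) =
      (TensorProduct.assoc R M C C).symm ((Coalgebra.comul (R := R)).lTensor M (d a)) := by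
  rw [LinearEquiv.eq_symm_apply]
  exact LinearMap.congr_fun hd.coassoc a

theorem IsRightCoaction.lTensor_counit_apply {M C : Type*} [AddCommGroup M] [Module R M]
    [AddCommGroup C] [Module R C] [Coalgebra R C] {d : M →ₗ[R] M ⊗[R] C} (hd : IsRightCoaction d)
    (a : M) : (Coalgebra.counit (R := R)).lTensor M (d a) = a ⊗ₜ 1 :=
  LinearMap.congr_fun hd.counit a

theorem isLeftCoaction_twist (hσ : IsSkewAntipode σ) (hδ : IsRightCoaction δ.toLinearMap) :
    IsLeftCoaction (twist σ δ) where
  coassoc := by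
    ext a
    have key : ∀ x : A ⊗[R] H, (TensorProduct.assoc R H H A) ((Coalgebra.comul (R := R)).rTensor A
        (TensorProduct.comm R A H (σ.lTensor A x))) =
        (TensorProduct.comm R (A ⊗[R] H) H ≪≫ₗ
          LinearEquiv.lTensor H (TensorProduct.comm R A H)) (TensorProduct.map
          (σ.lTensor A) σ ((TensorProduct.assoc R A H H).symm
            ((Coalgebra.comul (R := R)).lTensor A x))) := by
      intro x
      induction x with
      | zero => simp
      | add x y hx hy => simp only [map_add, hx, hy]
      | tmul a h =>
        simp only [LinearMap.lTensor_tmul, TensorProduct.comm_tmul, LinearMap.rTensor_tmul,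
          hσ.comul]
        generalize Coalgebra.comul (R := R) h = y
        induction y with
        | zero => simp
        | add x y hx hy => simp only [map_add, TensorProduct.add_tmul, TensorProduct.tmul_add, hx, hy]
        | tmul h k => simp
    have key2 : ∀ x : A ⊗[R] H, (twist σ δ).lTensor H
        (TensorProduct.comm R A H (σ.lTensor A x)) =
        (TensorProduct.comm R (A ⊗[R] H) H ≪≫ₗ
          LinearEquiv.lTensor H (TensorProduct.comm R A H)) (TensorProduct.map
          (σ.lTensor A) σ (δ.toLinearMap.rTensor H x)) := by
      intro x
      induction x with
      | zero => simp
      | add x y hx hy => simp only [map_add, hx, hy]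
      | tmul a h => simp [twist_apply]
    have e := hδ.rTensor_apply a
    simp only [LinearMap.comp_apply, twist_apply, LinearEquiv.coe_coe, key, key2]
    rw [AlgHom.toLinearMap_apply] at e
    rw [e]
  counit := by
    ext a
    have key : ∀ x : A ⊗[R] H, (Coalgebra.counit (R := R)).rTensor A
        (TensorProduct.comm R A H (σ.lTensor A x)) =
        TensorProduct.comm R A R ((Coalgebra.counit (R := R)).lTensor A x) := by
      intro x
      induction x with
      | zero => simp
      | add x y hx hy => simp only [map_add, hx, hy]
      | tmul a h => simp [hσ.counit]
    simp only [LinearMap.comp_apply, twist_apply, key]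
    have := hδ.lTensor_counit_apply a
    rw [AlgHom.toLinearMap_apply] at this
    rw [this]
    simp

/-- `a₍₀₎ ⊗ σ(a₍₂₎) a₍₁₎ = a ⊗ 1`. -/
theorem twist_mul_coaction (hσ : IsSkewAntipode σ) (hδ : IsRightCoaction δ.toLinearMap)
    {F : H ⊗[R] A →ₗ[R] A ⊗[R] H} (hF : ∀ h a, F (h ⊗ₜ a) = (1 ⊗ₜ h) * δ a) (a : A) :
    F (twist σ δ a) = a ⊗ₜ 1 := by
  let n : (A ⊗[R] H) ⊗[R] H →ₗ[R] A ⊗[R] H :=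
    (LinearMap.mul' R H ∘ₗ σ.rTensor H ∘ₗ (TensorProduct.comm R H H).toLinearMap).lTensor A ∘ₗ
      (TensorProduct.assoc R A H H).toLinearMap
  have key : ∀ x : A ⊗[R] H, F (TensorProduct.comm R A H (σ.lTensor A x)) =
      n (δ.toLinearMap.rTensor H x) := by
    intro x
    induction x with
    | zero => simp
    | add x y hx hy => simp only [map_add, hx, hy]
    | tmul a h =>
      rw [LinearMap.lTensor_tmul, TensorProduct.comm_tmul, hF, LinearMap.rTensor_tmul,
        AlgHom.toLinearMap_apply]
      generalize δ a = y
      induction y with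
      | zero => simp
      | add x y hx hy => simp only [map_add, mul_add, TensorProduct.add_tmul, hx, hy]
      | tmul b k => simp [n]
  have key2 : ∀ x : A ⊗[R] H, n ((TensorProduct.assoc R A H H).symm
      ((Coalgebra.comul (R := R)).lTensor A x)) =
      (Algebra.linearMap R H).lTensor A ((Coalgebra.counit (R := R)).lTensor A x) := by
    intro x
    induction x with
    | zero => simp
    | add x y hx hy => simp only [map_add, hx, hy]
    | tmul a h => simp [n, hσ.mul_rTensor_comm]
  rw [twist_apply, key, ← AlgHom.toLinearMap_apply, hδ.rTensor_apply, key2,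
    hδ.lTensor_counit_apply]
  simp

/-- `b₍₂₎ σ(b₍₁₎) ⊗ b₍₀₎ = 1 ⊗ b`. -/
theorem coaction_mul_twist (hσ : IsSkewAntipode σ) (hδ : IsRightCoaction δ.toLinearMap)
    {F : A ⊗[R] H →ₗ[R] H ⊗[R] A} (hF : ∀ a h, F (a ⊗ₜ h) = (h ⊗ₜ 1) * twist σ δ a) (b : A) :
    F (δ b) = 1 ⊗ₜ b := by
  let n : (A ⊗[R] H) ⊗[R] H →ₗ[R] H ⊗[R] A :=
    (TensorProduct.comm R A H).toLinearMap ∘ₗ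
    (LinearMap.mul' R H ∘ₗ σ.lTensor H ∘ₗ (TensorProduct.comm R H H).toLinearMap).lTensor A ∘ₗ
      (TensorProduct.assoc R A H H).toLinearMap
  have key : ∀ x : A ⊗[R] H, F x = n (δ.toLinearMap.rTensor H x) := by
    intro x
    induction x with
    | zero => simp
    | add x y hx hy => simp only [map_add, hx, hy]
    | tmul a h =>
      rw [hF, LinearMap.rTensor_tmul, AlgHom.toLinearMap_apply, twist_apply]
      generalize δ a = y
      induction y with
      | zero => simp
      | add x y hx hy => simp only [map_add, mul_add, TensorProduct.add_tmul, hx, hy]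
      | tmul b k => simp [n]
  have key2 : ∀ x : A ⊗[R] H, n ((TensorProduct.assoc R A H H).symm
      ((Coalgebra.comul (R := R)).lTensor A x)) = TensorProduct.comm R A H
      ((Algebra.linearMap R H).lTensor A ((Coalgebra.counit (R := R)).lTensor A x)) := by
    intro x
    induction x with
    | zero => simp
    | add x y hx hy => simp only [map_add, hx, hy]
    | tmul a h => simp [n, hσ.mul_lTensor_comm]
  rw [key, ← AlgHom.toLinearMap_apply, hδ.rTensor_apply, key2, hδ.lTensor_counit_apply]
  simp

theorem twist_of_mem_coinvariants (hσ : IsSkewAntipode σ) {b : A} (hb : b ∈ coinvariants δ) :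
    twist σ δ b = 1 ⊗ₜ b := by
  have hb' : δ b = b ⊗ₜ[R] 1 := hb
  rw [twist_apply, hb']
  simp [hσ.map_one]

end Twist

/-! ### Diagonal actions -/

section Diagonal

variable {R H A : Type*} [CommRing R] [Ring H] [Bialgebra R H] [Ring A] [Algebra R A]
  {X M : Type*} [AddCommGroup X] [Module R X] [AddCommGroup M] [Module R M]

/-- A right action of `H` on `X`. -/
structure IsRightAction (r : H →ₗ[R] Module.End R X) : Prop where
  map_one : r 1 = 1
  map_mul : ∀ g h, r (g * h) = r h * r g

/-- The action of `H ⊗ A` on `X ⊗ M`. -/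
def tensorAct (r : H →ₗ[R] Module.End R X) (α : A →ₐ[R] Module.End R M) :
    H ⊗[R] A →ₗ[R] Module.End R (X ⊗[R] M) :=
  TensorProduct.homTensorHomMap (RingHom.id R) X M X M ∘ₗ TensorProduct.map r α.toLinearMap

@[simp]
theorem tensorAct_tmul_tmul (r : H →ₗ[R] Module.End R X) (α : A →ₐ[R] Module.End R M)
    (h : H) (a : A) (x : X) (m : M) :
    tensorAct r α (h ⊗ₜ a) (x ⊗ₜ m) = r h x ⊗ₜ α a m := rfl

variable {σ : H →ₗ[R] H} (hσ : IsSkewAntipode σ) (δ : A →ₐ[R] A ⊗[R] H)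
  {r : H →ₗ[R] Module.End R X} (hr : IsRightAction r) (α : A →ₐ[R] Module.End R M)

include hσ hr in
theorem tensorAct_twist_mul (a b : A) : tensorAct r α (twist σ δ (a * b)) =
    tensorAct r α (twist σ δ a) * tensorAct r α (twist σ δ b) := by
  simp only [twist_apply, map_mul]
  generalize δ a = x
  generalize δ b = y
  induction x with
  | zero => simp
  | add x x' hx hx' => simp only [add_mul, map_add, hx, hx']
  | tmul a h =>
    induction y with
    | zero => simp
    | add y y' hy hy' => simp only [mul_add, map_add, hy, hy']
    | tmul b k =>
      apply TensorProduct.ext'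
      intro x m
      simp [hσ.map_mul, hr.map_mul]

/-- The diagonal action of `A` on `X ⊗ M`, `a (x ⊗ m) = x σ(a₍₁₎) ⊗ a₍₀₎ m`. -/
def diag : A →ₐ[R] Module.End R (X ⊗[R] M) :=
  AlgHom.ofLinearMap (tensorAct r α ∘ₗ twist σ δ)
    (by
      apply TensorProduct.ext'
      intro x m
      simp [twist_apply, Algebra.TensorProduct.one_def, hσ.map_one, hr.map_one])
    (tensorAct_twist_mul hσ δ hr α)

theorem diag_apply (a : A) : diag hσ δ hr α a = tensorAct r α (twist σ δ a) := rfl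

theorem diag_of_mem_coinvariants {b : A} (hb : b ∈ coinvariants δ) (x : X) (m : M) :
    diag hσ δ hr α b (x ⊗ₜ m) = x ⊗ₜ α b m := by
  rw [diag_apply, twist_of_mem_coinvariants hσ hb, tensorAct_tmul_tmul, hr.map_one]
  rfl

theorem lTensor_diag {N : Type*} [AddCommGroup N] [Module R N] (β : A →ₐ[R] Module.End R N)
    (f : M →ₗ[R] N) (hf : ∀ a m, f (α a m) = β a (f m)) (a : A) (z : X ⊗[R] M) :
    f.lTensor X (diag hσ δ hr α a z) = diag hσ δ hr β a (f.lTensor X z) := by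
  rw [diag_apply, diag_apply]
  generalize twist σ δ a = w
  induction w with
  | zero => simp
  | add x y hx hy => simp only [map_add, LinearMap.add_apply, hx, hy]
  | tmul h a =>
    induction z with
    | zero => simp
    | add x y hx hy => simp only [map_add, hx, hy]
    | tmul x m => simp [hf]

end Diagonal

section MulRight

variable {R H : Type*} [CommRing R] [Ring H] [Algebra R H] [Coalgebra R H]

/-- The right action of `H` on a generalised quotient. -/
def GenQuot.act (Q : GenQuot R H) : H →ₗ[R] Module.End R (H ⧸ Q.ideal) where
  toFun := Q.mulRight
  map_add' g h := Submodule.linearMap_qext _ (LinearMap.ext fun x => by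
    change Q.ideal.mkQ (x * (g + h)) = Q.ideal.mkQ (x * g) + Q.ideal.mkQ (x * h)
    rw [mul_add, map_add])
  map_smul' c h := Submodule.linearMap_qext _ (LinearMap.ext fun x => by
    change Q.ideal.mkQ (x * (c • h)) = c • Q.ideal.mkQ (x * h)
    rw [mul_smul_comm, map_smul])

@[simp]
theorem GenQuot.act_mkQ (Q : GenQuot R H) (h x : H) :
    Q.act h (Q.ideal.mkQ x) = Q.ideal.mkQ (x * h) := rfl

end MulRight

theorem GenQuot.isRightAction {R H : Type*} [CommRing R] [Ring H] [Bialgebra R H]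
    (Q : GenQuot R H) : IsRightAction Q.act where
  map_one := Submodule.linearMap_qext _ (LinearMap.ext fun x => by
    change Q.ideal.mkQ (x * 1) = Q.ideal.mkQ x
    rw [mul_one])
  map_mul g h := Submodule.linearMap_qext _ (LinearMap.ext fun x => by
    change Q.ideal.mkQ (x * (g * h)) = Q.ideal.mkQ (x * g * h)
    rw [mul_assoc])

theorem isRightAction_mul_flip {R H : Type*} [CommRing R] [Ring H] [Bialgebra R H] :
    IsRightAction (LinearMap.mul R H).flip where
  map_one := LinearMap.ext fun x => mul_one x
  map_mul g h := LinearMap.ext fun x => (mul_assoc x g h).symm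

/-! ### Hopf modules -/

section HopfModule

variable {R H A : Type*} [CommRing R] [Ring H] [Bialgebra R H] [Ring A] [Algebra R A]
  {M : Type*} [AddCommGroup M] [Module R M]
  {σ : H →ₗ[R] H} (hσ : IsSkewAntipode σ) (δ : A →ₐ[R] A ⊗[R] H) (Q : GenQuot R H)
  (α : A →ₐ[R] Module.End R M)

/-- The coaction `lam` of `Q` on the `A`-module `M` is compatible with the action of `A`. -/
structure IsHopfModule (lam : M →ₗ[R] (H ⧸ Q.ideal) ⊗[R] M) : Prop where
  coaction : IsLeftCoaction lam
  map_act : ∀ a m, lam (α a m) = diag hσ δ Q.isRightAction α a (lam m)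

theorem GenQuot.comul_act (Q : GenQuot R H) (h : H) (q : H ⧸ Q.ideal) :
    Coalgebra.comul (R := R) (Q.act h q) =
      TensorProduct.homTensorHomMap (RingHom.id R) _ _ _ _ (TensorProduct.map Q.act Q.act
        (Coalgebra.comul (R := R) h)) (Coalgebra.comul (R := R) q) := by
  obtain ⟨x, rfl⟩ := Q.ideal.mkQ_surjective q
  rw [Q.act_mkQ]
  change TensorProduct.map Q.ideal.mkQ Q.ideal.mkQ (Coalgebra.comul (R := R) (x * h)) =
    TensorProduct.homTensorHomMap (RingHom.id R) _ _ _ _ (TensorProduct.map Q.act Q.act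
        (Coalgebra.comul (R := R) h)) (TensorProduct.map Q.ideal.mkQ Q.ideal.mkQ
          (Coalgebra.comul (R := R) x))
  rw [Bialgebra.comul_mul]
  generalize Coalgebra.comul (R := R) x = y
  generalize Coalgebra.comul (R := R) h = z
  induction y with
  | zero => simp
  | add y y' hy hy' => simp only [add_mul, map_add, hy, hy']
  | tmul y y' =>
    induction z with
    | zero => simp
    | add z z' hz hz' => simp only [mul_add, map_add, LinearMap.add_apply, hz, hz']
    | tmul z z' =>
      simp only [Algebra.TensorProduct.tmul_mul_tmul, TensorProduct.map_tmul,
        TensorProduct.homTensorHomMap_apply, Q.act_mkQ]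

theorem GenQuot.counit_act (Q : GenQuot R H) (h : H) (q : H ⧸ Q.ideal) :
    Coalgebra.counit (R := R) (Q.act h q) =
      Coalgebra.counit (R := R) q * Coalgebra.counit (R := R) h := by
  obtain ⟨x, rfl⟩ := Q.ideal.mkQ_surjective q
  exact Bialgebra.counit_mul x h

theorem counit_rTensor_diag (hδ : IsRightCoaction δ.toLinearMap) (a : A)
    (z : (H ⧸ Q.ideal) ⊗[R] M) :
    (Coalgebra.counit (R := R)).rTensor M (diag hσ δ Q.isRightAction α a z) =
      (α a).lTensor R ((Coalgebra.counit (R := R)).rTensor M z) := by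
  induction z with
  | zero => simp
  | add x y hx hy => simp only [map_add, hx, hy]
  | tmul q m =>
    have key : ∀ w : H ⊗[R] A, (Coalgebra.counit (R := R)).rTensor M
        (tensorAct Q.act α w (q ⊗ₜ m)) = Coalgebra.counit (R := R) q •
          (α.toLinearMap.flip m).lTensor R ((Coalgebra.counit (R := R)).rTensor A w) := by
      intro w
      induction w with
      | zero => simp
      | add x y hx hy => simp only [map_add, LinearMap.add_apply, smul_add, hx, hy]
      | tmul h a => simp [Q.counit_act, TensorProduct.smul_tmul']
    have h2 : (Coalgebra.counit (R := R)).rTensor A (twist σ δ a) = 1 ⊗ₜ a :=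
      LinearMap.congr_fun (isLeftCoaction_twist hσ hδ).counit a
    rw [diag_apply, key, h2]
    simp [TensorProduct.smul_tmul']

theorem comul_rTensor_diag (hδ : IsRightCoaction δ.toLinearMap) (a : A)
    (z : (H ⧸ Q.ideal) ⊗[R] M) :
    TensorProduct.assoc R _ _ M ((Coalgebra.comul (R := R)).rTensor M
      (diag hσ δ Q.isRightAction α a z)) =
      diag hσ δ Q.isRightAction (diag hσ δ Q.isRightAction α) a
        (TensorProduct.assoc R _ _ M ((Coalgebra.comul (R := R)).rTensor M z)) := by
  induction z with
  | zero => simp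
  | add x y hx hy => simp only [map_add, hx, hy]
  | tmul q m =>
    let G : (H ⧸ Q.ideal) ⊗[R] (H ⧸ Q.ideal) → H ⊗[R] (H ⊗[R] A) →ₗ[R]
        (H ⧸ Q.ideal) ⊗[R] ((H ⧸ Q.ideal) ⊗[R] M) := fun y =>
      (TensorProduct.assoc R _ _ M).toLinearMap ∘ₗ
        (LinearMap.applyₗ y ∘ₗ TensorProduct.homTensorHomMap (RingHom.id R) _ _ _ _ ∘ₗ
          TensorProduct.map Q.act Q.act).rTensor M ∘ₗ
        (α.toLinearMap.flip m).lTensor (H ⊗[R] H) ∘ₗ (TensorProduct.assoc R H H A).symm.toLinearMap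
    have key : ∀ w : H ⊗[R] A, TensorProduct.assoc R _ _ M ((Coalgebra.comul (R := R)).rTensor M
        (tensorAct Q.act α w (q ⊗ₜ m))) = G (Coalgebra.comul (R := R) q)
          (TensorProduct.assoc R H H A ((Coalgebra.comul (R := R)).rTensor A w)) := by
      intro w
      induction w with
      | zero => simp
      | add x y hx hy => simp only [map_add, LinearMap.add_apply, hx, hy]
      | tmul h a => simp [G, Q.comul_act]
    have key2 : ∀ (w : H ⊗[R] A) (y : (H ⧸ Q.ideal) ⊗[R] (H ⧸ Q.ideal)),
        tensorAct Q.act (diag hσ δ Q.isRightAction α) w (TensorProduct.assoc R _ _ M (y ⊗ₜ m)) =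
          G y ((twist σ δ).lTensor H w) := by
      intro w y
      induction y with
      | zero => simp [G]
      | add x y hx hy =>
        simp only [TensorProduct.add_tmul, map_add, hx, hy]
        simp only [G, map_add, LinearMap.add_comp, LinearMap.rTensor_add, LinearMap.comp_add,
          LinearMap.add_apply]
      | tmul q q' =>
        induction w with
        | zero => simp
        | add x y hx hy => simp only [map_add, LinearMap.add_apply, hx, hy]
        | tmul h a =>
          rw [TensorProduct.assoc_tmul, tensorAct_tmul_tmul, diag_apply, LinearMap.lTensor_tmul]
          generalize twist σ δ a = v
          induction v with
          | zero => simp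
          | add x y hx hy =>
            simp only [map_add, LinearMap.add_apply, TensorProduct.tmul_add, hx, hy]
          | tmul k b => simp [G]
    have h2 : TensorProduct.assoc R H H A ((Coalgebra.comul (R := R)).rTensor A (twist σ δ a)) =
        (twist σ δ).lTensor H (twist σ δ a) :=
      LinearMap.congr_fun (isLeftCoaction_twist hσ hδ).coassoc a
    rw [diag_apply, key, h2, LinearMap.rTensor_tmul, diag_apply, key2]

/-- A compatible map is a coaction as soon as it is one on generators. -/
theorem isHopfModule_of_generators (hδ : IsRightCoaction δ.toLinearMap)
    {lam : M →ₗ[R] (H ⧸ Q.ideal) ⊗[R] M}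
    (h : ∀ a m, lam (α a m) = diag hσ δ Q.isRightAction α a (lam m)) (Z : Set M)
    (hZ : ∀ p : Submodule R M, (∀ a, ∀ m ∈ p, α a m ∈ p) → Z ⊆ p → p = ⊤)
    (hcoassoc : ∀ m ∈ Z, TensorProduct.assoc R _ _ M
      ((Coalgebra.comul (R := R)).rTensor M (lam m)) = lam.lTensor _ (lam m))
    (hcounit : ∀ m ∈ Z, (Coalgebra.counit (R := R)).rTensor M (lam m) = 1 ⊗ₜ m) :
    IsHopfModule hσ δ Q α lam where
  map_act := h
  coaction :=
    { coassoc := by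
        refine LinearMap.eqLocus_eq_top.1 (hZ _ ?_ hcoassoc)
        intro a m hm
        have hm' : TensorProduct.assoc R _ _ M
          ((Coalgebra.comul (R := R)).rTensor M (lam m)) = lam.lTensor _ (lam m) := hm
        change TensorProduct.assoc R _ _ M
          ((Coalgebra.comul (R := R)).rTensor M (lam (α a m))) = lam.lTensor _ (lam (α a m))
        rw [h, comul_rTensor_diag hσ δ Q α hδ, hm', lTensor_diag hσ δ _ α _ lam h]
      counit := by
        refine LinearMap.eqLocus_eq_top.1 (hZ _ ?_ hcounit)
        intro a m hm
        have hm' : (Coalgebra.counit (R := R)).rTensor M (lam m) = 1 ⊗ₜ m := hm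
        change (Coalgebra.counit (R := R)).rTensor M (lam (α a m)) = 1 ⊗ₜ α a m
        rw [h, counit_rTensor_diag hσ δ Q α hδ, hm', LinearMap.lTensor_tmul] }

end HopfModule

/-! ### The Galois map for modules -/

section GaloisMap

variable {R H A : Type*} [CommRing R] [Ring H] [Bialgebra R H] [Ring A] [Algebra R A]
  {σ : H →ₗ[R] H} (hσ : IsSkewAntipode σ) (δ : A →ₐ[R] A ⊗[R] H)
  {N : Type*} [AddCommGroup N] [Module R N] [Module A N] [IsScalarTower R A N]

theorem diag_mul_flip_one_tmul (a : A) (n : N) :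
    diag hσ δ isRightAction_mul_flip (Algebra.lsmul R R N) a ((1 : H) ⊗ₜ n) =
      ((Algebra.lsmul R R N).toLinearMap.flip n).lTensor H (twist σ δ a) := by
  rw [diag_apply]
  generalize twist σ δ a = w
  induction w with
  | zero => simp
  | add x y hx hy => simp only [map_add, LinearMap.add_apply, hx, hy]
  | tmul h a => simp

theorem diag_mul_flip_mul (a : A) (h : H) (y : H ⊗[R] A) :
    diag hσ δ isRightAction_mul_flip (Algebra.lsmul R R A) a ((h ⊗ₜ 1) * y) =
      (h ⊗ₜ 1) * diag hσ δ isRightAction_mul_flip (Algebra.lsmul R R A) a y := by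
  rw [diag_apply]
  generalize twist σ δ a = w
  induction w with
  | zero => simp
  | add x y hx hy => simp only [map_add, LinearMap.add_apply, mul_add, hx, hy]
  | tmul k a =>
    induction y with
    | zero => simp
    | add x y hx hy => simp only [map_add, mul_add, hx, hy]
    | tmul g b => simp [mul_assoc]

theorem twist_eq_diag (a : A) : twist σ δ a =
    diag hσ δ isRightAction_mul_flip (Algebra.lsmul R R A) a ((1 : H) ⊗ₜ 1) := by
  rw [diag_mul_flip_one_tmul]
  generalize twist σ δ a = w
  induction w with
  | zero => simp
  | add x y hx hy => simp only [map_add, ← hx, ← hy]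
  | tmul h a => simp

/-- `A ⊗ H → H ⊗ A`, `a ⊗ h ↦ h σ(a₍₁₎) ⊗ a₍₀₎`. -/
def flipTwist (σ : H →ₗ[R] H) (δ : A →ₐ[R] A ⊗[R] H) : A ⊗[R] H →ₗ[R] H ⊗[R] A :=
  TensorProduct.lift (LinearMap.mk₂ R (fun a h => (h ⊗ₜ 1) * twist σ δ a)
    (fun _ _ _ => by rw [map_add, mul_add])
    (fun _ _ _ => by rw [map_smul, mul_smul_comm])
    (fun _ _ _ => by rw [TensorProduct.add_tmul, add_mul])
    (fun _ _ _ => by rw [← TensorProduct.smul_tmul', smul_mul_assoc]))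

@[simp]
theorem flipTwist_tmul (a : A) (h : H) :
    flipTwist σ δ (a ⊗ₜ h) = (h ⊗ₜ 1) * twist σ δ a := by
  simp [flipTwist]

theorem flipTwist_smul (a : A) (w : A ⊗[R] H) : flipTwist σ δ (a • w) =
    diag hσ δ isRightAction_mul_flip (Algebra.lsmul R R A) a (flipTwist σ δ w) := by
  induction w with
  | zero => simp
  | add x y hx hy => simp only [smul_add, map_add, hx, hy]
  | tmul b h =>
    rw [TensorProduct.smul_tmul', smul_eq_mul, flipTwist_tmul, flipTwist_tmul, diag_mul_flip_mul,
      twist_eq_diag hσ δ (a * b), twist_eq_diag hσ δ b, map_mul, Module.End.mul_apply]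

theorem flipTwist_smul_coaction (hδ : IsRightCoaction δ.toLinearMap) (a b : A) :
    flipTwist σ δ (a • δ b) =
      diag hσ δ isRightAction_mul_flip (Algebra.lsmul R R A) a (1 ⊗ₜ b) := by
  rw [flipTwist_smul hσ, coaction_mul_twist hσ hδ (flipTwist_tmul δ)]

variable (N) in
/-- `A ⊗_B N → H ⊗ N`, `a ⊗ n ↦ σ(a₍₁₎) ⊗ a₍₀₎ n`. -/
def galoisMap : BalancedTensor R (coinvariants δ) A N →ₗ[R] H ⊗[R] N :=
  BalancedTensor.lift
    (LinearMap.lcomp R (H ⊗[R] N) (TensorProduct.mk R H N 1) ∘ₗ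
      (diag hσ δ isRightAction_mul_flip (Algebra.lsmul R R N)).toLinearMap)
    (fun a b n => by
      change diag hσ δ isRightAction_mul_flip (Algebra.lsmul R R N) (a * (b : A)) (1 ⊗ₜ n) =
        diag hσ δ isRightAction_mul_flip (Algebra.lsmul R R N) a (1 ⊗ₜ ((b : A) • n))
      rw [map_mul, Module.End.mul_apply, diag_of_mem_coinvariants hσ δ _ _ b.2]
      rfl)

theorem galoisMap_tmul (a : A) (n : N) :
    galoisMap hσ δ N (BalancedTensor.tmul R _ a n) =
      diag hσ δ isRightAction_mul_flip (Algebra.lsmul R R N) a (1 ⊗ₜ n) :=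
  BalancedTensor.lift_tmul _ _ _ _

theorem galoisMap_mapRight {N' : Type*} [AddCommGroup N'] [Module R N'] [Module A N']
    [IsScalarTower R A N'] (f : N →ₗ[A] N') (z : BalancedTensor R (coinvariants δ) A N) :
    galoisMap hσ δ N' (BalancedTensor.mapRight (R := R) A
      (f.restrictScalars (coinvariants δ)) z) =
      (f.restrictScalars R).lTensor H (galoisMap hσ δ N z) := by
  induction z using BalancedTensor.induction_on with
  | zero => simp
  | add x y hx hy => simp only [map_add, hx, hy]
  | tmul a n =>
    rw [BalancedTensor.mapRight_tmul, galoisMap_tmul, galoisMap_tmul,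
      lTensor_diag hσ δ _ _ (Algebra.lsmul R R N') (f.restrictScalars R) (fun a m => by simp)]
    rfl

/-- Right multiplication `a ↦ a n`. -/
def smulRightOver (S : Subalgebra R A) (n : N) : A →ₗ[S] N :=
  (LinearMap.toSpanSingleton A N n).restrictScalars S

@[simp]
theorem smulRightOver_apply {R A N : Type*} [CommRing R] [Ring A] [Algebra R A] [AddCommGroup N]
    [Module A N] (S : Subalgebra R A) (n : N) (a : A) :
    smulRightOver S n a = a • n := rfl

theorem galoisMap_smulRightOver (hδ : IsRightCoaction δ.toLinearMap)
    (z : BalancedTensor R (coinvariants δ) A A) (n : N) :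
    galoisMap hσ δ N (BalancedTensor.mapRight (R := R) A (smulRightOver (coinvariants δ) n) z) =
      ((Algebra.lsmul R R N).toLinearMap.flip n).lTensor H (flipTwist σ δ
        (canonicalMap δ.toLinearMap (coinvariants δ) (coaction_mul_of_mem δ) z)) := by
  have e : galoisMap hσ δ A z = flipTwist σ δ
        (canonicalMap δ.toLinearMap (coinvariants δ) (coaction_mul_of_mem δ) z) := by
    induction z using BalancedTensor.induction_on with
    | zero => simp
    | add x y hx hy => simp only [map_add, hx, hy]
    | tmul a b =>
      rw [galoisMap_tmul, canonicalMap_tmul, AlgHom.toLinearMap_apply,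
        flipTwist_smul_coaction hσ δ hδ]
  rw [← e]
  exact galoisMap_mapRight hσ δ (LinearMap.toSpanSingleton A N n) z

theorem galoisMap_surjective (hδ : IsRightCoaction δ.toLinearMap) (hG : IsHopfGalois δ) :
    Function.Surjective (galoisMap hσ δ N) := by
  intro w
  induction w with
  | zero => exact ⟨0, map_zero _⟩
  | add x y hx hy =>
    obtain ⟨x, rfl⟩ := hx
    obtain ⟨y, rfl⟩ := hy
    exact ⟨x + y, map_add _ _ _⟩
  | tmul h n =>
    obtain ⟨z, hz⟩ := hG.2 (1 ⊗ₜ h)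
    refine ⟨BalancedTensor.mapRight (R := R) A (smulRightOver (coinvariants δ) n) z, ?_⟩
    rw [galoisMap_smulRightOver hσ δ hδ, hz, flipTwist_tmul, twist_apply, map_one,
      Algebra.TensorProduct.one_def]
    simp [hσ.map_one]

theorem canonicalMap_smulRightOver (z : BalancedTensor R (coinvariants δ) A A) (a : A) :
    canonicalMap δ.toLinearMap (coinvariants δ) (coaction_mul_of_mem δ)
      (BalancedTensor.mapRight (R := R) A (smulRightOver (coinvariants δ) a) z) =
    canonicalMap δ.toLinearMap (coinvariants δ) (coaction_mul_of_mem δ) z * δ a := by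
  induction z using BalancedTensor.induction_on with
  | zero => simp
  | add x y hx hy => simp only [map_add, add_mul, hx, hy]
  | tmul b c =>
    rw [BalancedTensor.mapRight_tmul, canonicalMap_tmul, canonicalMap_tmul, smulRightOver_apply,
      smul_eq_mul, AlgHom.toLinearMap_apply, map_mul, AlgHom.toLinearMap_apply]
    exact (smul_mul_assoc b (δ c) (δ a)).symm

theorem galoisMap_injective (hδ : IsRightCoaction δ.toLinearMap) (hG : IsHopfGalois δ) :
    Function.Injective (galoisMap hσ δ N) := by
  let e := LinearEquiv.ofBijective _ hG
  let κ : BalancedTensor R (coinvariants δ) A A →ₗ[R] N →ₗ[R]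
      BalancedTensor R (coinvariants δ) A N :=
    LinearMap.mk₂ R (fun z n => BalancedTensor.mapRight (R := R) A
        (smulRightOver (coinvariants δ) n) z)
      (fun _ _ _ => map_add _ _ _) (fun _ _ _ => map_smul _ _ _)
      (fun z n n' => by
        induction z using BalancedTensor.induction_on with
        | zero => simp
        | add x y hx hy => simp only [map_add, hx, hy]; abel
        | tmul a b => simp [BalancedTensor.tmul_add])
      (fun c z n => by
        induction z using BalancedTensor.induction_on with
        | zero => simp
        | add x y hx hy => simp only [map_add, hx, hy, smul_add]
        | tmul a b =>
          rw [BalancedTensor.mapRight_tmul, BalancedTensor.mapRight_tmul, smulRightOver_apply,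
            smulRightOver_apply, smul_comm, ← BalancedTensor.mkRight_apply, map_smul]
          rfl)
  let Ψ : H ⊗[R] N →ₗ[R] BalancedTensor R (coinvariants δ) A N :=
    TensorProduct.lift (κ ∘ₗ e.symm.toLinearMap ∘ₗ TensorProduct.mk R A H 1)
  let G : H ⊗[R] A →ₗ[R] BalancedTensor R (coinvariants δ) A A :=
    TensorProduct.lift ((LinearMap.mk₂ R (fun z a => BalancedTensor.mapRight (R := R) A
        (smulRightOver (coinvariants δ) a) z)
      (fun _ _ _ => map_add _ _ _) (fun _ _ _ => map_smul _ _ _)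
      (fun z n n' => hG.1 (by
        simp only [map_add, canonicalMap_smulRightOver, mul_add]))
      (fun c z n => hG.1 (by
        simp only [map_smul, canonicalMap_smulRightOver, mul_smul_comm]))) ∘ₗ
      e.symm.toLinearMap ∘ₗ TensorProduct.mk R A H 1)
  have hG' : ∀ h a, G (h ⊗ₜ a) = BalancedTensor.mapRight (R := R) A
      (smulRightOver (coinvariants δ) a) (e.symm (1 ⊗ₜ h)) := fun h a => by simp [G]
  have hΨ' : ∀ h n, Ψ (h ⊗ₜ n) = BalancedTensor.mapRight (R := R) A
      (smulRightOver (coinvariants δ) n) (e.symm (1 ⊗ₜ h)) := fun h n => by simp [Ψ, κ]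
  have h1 : ∀ a, G (twist σ δ a) = BalancedTensor.tmul R (coinvariants δ) a 1 := by
    intro a
    apply hG.1
    rw [canonicalMap_tmul, AlgHom.toLinearMap_apply, map_one]
    refine (twist_mul_coaction hσ hδ (F := e.toLinearMap ∘ₗ G) ?_ a).trans ?_
    · intro h a
      rw [LinearMap.comp_apply, hG']
      refine (canonicalMap_smulRightOver δ _ a).trans ?_
      congr 1
      exact e.apply_symm_apply _
    · rw [Algebra.TensorProduct.one_def, TensorProduct.smul_tmul', smul_eq_mul, mul_one]
  have h2 : ∀ (n : N) (w : H ⊗[R] A),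
      Ψ (((Algebra.lsmul R R N).toLinearMap.flip n).lTensor H w) =
      BalancedTensor.mapRight (R := R) A (smulRightOver (coinvariants δ) n) (G w) := by
    intro n w
    induction w with
    | zero => simp
    | add x y hx hy => simp only [map_add, hx, hy]
    | tmul h a =>
      rw [LinearMap.lTensor_tmul, hΨ', hG', ← BalancedTensor.mapRight_comp_apply]
      congr 2
      ext b
      simp [mul_smul]
  refine Function.LeftInverse.injective (g := Ψ) fun z => ?_
  induction z using BalancedTensor.induction_on with
  | zero => simp
  | add x y hx hy => simp only [map_add, hx, hy]
  | tmul a n =>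
    rw [galoisMap_tmul, diag_mul_flip_one_tmul, h2, h1]
    simp

end GaloisMap

/-! ### Coinvariants of Hopf modules -/

section Coinvariants

variable {R H A : Type*} [CommRing R] [Ring H] [Bialgebra R H] [Ring A] [Algebra R A]
  {σ : H →ₗ[R] H} (hσ : IsSkewAntipode σ) (δ : A →ₐ[R] A ⊗[R] H) (Q : GenQuot R H)
  {M : Type*} [AddCommGroup M] [Module R M]

theorem diag_mkQ_one_tmul (α : A →ₐ[R] Module.End R M) (a : A) (m : M) :
    diag hσ δ Q.isRightAction α a (Q.ideal.mkQ 1 ⊗ₜ m) =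
      TensorProduct.map Q.ideal.mkQ (α.toLinearMap.flip m) (twist σ δ a) := by
  rw [diag_apply]
  generalize twist σ δ a = w
  induction w with
  | zero => simp
  | add x y hx hy => simp only [map_add, LinearMap.add_apply, hx, hy]
  | tmul h a => rw [tensorAct_tmul_tmul, Q.act_mkQ, one_mul]; rfl

variable {Q} [Module A M] [IsScalarTower R A M]

/-- The coinvariants of a Hopf module, as a module over the coinvariants of `A`. -/
def hopfCoinvariants {lam : M →ₗ[R] (H ⧸ Q.ideal) ⊗[R] M}
    (hlam : IsHopfModule hσ δ Q (Algebra.lsmul R R M) lam) : Submodule (coinvariants δ) M where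
  carrier := {m | lam m = Q.ideal.mkQ 1 ⊗ₜ m}
  zero_mem' := by simp
  add_mem' {m m'} hm hm' := by
    rw [Set.mem_ofPred_eq] at hm hm' ⊢
    rw [map_add, hm, hm', TensorProduct.tmul_add]
  smul_mem' b m hm := by
    rw [Set.mem_ofPred_eq] at hm ⊢
    have := hlam.map_act b m
    rw [hm, diag_of_mem_coinvariants hσ δ _ _ b.2] at this
    exact this

theorem mem_hopfCoinvariants {lam : M →ₗ[R] (H ⧸ Q.ideal) ⊗[R] M}
    (hlam : IsHopfModule hσ δ Q (Algebra.lsmul R R M) lam) {m : M} :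
    m ∈ hopfCoinvariants hσ δ hlam ↔ lam m = Q.ideal.mkQ 1 ⊗ₜ m := Iff.rfl

/-- The embedding of `A ⊗_B M^{co Q}` into `H ⊗ M`. -/
def hopfEmb {lam : M →ₗ[R] (H ⧸ Q.ideal) ⊗[R] M}
    (hlam : IsHopfModule hσ δ Q (Algebra.lsmul R R M) lam) :
    BalancedTensor R (coinvariants δ) A (hopfCoinvariants hσ δ hlam) →ₗ[R] H ⊗[R] M :=
  galoisMap hσ δ M ∘ₗ BalancedTensor.mapRight (R := R) A (hopfCoinvariants hσ δ hlam).subtype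

theorem hopfEmb_apply {lam : M →ₗ[R] (H ⧸ Q.ideal) ⊗[R] M}
    (hlam : IsHopfModule hσ δ Q (Algebra.lsmul R R M) lam)
    (z : BalancedTensor R (coinvariants δ) A (hopfCoinvariants hσ δ hlam)) :
    hopfEmb hσ δ hlam z = galoisMap hσ δ M
      (BalancedTensor.mapRight (R := R) A (hopfCoinvariants hσ δ hlam).subtype z) := rfl

end Coinvariants

section Exactness

variable {R H A : Type u} [CommRing R] [Ring H] [Bialgebra R H] [Ring A] [Algebra R A]
  {σ : H →ₗ[R] H} (hσ : IsSkewAntipode σ) {δ : A →ₐ[R] A ⊗[R] H} {Q : GenQuot R H}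
  {M : Type u} [AddCommGroup M] [Module R M] [Module A M] [IsScalarTower R A M]

theorem hopfEmb_injective (hδ : IsRightCoaction δ.toLinearMap) (hG : IsHopfGalois δ)
    (hB : IsRightFaithfullyFlat R (coinvariants δ) A)
    {lam : M →ₗ[R] (H ⧸ Q.ideal) ⊗[R] M}
    (hlam : IsHopfModule hσ δ Q (Algebra.lsmul R R M) lam) :
    Function.Injective (hopfEmb hσ δ hlam) := by
  intro x y hxy
  rw [hopfEmb_apply, hopfEmb_apply] at hxy
  exact hB.mapRight_injective (X := hopfCoinvariants hσ δ hlam) (Y := M)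
    (f := (hopfCoinvariants hσ δ hlam).subtype) Subtype.val_injective
    (galoisMap_injective hσ δ hδ hG hxy)

theorem range_hopfEmb (hδ : IsRightCoaction δ.toLinearMap) (hG : IsHopfGalois δ)
    (hB : IsRightFaithfullyFlat R (coinvariants δ) A)
    {lam : M →ₗ[R] (H ⧸ Q.ideal) ⊗[R] M}
    (hlam : IsHopfModule hσ δ Q (Algebra.lsmul R R M) lam) :
    LinearMap.range (hopfEmb hσ δ hlam) = LinearMap.range (cotensor
      (Q.ideal.mkQ.lTensor H ∘ₗ Coalgebra.comul (R := R) (A := H)) lam).subtype := by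
  let D := diag hσ δ Q.isRightAction (Algebra.lsmul R R M)
  let _ : Module A ((H ⧸ Q.ideal) ⊗[R] M) := Module.compHom _ D.toRingHom
  have hsmul : ∀ (a : A) (n : (H ⧸ Q.ideal) ⊗[R] M), a • n = D a n := fun _ _ => rfl
  have : IsScalarTower R A ((H ⧸ Q.ideal) ⊗[R] M) := ⟨fun r a n => by
    rw [hsmul, hsmul, map_smul, LinearMap.smul_apply]⟩
  let lamA : M →ₗ[A] (H ⧸ Q.ideal) ⊗[R] M :=
    { toFun := lam, map_add' := map_add lam, map_smul' := hlam.map_act }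
  let v : M →ₗ[coinvariants δ] (H ⧸ Q.ideal) ⊗[R] M :=
    { toFun := fun m => Q.ideal.mkQ 1 ⊗ₜ m
      map_add' := fun m m' => TensorProduct.tmul_add _ _ _
      map_smul' := fun b m => (diag_of_mem_coinvariants hσ δ Q.isRightAction
        (Algebra.lsmul R R M) b.2 (Q.ideal.mkQ 1) m).symm }
  let θ : M →ₗ[coinvariants δ] (H ⧸ Q.ideal) ⊗[R] M :=
    lamA.restrictScalars (coinvariants δ) - v
  have hex : Function.Exact (hopfCoinvariants hσ δ hlam).subtype θ := by
    intro m
    rw [Submodule.coe_subtype, Subtype.range_coe]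
    exact sub_eq_zero
  have hex' := (hB.exact_iff (X := hopfCoinvariants hσ δ hlam)
    (hopfCoinvariants hσ δ hlam).subtype θ).1 hex
  have hlam' : ∀ z, galoisMap hσ δ _ (BalancedTensor.mapRight (R := R) A
      (lamA.restrictScalars (coinvariants δ)) z) = lam.lTensor H (galoisMap hσ δ M z) :=
    fun z => galoisMap_mapRight hσ δ lamA z
  have hv : ∀ z, galoisMap hσ δ _ (BalancedTensor.mapRight (R := R) A v z) =
      TensorProduct.assoc R H (H ⧸ Q.ideal) M
        ((Q.ideal.mkQ.lTensor H ∘ₗ Coalgebra.comul (R := R) (A := H)).rTensor M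
          (galoisMap hσ δ M z)) := by
    intro z
    induction z using BalancedTensor.induction_on with
    | zero => simp
    | add x y hx hy => simp only [map_add, hx, hy]
    | tmul a m =>
      rw [BalancedTensor.mapRight_tmul, galoisMap_tmul, galoisMap_tmul, diag_mul_flip_one_tmul,
        diag_mul_flip_one_tmul]
      let J : H ⊗[R] (H ⊗[R] A) →ₗ[R] H ⊗[R] ((H ⧸ Q.ideal) ⊗[R] M) :=
        (TensorProduct.map Q.ideal.mkQ ((Algebra.lsmul R R M).toLinearMap.flip m)).lTensor H
      have e1 : ∀ w : H ⊗[R] A, ((Algebra.lsmul R R _).toLinearMap.flip (v m)).lTensor H w =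
          J ((twist σ δ).lTensor H w) := by
        intro w
        induction w with
        | zero => simp
        | add x y hx hy => simp only [map_add, hx, hy]
        | tmul h b =>
          simp only [J, LinearMap.lTensor_tmul]
          rw [← diag_mkQ_one_tmul hσ δ Q (Algebra.lsmul R R M) b m]
          rfl
      have e2 : ∀ w : H ⊗[R] A, TensorProduct.assoc R H (H ⧸ Q.ideal) M
          ((Q.ideal.mkQ.lTensor H ∘ₗ Coalgebra.comul (R := R) (A := H)).rTensor M
            (((Algebra.lsmul R R M).toLinearMap.flip m).lTensor H w)) =
          J (TensorProduct.assoc R H H A ((Coalgebra.comul (R := R)).rTensor A w)) := by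
        intro w
        induction w with
        | zero => simp
        | add x y hx hy => simp only [map_add, hx, hy]
        | tmul h b =>
          simp only [LinearMap.lTensor_tmul, LinearMap.rTensor_tmul, LinearMap.comp_apply]
          generalize Coalgebra.comul (R := R) h = y
          induction y with
          | zero => simp
          | add x y hx hy => simp only [map_add, TensorProduct.add_tmul, hx, hy]
          | tmul h k => simp [J]
      have h2 : TensorProduct.assoc R H H A ((Coalgebra.comul (R := R)).rTensor A (twist σ δ a)) =
          (twist σ δ).lTensor H (twist σ δ a) :=
        LinearMap.congr_fun (isLeftCoaction_twist hσ hδ).coassoc a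
      rw [e1, e2, h2]
  ext w
  obtain ⟨z, rfl⟩ := galoisMap_surjective hσ δ hδ hG w
  rw [Submodule.range_subtype]
  have e1 : galoisMap hσ δ M z ∈ LinearMap.range (hopfEmb hσ δ hlam) ↔
      BalancedTensor.mapRight (R := R) A θ z = 0 := by
    refine Iff.trans ?_ (hex' z).symm
    refine exists_congr fun y => ?_
    rw [hopfEmb_apply]
    exact (galoisMap_injective hσ δ hδ hG).eq_iff
  rw [e1, BalancedTensor.mapRight_sub_apply, sub_eq_zero,
    ← (galoisMap_injective hσ δ hδ hG).eq_iff, hlam', hv, eq_comm]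
  rfl

/-- If `H` is faithfully coflat over `Q`, exactness of Hopf module maps is detected on
coinvariants. -/
theorem hopfModule_exact_iff (hδ : IsRightCoaction δ.toLinearMap) (hG : IsHopfGalois δ)
    (hB : IsRightFaithfullyFlat R (coinvariants δ) A)
    (hQ : IsRightFaithfullyCoflat
      (Q.ideal.mkQ.lTensor H ∘ₗ Coalgebra.comul (R := R) (A := H)))
    {M₁ M₂ M₃ : Type u} [AddCommGroup M₁] [AddCommGroup M₂] [AddCommGroup M₃]
    [Module R M₁] [Module R M₂] [Module R M₃] [Module A M₁] [Module A M₂] [Module A M₃]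
    [IsScalarTower R A M₁] [IsScalarTower R A M₂] [IsScalarTower R A M₃]
    {lam₁ : M₁ →ₗ[R] (H ⧸ Q.ideal) ⊗[R] M₁} {lam₂ : M₂ →ₗ[R] (H ⧸ Q.ideal) ⊗[R] M₂}
    {lam₃ : M₃ →ₗ[R] (H ⧸ Q.ideal) ⊗[R] M₃}
    (h₁ : IsHopfModule hσ δ Q (Algebra.lsmul R R M₁) lam₁)
    (h₂ : IsHopfModule hσ δ Q (Algebra.lsmul R R M₂) lam₂)
    (h₃ : IsHopfModule hσ δ Q (Algebra.lsmul R R M₃) lam₃)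
    (f : M₁ →ₗ[A] M₂) (g : M₂ →ₗ[A] M₃)
    (hf : ∀ m, lam₂ (f m) = (f.restrictScalars R).lTensor _ (lam₁ m))
    (hg : ∀ m, lam₃ (g m) = (g.restrictScalars R).lTensor _ (lam₂ m)) :
    Function.Exact f g ↔ ∀ y, lam₂ y = Q.ideal.mkQ 1 ⊗ₜ y →
      (g y = 0 ↔ ∃ x, lam₁ x = Q.ideal.mkQ 1 ⊗ₜ x ∧ f x = y) := by
  let f' : hopfCoinvariants hσ δ h₁ →ₗ[coinvariants δ] hopfCoinvariants hσ δ h₂ :=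
    (f.restrictScalars (coinvariants δ)).restrict fun m hm => by
      rw [mem_hopfCoinvariants] at hm ⊢
      rw [LinearMap.restrictScalars_apply, hf, hm]
      rfl
  let g' : hopfCoinvariants hσ δ h₂ →ₗ[coinvariants δ] hopfCoinvariants hσ δ h₃ :=
    (g.restrictScalars (coinvariants δ)).restrict fun m hm => by
      rw [mem_hopfCoinvariants] at hm ⊢
      rw [LinearMap.restrictScalars_apply, hg, hm]
      rfl
  have e1 : Function.Exact f' g' ↔ ∀ y, lam₂ y = Q.ideal.mkQ 1 ⊗ₜ y →
      (g y = 0 ↔ ∃ x, lam₁ x = Q.ideal.mkQ 1 ⊗ₜ x ∧ f x = y) := by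
    have hg0 : ∀ y : hopfCoinvariants hσ δ h₂, g' y = 0 ↔ g y.1 = 0 := fun y => by
      rw [Subtype.ext_iff]; rfl
    have hf0 : ∀ y : hopfCoinvariants hσ δ h₂, y ∈ Set.range f' ↔
        ∃ x, lam₁ x = Q.ideal.mkQ 1 ⊗ₜ x ∧ f x = y.1 := fun y =>
      ⟨fun ⟨x, hx⟩ => ⟨x.1, x.2, congrArg Subtype.val hx⟩,
        fun ⟨x, hx, hxy⟩ => ⟨⟨x, hx⟩, Subtype.ext hxy⟩⟩
    constructor
    · intro h y hy
      exact (hg0 ⟨y, hy⟩).symm.trans ((h ⟨y, hy⟩).trans (hf0 _))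
    · intro h y
      exact (hg0 y).trans ((h y.1 y.2).trans (hf0 y).symm)
  have e2 := hQ M₁ M₂ M₃ lam₁ lam₂ lam₃ h₁.coaction h₂.coaction h₃.coaction
    (f.restrictScalars R) (g.restrictScalars R) (LinearMap.ext hf) (LinearMap.ext hg)
  refine Iff.trans e2 (Iff.trans (Iff.symm ?_) ((hB.exact_iff (X := hopfCoinvariants hσ δ h₁)
    (Y := hopfCoinvariants hσ δ h₂) (Z := hopfCoinvariants hσ δ h₃) f' g').symm.trans e1))
  let ρ := Q.ideal.mkQ.lTensor H ∘ₗ Coalgebra.comul (R := R) (A := H)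
  refine exact_iff_of_range_eq ((f.restrictScalars R).lTensor H) ((g.restrictScalars R).lTensor H)
    (hopfEmb_injective hσ hδ hG hB h₂) (hopfEmb_injective hσ hδ hG hB h₃)
    (V₁ := cotensor ρ lam₁) (V₂ := cotensor ρ lam₂) (V₃ := cotensor ρ lam₃)
    (k₁ := (cotensor ρ lam₁).subtype) (k₂ := (cotensor ρ lam₂).subtype)
    (k₃ := (cotensor ρ lam₃).subtype)
    Subtype.val_injective Subtype.val_injective
    (range_hopfEmb hσ hδ hG hB h₁) (range_hopfEmb hσ hδ hG hB h₂) ?_ ?_ ?_ ?_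
  · intro x
    refine Eq.trans ?_ (galoisMap_mapRight hσ δ f _)
    rw [hopfEmb_apply, ← BalancedTensor.mapRight_comp_apply, ← BalancedTensor.mapRight_comp_apply]
    rfl
  · intro x
    refine Eq.trans ?_ (galoisMap_mapRight hσ δ g _)
    rw [hopfEmb_apply, ← BalancedTensor.mapRight_comp_apply, ← BalancedTensor.mapRight_comp_apply]
    rfl
  · exact fun _ => rfl
  · exact fun _ => rfl

end Exactness

/-! ### The subalgebra of coinvariants of a generalised quotient -/

section PhiTwist

variable {R H A : Type*} [CommRing R] [Ring H] [Bialgebra R H] [Ring A] [Algebra R A]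
  {σ : H →ₗ[R] H} (hσ : IsSkewAntipode σ) (δ : A →ₐ[R] A ⊗[R] H) (Q : GenQuot R H)

/-- `Q ⊗ A → A ⊗ Q`, `q ⊗ a ↦ a₍₀₎ ⊗ q a₍₁₎`. -/
def quotFlip : (H ⧸ Q.ideal) ⊗[R] A →ₗ[R] A ⊗[R] (H ⧸ Q.ideal) :=
  TensorProduct.lift (LinearMap.lcomp R (A ⊗[R] (H ⧸ Q.ideal)) δ.toLinearMap ∘ₗ
    LinearMap.lTensorHom A ∘ₗ Q.act.flip)

theorem quotFlip_tmul (q : H ⧸ Q.ideal) (a : A) :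
    quotFlip δ Q (q ⊗ₜ a) = (Q.act.flip q).lTensor A (δ a) := rfl

theorem quotFlip_one_tmul (a : A) :
    quotFlip δ Q (Q.ideal.mkQ 1 ⊗ₜ a) = quotCoaction δ Q a := by
  rw [quotFlip_tmul]
  change _ = Q.ideal.mkQ.lTensor A (δ a)
  congr 2
  ext h
  change Q.ideal.mkQ (1 * h) = Q.ideal.mkQ h
  rw [one_mul]

/-- `H ⊗ A → A ⊗ H`, `h ⊗ a ↦ a₍₀₎ ⊗ h a₍₁₎`. -/
def mulCoaction : H ⊗[R] A →ₗ[R] A ⊗[R] H :=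
  TensorProduct.lift (LinearMap.mk₂ R (fun h a => (1 ⊗ₜ h) * δ a)
    (fun _ _ _ => by rw [TensorProduct.tmul_add, add_mul])
    (fun _ _ _ => by rw [TensorProduct.tmul_smul, smul_mul_assoc])
    (fun _ _ _ => by rw [map_add, mul_add])
    (fun _ _ _ => by rw [map_smul, mul_smul_comm]))

theorem mulCoaction_tmul (h : H) (a : A) : mulCoaction δ (h ⊗ₜ a) = (1 ⊗ₜ h) * δ a := by
  simp [mulCoaction]

theorem quotFlip_tensorAct (q : H ⧸ Q.ideal) (w : H ⊗[R] A) :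
    quotFlip δ Q (tensorAct Q.act (Algebra.lsmul R R A) w (q ⊗ₜ 1)) =
      (Q.act.flip q).lTensor A (mulCoaction δ w) := by
  induction w with
  | zero => simp
  | add x y hx hy => simp only [map_add, LinearMap.add_apply, hx, hy]
  | tmul h a =>
    have : (Algebra.lsmul R R A a) 1 = a := by simp
    rw [tensorAct_tmul_tmul, this, quotFlip_tmul, mulCoaction_tmul]
    generalize δ a = y
    induction y with
    | zero => simp
    | add x y hx hy => simp only [map_add, mul_add, hx, hy]
    | tmul b k =>
      simp only [Algebra.TensorProduct.tmul_mul_tmul, LinearMap.lTensor_tmul, one_mul,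
        LinearMap.flip_apply, Q.isRightAction.map_mul, Module.End.mul_apply]

/-- `a₍₀₎ ⊗ q σ(a₍₂₎) a₍₁₎ = a ⊗ q`. -/
theorem quotFlip_diag (hδ : IsRightCoaction δ.toLinearMap) (a : A) (q : H ⧸ Q.ideal) :
    quotFlip δ Q (diag hσ δ Q.isRightAction (Algebra.lsmul R R A) a (q ⊗ₜ 1)) = a ⊗ₜ q := by
  rw [diag_apply, quotFlip_tensorAct, twist_mul_coaction hσ hδ (mulCoaction_tmul δ),
    LinearMap.lTensor_tmul, LinearMap.flip_apply, Q.isRightAction.map_one]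
  rfl

theorem diag_smul_tmul_flipTwist (x : A ⊗[R] H) :
    TensorProduct.lift ((LinearMap.mk₂ R (fun (a : A) (q : H ⧸ Q.ideal) =>
      tensorAct Q.act (Algebra.lsmul R R A) (twist σ δ a) (q ⊗ₜ (1 : A)))
      (fun _ _ _ => by simp only [map_add, LinearMap.add_apply])
      (fun _ _ _ => by simp only [map_smul, LinearMap.smul_apply])
      (fun _ _ _ => by simp only [map_add, TensorProduct.add_tmul])
      (fun _ _ _ => by simp only [map_smul, ← TensorProduct.smul_tmul'])))
      (Q.ideal.mkQ.lTensor A x) = Q.ideal.mkQ.rTensor A (flipTwist σ δ x) := by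
  induction x with
  | zero => simp
  | add x y hx hy => simp only [map_add, hx, hy]
  | tmul a h =>
    rw [LinearMap.lTensor_tmul, TensorProduct.lift.tmul, LinearMap.mk₂_apply, flipTwist_tmul]
    generalize twist σ δ a = w
    induction w with
    | zero => simp
    | add x y hx hy => simp only [map_add, LinearMap.add_apply, mul_add, hx, hy]
    | tmul k b =>
      rw [tensorAct_tmul_tmul, Q.act_mkQ]
      simp

theorem diag_one_tmul_one (a : A) :
    diag hσ δ Q.isRightAction (Algebra.lsmul R R A) a (Q.ideal.mkQ 1 ⊗ₜ 1) =
      Q.ideal.mkQ.rTensor A (twist σ δ a) := by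
  rw [diag_mkQ_one_tmul]
  change TensorProduct.map _ _ _ = TensorProduct.map _ _ _
  congr 2
  ext b
  simp

include hσ in
/-- `a ∈ A^{co Q}` iff `π(σ(a₍₁₎)) ⊗ a₍₀₎ = π(1) ⊗ a`. -/
theorem mem_phi_iff_twist (hδ : IsRightCoaction δ.toLinearMap) (a : A) :
    a ∈ phi δ Q ↔ Q.ideal.mkQ.rTensor A (twist σ δ a) = Q.ideal.mkQ 1 ⊗ₜ a := by
  constructor
  · intro ha
    have ha' : Q.ideal.mkQ.lTensor A (δ a) = a ⊗ₜ Q.ideal.mkQ 1 := ha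
    have h1 := diag_smul_tmul_flipTwist (σ := σ) δ Q (δ a)
    rw [ha', coaction_mul_twist hσ hδ (flipTwist_tmul δ), TensorProduct.lift.tmul,
      LinearMap.mk₂_apply, ← diag_apply hσ δ Q.isRightAction, diag_one_tmul_one] at h1
    exact h1
  · intro ha
    rw [← diag_one_tmul_one hσ] at ha
    have := congrArg (quotFlip δ Q) ha
    rw [quotFlip_diag hσ δ Q hδ, quotFlip_one_tmul] at this
    exact this.symm

theorem diag_of_mem_phi (hδ : IsRightCoaction δ.toLinearMap) {M : Type*} [AddCommGroup M]
    [Module R M] (α : A →ₐ[R] Module.End R M) {s : A} (hs : s ∈ phi δ Q) (m : M) :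
    diag hσ δ Q.isRightAction α s (Q.ideal.mkQ 1 ⊗ₜ m) = Q.ideal.mkQ 1 ⊗ₜ α s m := by
  rw [diag_mkQ_one_tmul, ← LinearMap.lTensor_comp_rTensor, LinearMap.comp_apply,
    (mem_phi_iff_twist hσ δ Q hδ s).1 hs]
  rfl

end PhiTwist

/-! ### Induced Hopf modules -/

section Induced

variable {R H A : Type*} [CommRing R] [Ring H] [Bialgebra R H] [Ring A] [Algebra R A]
  {σ : H →ₗ[R] H} (hσ : IsSkewAntipode σ) {δ : A →ₐ[R] A ⊗[R] H}
  (hδ : IsRightCoaction δ.toLinearMap) (Q : GenQuot R H)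
  (V : Type*) [AddCommGroup V] [Module R V] [Module (phi δ Q) V]

/-- The coaction `a ⊗ v ↦ π(σ(a₍₁₎)) ⊗ a₍₀₎ ⊗ v` on `A ⊗_S V`. -/
def inducedCoaction : BalancedTensor R (phi δ Q) A V →ₗ[R]
    (H ⧸ Q.ideal) ⊗[R] BalancedTensor R (phi δ Q) A V :=
  BalancedTensor.lift
    (LinearMap.lcomp R _ (TensorProduct.mk R (H ⧸ Q.ideal) _ (Q.ideal.mkQ 1) ∘ₗ
        BalancedTensor.mkRight R (phi δ Q) V (1 : A)) ∘ₗ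
      (diag hσ δ Q.isRightAction
        (Algebra.lsmul R R (BalancedTensor R (phi δ Q) A V))).toLinearMap)
    (fun a s v => by
      change diag hσ δ Q.isRightAction (Algebra.lsmul R R (BalancedTensor R (phi δ Q) A V))
          (a * (s : A)) (Q.ideal.mkQ 1 ⊗ₜ BalancedTensor.tmul R (phi δ Q) 1 v) =
        diag hσ δ Q.isRightAction (Algebra.lsmul R R (BalancedTensor R (phi δ Q) A V)) a
          (Q.ideal.mkQ 1 ⊗ₜ BalancedTensor.tmul R (phi δ Q) 1 (s • v))
      rw [map_mul, Module.End.mul_apply, diag_of_mem_phi hσ δ Q hδ _ s.2,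
        ← BalancedTensor.op_smul_tmul, op_smul_eq_mul, one_mul]
      change diag hσ δ Q.isRightAction _ a (_ ⊗ₜ ((s : A) • BalancedTensor.tmul R _ 1 v)) = _
      rw [BalancedTensor.smul_tmul, mul_one])

theorem inducedCoaction_tmul (a : A) (v : V) :
    inducedCoaction hσ hδ Q V (BalancedTensor.tmul R _ a v) =
      diag hσ δ Q.isRightAction (Algebra.lsmul R R _) a
        (Q.ideal.mkQ 1 ⊗ₜ BalancedTensor.tmul R (phi δ Q) 1 v) :=
  BalancedTensor.lift_tmul _ _ _ _

theorem inducedCoaction_one_tmul (v : V) :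
    inducedCoaction hσ hδ Q V (BalancedTensor.tmul R _ 1 v) =
      Q.ideal.mkQ 1 ⊗ₜ BalancedTensor.tmul R (phi δ Q) 1 v := by
  rw [inducedCoaction_tmul, map_one, Module.End.one_apply]

theorem eq_top_of_one_tmul_mem {R A : Type*} [CommRing R] [Ring A] [Algebra R A]
    {S : Subalgebra R A} {V : Type*} [AddCommGroup V] [Module R V] [Module S V]
    (p : Submodule R (BalancedTensor R S A V)) (h : ∀ a : A, ∀ m ∈ p, a • m ∈ p)
    (h1 : ∀ v, BalancedTensor.tmul R S 1 v ∈ p) : p = ⊤ := by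
  rw [eq_top_iff]
  rintro z -
  induction z using BalancedTensor.induction_on with
  | zero => exact p.zero_mem
  | add x y hx hy => exact p.add_mem hx hy
  | tmul a v => rw [BalancedTensor.tmul_eq_smul]; exact h a _ (h1 v)

theorem GenQuot.comul_one (Q : GenQuot R H) : Coalgebra.comul (R := R) (Q.ideal.mkQ (1 : H)) =
    Q.ideal.mkQ 1 ⊗ₜ Q.ideal.mkQ 1 := by
  change TensorProduct.map Q.ideal.mkQ Q.ideal.mkQ (Coalgebra.comul (R := R) (1 : H)) = _
  rw [Bialgebra.comul_one, Algebra.TensorProduct.one_def, TensorProduct.map_tmul]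

theorem GenQuot.counit_one (Q : GenQuot R H) :
    Coalgebra.counit (R := R) (Q.ideal.mkQ (1 : H)) = 1 :=
  Bialgebra.counit_one (R := R) (A := H)

theorem isHopfModule_induced : IsHopfModule hσ δ Q
    (Algebra.lsmul R R (BalancedTensor R (phi δ Q) A V)) (inducedCoaction hσ hδ Q V) := by
  refine isHopfModule_of_generators hσ δ Q _ hδ ?_
    (Set.range (BalancedTensor.tmul R (phi δ Q) (1 : A)))
    (fun p hp hZ => eq_top_of_one_tmul_mem p hp fun v => hZ ⟨v, rfl⟩) ?_ ?_
  · intro a z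
    change inducedCoaction hσ hδ Q V (a • z) = _
    induction z using BalancedTensor.induction_on with
    | zero => simp
    | add x y hx hy => simp only [smul_add, map_add, hx, hy]
    | tmul b v =>
      rw [BalancedTensor.smul_tmul, inducedCoaction_tmul, inducedCoaction_tmul, map_mul,
        Module.End.mul_apply]
  · rintro _ ⟨v, rfl⟩
    rw [inducedCoaction_one_tmul, LinearMap.rTensor_tmul, Q.comul_one, TensorProduct.assoc_tmul,
      LinearMap.lTensor_tmul, inducedCoaction_one_tmul]
  · rintro _ ⟨v, rfl⟩
    rw [inducedCoaction_one_tmul, LinearMap.rTensor_tmul, Q.counit_one]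

variable {V}

/-- `A ⊗_S f` as a map of `A`-modules. -/
def inducedMap [IsScalarTower R (phi δ Q) V] {V' : Type*} [AddCommGroup V'] [Module R V']
    [Module (phi δ Q) V'] [IsScalarTower R (phi δ Q) V'] (f : V →ₗ[phi δ Q] V') :
    BalancedTensor R (phi δ Q) A V →ₗ[A] BalancedTensor R (phi δ Q) A V' where
  toFun := BalancedTensor.mapRight (R := R) A f
  map_add' := map_add _
  map_smul' a z := BalancedTensor.mapRight_smul f a z

theorem inducedMap_tmul [IsScalarTower R (phi δ Q) V] {V' : Type*} [AddCommGroup V'] [Module R V']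
    [Module (phi δ Q) V'] [IsScalarTower R (phi δ Q) V'] (f : V →ₗ[phi δ Q] V') (a : A) (v : V) :
    inducedMap Q f (BalancedTensor.tmul R _ a v) = BalancedTensor.tmul R _ a (f v) := rfl

/-- Maps out of an induced Hopf module are colinear if they are so on generators. -/
theorem inducedCoaction_colinear {N : Type*} [AddCommGroup N] [Module R N] [Module A N]
    [IsScalarTower R A N] {lam : N →ₗ[R] (H ⧸ Q.ideal) ⊗[R] N}
    (hlam : ∀ a n, lam (a • n) = diag hσ δ Q.isRightAction (Algebra.lsmul R R N) a (lam n))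
    (f : BalancedTensor R (phi δ Q) A V →ₗ[A] N)
    (hf : ∀ v, lam (f (BalancedTensor.tmul R _ 1 v)) =
      Q.ideal.mkQ 1 ⊗ₜ f (BalancedTensor.tmul R _ 1 v)) (z : BalancedTensor R (phi δ Q) A V) :
    lam (f z) = (f.restrictScalars R).lTensor _ (inducedCoaction hσ hδ Q V z) := by
  induction z using BalancedTensor.induction_on with
  | zero => simp
  | add x y hx hy => simp only [map_add, hx, hy]
  | tmul a v =>
    rw [inducedCoaction_tmul, lTensor_diag hσ δ _ _ (Algebra.lsmul R R N) (f.restrictScalars R)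
      (fun a m => by simp), BalancedTensor.tmul_eq_smul, map_smul, hlam, hf]
    rfl

theorem inducedMap_colinear [IsScalarTower R (phi δ Q) V] {V' : Type*} [AddCommGroup V']
    [Module R V'] [Module (phi δ Q) V'] [IsScalarTower R (phi δ Q) V'] (f : V →ₗ[phi δ Q] V')
    (z : BalancedTensor R (phi δ Q) A V) :
    inducedCoaction hσ hδ Q V' (inducedMap Q f z) =
      ((inducedMap Q f).restrictScalars R).lTensor _ (inducedCoaction hσ hδ Q V z) :=
  inducedCoaction_colinear hσ hδ Q (isHopfModule_induced hσ hδ Q V').map_act (inducedMap Q f)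
    (fun v => by rw [inducedMap_tmul, inducedCoaction_one_tmul]) z

end Induced

/-! ### The Hopf module `A ⊗ Q` -/

section Regular

variable {R H A : Type*} [CommRing R] [Ring H] [Bialgebra R H] [Ring A] [Algebra R A]
  {σ : H →ₗ[R] H} (hσ : IsSkewAntipode σ) {δ : A →ₐ[R] A ⊗[R] H}
  (hδ : IsRightCoaction δ.toLinearMap) (Q : GenQuot R H)

variable (R A) in
/-- `q ⊗ q' ↦ q ⊗ (1 ⊗ q')`. -/
def insertOne : (H ⧸ Q.ideal) ⊗[R] (H ⧸ Q.ideal) →ₗ[R]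
    (H ⧸ Q.ideal) ⊗[R] (A ⊗[R] (H ⧸ Q.ideal)) :=
  (TensorProduct.mk R A (H ⧸ Q.ideal) 1).lTensor (H ⧸ Q.ideal)

variable (δ) in
/-- The coaction `a ⊗ q ↦ q₍₁₎ σ(a₍₁₎) ⊗ a₍₀₎ ⊗ q₍₂₎` on `A ⊗ Q`. -/
def regularCoaction : A ⊗[R] (H ⧸ Q.ideal) →ₗ[R] (H ⧸ Q.ideal) ⊗[R] (A ⊗[R] (H ⧸ Q.ideal)) :=
  TensorProduct.lift
    (LinearMap.lcomp R _ (insertOne R A Q ∘ₗ Coalgebra.comul (R := R)) ∘ₗ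
      (diag hσ δ Q.isRightAction (Algebra.lsmul R R (A ⊗[R] (H ⧸ Q.ideal)))).toLinearMap)

theorem regularCoaction_tmul (a : A) (q : H ⧸ Q.ideal) :
    regularCoaction hσ δ Q (a ⊗ₜ q) =
      diag hσ δ Q.isRightAction (Algebra.lsmul R R (A ⊗[R] (H ⧸ Q.ideal))) a
        (insertOne R A Q (Coalgebra.comul (R := R) q)) := rfl

include hδ in
theorem isHopfModule_regular : IsHopfModule hσ δ Q
    (Algebra.lsmul R R (A ⊗[R] (H ⧸ Q.ideal))) (regularCoaction hσ δ Q) := by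
  have h1 : ∀ q, regularCoaction hσ δ Q (1 ⊗ₜ q) =
      insertOne R A Q (Coalgebra.comul (R := R) q) := fun q => by
    rw [regularCoaction_tmul, map_one, Module.End.one_apply]
  refine isHopfModule_of_generators hσ δ Q _ hδ ?_
    (Set.range fun q : H ⧸ Q.ideal => (1 : A) ⊗ₜ[R] q) ?_ ?_ ?_
  · intro a z
    change regularCoaction hσ δ Q (a • z) = _
    induction z with
    | zero => simp
    | add x y hx hy => simp only [smul_add, map_add, hx, hy]
    | tmul b q =>
      rw [TensorProduct.smul_tmul', smul_eq_mul, regularCoaction_tmul, regularCoaction_tmul,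
        map_mul, Module.End.mul_apply]
  · intro p hp hZ
    rw [eq_top_iff]
    rintro z -
    induction z with
    | zero => exact p.zero_mem
    | add x y hx hy => exact p.add_mem hx hy
    | tmul a q =>
      have := hp a _ (hZ ⟨q, rfl⟩)
      simpa [TensorProduct.smul_tmul'] using this
  · rintro _ ⟨q, rfl⟩
    dsimp only
    rw [h1]
    have e1 : ∀ y : (H ⧸ Q.ideal) ⊗[R] (H ⧸ Q.ideal), TensorProduct.assoc R _ _ _
        ((Coalgebra.comul (R := R)).rTensor _ (insertOne R A Q y)) =
        (insertOne R A Q).lTensor _ (TensorProduct.assoc R _ _ _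
          ((Coalgebra.comul (R := R)).rTensor _ y)) := by
      intro y
      induction y with
      | zero => simp
      | add x y hx hy => simp only [map_add, hx, hy]
      | tmul q q' =>
        simp only [insertOne, LinearMap.lTensor_tmul, LinearMap.rTensor_tmul]
        generalize Coalgebra.comul (R := R) q = w
        induction w with
        | zero => simp
        | add x y hx hy => simp only [map_add, TensorProduct.add_tmul, hx, hy]
        | tmul k k' => simp
    have e2 : ∀ y : (H ⧸ Q.ideal) ⊗[R] (H ⧸ Q.ideal),
        (regularCoaction hσ δ Q).lTensor _ (insertOne R A Q y) =
        (insertOne R A Q).lTensor _ ((Coalgebra.comul (R := R)).lTensor _ y) := by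
      intro y
      induction y with
      | zero => simp
      | add x y hx hy => simp only [map_add, hx, hy]
      | tmul q q' =>
        rw [LinearMap.lTensor_tmul, LinearMap.lTensor_tmul, ← h1]
        rfl
    rw [e1, e2, Coalgebra.coassoc_apply]
  · rintro _ ⟨q, rfl⟩
    dsimp only
    rw [h1, insertOne, ← LinearMap.comp_apply, LinearMap.rTensor_comp_lTensor,
      ← LinearMap.lTensor_comp_rTensor, LinearMap.comp_apply, Coalgebra.rTensor_counit_comul]
    rfl

include hδ in
theorem regularCoaction_quotCoaction (b : A) :
    regularCoaction hσ δ Q (quotCoaction δ Q b) = Q.ideal.mkQ 1 ⊗ₜ quotCoaction δ Q b := by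
  let P : (H ⊗[R] A) ⊗[R] H →ₗ[R] (H ⧸ Q.ideal) ⊗[R] (A ⊗[R] (H ⧸ Q.ideal)) :=
    TensorProduct.map Q.ideal.mkQ (Q.ideal.mkQ.lTensor A) ∘ₗ
      (TensorProduct.assoc R H A H).toLinearMap
  have e1 : ∀ x : A ⊗[R] H, regularCoaction hσ δ Q (Q.ideal.mkQ.lTensor A x) =
      P ((flipTwist σ δ).rTensor H ((TensorProduct.assoc R A H H).symm
        ((Coalgebra.comul (R := R)).lTensor A x))) := by
    intro x
    induction x with
    | zero => simp
    | add x y hx hy => simp only [map_add, hx, hy]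
    | tmul a h =>
      rw [LinearMap.lTensor_tmul, regularCoaction_tmul, LinearMap.lTensor_tmul]
      change diag hσ δ _ _ a (insertOne R A Q (TensorProduct.map Q.ideal.mkQ Q.ideal.mkQ
        (Coalgebra.comul (R := R) h))) = _
      generalize Coalgebra.comul (R := R) h = y
      induction y with
      | zero => simp
      | add x y hx hy => simp only [map_add, TensorProduct.tmul_add, hx, hy]
      | tmul h k =>
        rw [TensorProduct.assoc_symm_tmul, LinearMap.rTensor_tmul, flipTwist_tmul, diag_apply]
        generalize twist σ δ a = w
        induction w with
        | zero => simp
        | add x y hx hy =>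
          simp only [map_add, LinearMap.add_apply, mul_add, TensorProduct.add_tmul, hx, hy]
        | tmul g c =>
          rw [TensorProduct.map_tmul, insertOne, LinearMap.lTensor_tmul, TensorProduct.mk_apply,
            tensorAct_tmul_tmul, Q.act_mkQ]
          simp [P, TensorProduct.smul_tmul']
  have e2 : ∀ x : A ⊗[R] H, P ((flipTwist σ δ).rTensor H (δ.toLinearMap.rTensor H x)) =
      Q.ideal.mkQ 1 ⊗ₜ Q.ideal.mkQ.lTensor A x := by
    intro x
    induction x with
    | zero => simp
    | add x y hx hy => simp only [map_add, TensorProduct.tmul_add, hx, hy]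
    | tmul a h =>
      rw [LinearMap.rTensor_tmul, LinearMap.rTensor_tmul, AlgHom.toLinearMap_apply,
        coaction_mul_twist hσ hδ (flipTwist_tmul δ)]
      simp [P]
  change regularCoaction hσ δ Q (Q.ideal.mkQ.lTensor A (δ.toLinearMap b)) =
    Q.ideal.mkQ 1 ⊗ₜ Q.ideal.mkQ.lTensor A (δ.toLinearMap b)
  rw [e1, ← hδ.rTensor_apply, e2]

include hδ in
theorem eq_quotCoaction_of_regularCoaction {z : A ⊗[R] (H ⧸ Q.ideal)}
    (hz : regularCoaction hσ δ Q z = Q.ideal.mkQ 1 ⊗ₜ z) : ∃ b, quotCoaction δ Q b = z := by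
  let E : A ⊗[R] (H ⧸ Q.ideal) →ₗ[R] A :=
    (TensorProduct.rid R A).toLinearMap ∘ₗ (Coalgebra.counit (R := R)).lTensor A
  have hE : ∀ (a : A) (z : A ⊗[R] (H ⧸ Q.ideal)), E (a • z) = a • E z := by
    intro a z
    induction z with
    | zero => simp
    | add x y hx hy => simp only [map_add, smul_add, hx, hy]
    | tmul b q => simp [E, TensorProduct.smul_tmul']
  have e1 : ∀ z, quotFlip δ Q (E.lTensor _ (regularCoaction hσ δ Q z)) = z := by
    intro z
    induction z with
    | zero => simp
    | add x y hx hy => simp only [map_add, hx, hy]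
    | tmul a q =>
      have e2 : E.lTensor _ (insertOne R A Q (Coalgebra.comul (R := R) q)) = q ⊗ₜ 1 := by
        rw [insertOne, ← LinearMap.lTensor_comp_apply]
        have : E ∘ₗ TensorProduct.mk R A (H ⧸ Q.ideal) 1 =
            LinearMap.toSpanSingleton R A 1 ∘ₗ Coalgebra.counit (R := R) := by
          ext h
          simp [E]
        rw [this, LinearMap.lTensor_comp_apply, Coalgebra.lTensor_counit_comul]
        simp
      rw [regularCoaction_tmul, lTensor_diag hσ δ _ _ (Algebra.lsmul R R A) E hE, e2,
        quotFlip_diag hσ δ Q hδ]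
  refine ⟨E z, ?_⟩
  rw [← quotFlip_one_tmul]
  refine Eq.trans ?_ (e1 z)
  rw [hz]
  rfl

end Regular

/-! ### Descent for coinvariants under faithful coflatness -/

section Zero

variable {R H A : Type u} [CommRing R] [Ring H] [Bialgebra R H] [Ring A] [Algebra R A]
  {σ : H →ₗ[R] H} (hσ : IsSkewAntipode σ) {δ : A →ₐ[R] A ⊗[R] H} {Q : GenQuot R H}

theorem isHopfModule_punit : IsHopfModule hσ δ Q (Algebra.lsmul R R (PUnit : Type u)) 0 where
  coaction :=
    { coassoc := LinearMap.ext fun x => by rw [Subsingleton.elim x 0, map_zero, map_zero]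
      counit := LinearMap.ext fun x => by rw [Subsingleton.elim x 0, map_zero, map_zero] }
  map_act a m := by simp

variable (hδ : IsRightCoaction δ.toLinearMap) (hG : IsHopfGalois δ)
  (hB : IsRightFaithfullyFlat R (coinvariants δ) A)
  (hQ : IsRightFaithfullyCoflat (Q.ideal.mkQ.lTensor H ∘ₗ Coalgebra.comul (R := R) (A := H)))
  {M₁ M₂ : Type u} [AddCommGroup M₁] [AddCommGroup M₂] [Module R M₁] [Module R M₂]
  [Module A M₁] [Module A M₂] [IsScalarTower R A M₁] [IsScalarTower R A M₂]
  {lam₁ : M₁ →ₗ[R] (H ⧸ Q.ideal) ⊗[R] M₁} {lam₂ : M₂ →ₗ[R] (H ⧸ Q.ideal) ⊗[R] M₂}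
  (h₁ : IsHopfModule hσ δ Q (Algebra.lsmul R R M₁) lam₁)
  (h₂ : IsHopfModule hσ δ Q (Algebra.lsmul R R M₂) lam₂) (f : M₁ →ₗ[A] M₂)
  (hf : ∀ m, lam₂ (f m) = (f.restrictScalars R).lTensor _ (lam₁ m))

include hδ hG hB hQ h₁ h₂ hf

theorem hopfModule_surjective_iff : Function.Surjective f ↔
    ∀ y, lam₂ y = Q.ideal.mkQ 1 ⊗ₜ y → ∃ x, lam₁ x = Q.ideal.mkQ 1 ⊗ₜ x ∧ f x = y := by
  have h := hopfModule_exact_iff hσ hδ hG hB hQ h₁ h₂ (isHopfModule_punit hσ) f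
    (0 : M₂ →ₗ[A] (PUnit : Type u)) hf (fun m => by simp)
  have e : Function.Exact f (0 : M₂ →ₗ[A] (PUnit : Type u)) ↔ Function.Surjective f :=
    ⟨fun h y => (h y).1 rfl, fun h y => ⟨fun _ => h y, fun _ => rfl⟩⟩
  rw [← e, h]
  exact forall₂_congr fun y hy => ⟨fun h => h.1 rfl, fun h => ⟨fun _ => h, fun _ => rfl⟩⟩

theorem hopfModule_injective_iff : Function.Injective f ↔
    ∀ x, lam₁ x = Q.ideal.mkQ 1 ⊗ₜ x → f x = 0 → x = 0 := by
  have h := hopfModule_exact_iff hσ hδ hG hB hQ (isHopfModule_punit hσ) h₁ h₂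
    (0 : (PUnit : Type u) →ₗ[A] M₁) f (fun m => by simp) hf
  have e : Function.Exact (0 : (PUnit : Type u) →ₗ[A] M₁) f ↔ Function.Injective f := by
    rw [injective_iff_map_eq_zero]
    constructor
    · intro h x hx
      obtain ⟨y, rfl⟩ := (h x).1 hx
      rfl
    · intro h x
      refine ⟨fun hx => ⟨0, (h x hx).symm⟩, ?_⟩
      rintro ⟨y, rfl⟩
      exact map_zero f
  rw [← e, h]
  refine forall₂_congr fun x hx => ⟨fun h h0 => ?_, fun h => ⟨fun h0 => ⟨0, ?_, (h h0).symm⟩, ?_⟩⟩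
  · obtain ⟨y, -, hy⟩ := h.1 h0
    exact hy.symm
  · rw [LinearMap.zero_apply, TensorProduct.tmul_zero]
  · rintro ⟨y, -, rfl⟩
    exact map_zero f

end Zero

section Descent

variable {R H A : Type u} [CommRing R] [Ring H] [Bialgebra R H] [Ring A] [Algebra R A]
  {σ : H →ₗ[R] H} (hσ : IsSkewAntipode σ) {δ : A →ₐ[R] A ⊗[R] H} {Q : GenQuot R H}
  (hδ : IsRightCoaction δ.toLinearMap)

/-- The coordinates of an element of `A ⊗_S S^{(ι)}`. -/
def coord (S : Subalgebra R A) {ι : Type*} (i : ι) :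
    BalancedTensor R S A (ι →₀ S) →ₗ[A] A where
  toFun := BalancedTensor.lift (LinearMap.mk₂ R (fun a p => a * (p i : A))
    (fun _ _ _ => add_mul _ _ _) (fun _ _ _ => smul_mul_assoc _ _ _)
    (fun _ _ _ => by simp [mul_add]) (fun _ _ _ => by simp))
    (fun a s p => by simp [op_smul_eq_mul, mul_assoc])
  map_add' := map_add _
  map_smul' a z := by
    induction z using BalancedTensor.induction_on with
    | zero => simp
    | add x y hx hy => simp only [smul_add, map_add, hx, hy]
    | tmul b p => exact mul_assoc a b (p i : A)

theorem coord_tmul {S : Subalgebra R A} {ι : Type*} (i : ι) (a : A) (p : ι →₀ S) :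
    coord S i (BalancedTensor.tmul R S a p) = a * (p i : A) := rfl

theorem exists_sum_coord {S : Subalgebra R A} {ι : Type*} (z : BalancedTensor R S A (ι →₀ S)) :
    ∃ t : Finset ι, ∀ t', t ⊆ t' → z = ∑ i ∈ t',
      BalancedTensor.tmul R S (coord S i z) (Finsupp.single i (1 : S)) := by
  classical
  induction z using BalancedTensor.induction_on with
  | zero => exact ⟨∅, fun t' _ => by simp [BalancedTensor.tmul]⟩
  | add x y hx hy =>
    obtain ⟨t, ht⟩ := hx
    obtain ⟨u, hu⟩ := hy
    refine ⟨t ∪ u, fun t' h => ?_⟩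
    conv_lhs => rw [ht t' (Finset.union_subset_left h), hu t' (Finset.union_subset_right h)]
    simp only [map_add, BalancedTensor.add_tmul, Finset.sum_add_distrib]
  | tmul a p =>
    refine ⟨p.support, fun t' h => ?_⟩
    have hp : p = ∑ i ∈ t', p i • Finsupp.single i (1 : S) := by
      conv_lhs => rw [← Finsupp.sum_single p]
      rw [Finsupp.sum_of_support_subset p h _ (fun i _ => Finsupp.single_zero i)]
      simp
    conv_lhs => rw [hp, ← BalancedTensor.mkRight_apply, map_sum]
    refine Finset.sum_congr rfl fun i _ => ?_
    rw [BalancedTensor.mkRight_apply, ← BalancedTensor.op_smul_tmul, op_smul_eq_mul, coord_tmul]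

theorem coord_mem_phi {ι : Type u} {z : BalancedTensor R (phi δ Q) A (ι →₀ phi δ Q)}
    (hz : inducedCoaction hσ hδ Q _ z = Q.ideal.mkQ 1 ⊗ₜ z) (i : ι) : coord (phi δ Q) i z ∈ phi δ Q := by
  have h := inducedCoaction_colinear hσ hδ Q
    (lam := Q.ideal.mkQ.rTensor A ∘ₗ twist σ δ) (N := A)
    (fun a n => by
      simp only [LinearMap.comp_apply, ← diag_one_tmul_one hσ, smul_eq_mul, map_mul]
      rfl) (coord (phi δ Q) i) (fun p => by
        rw [coord_tmul, one_mul]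
        exact (mem_phi_iff_twist hσ δ Q hδ _).1 (p i).2) z
  rw [hz] at h
  exact (mem_phi_iff_twist hσ δ Q hδ _).2 h

theorem exists_one_tmul_of_free {ι : Type u}
    {z : BalancedTensor R (phi δ Q) A (ι →₀ phi δ Q)}
    (hz : inducedCoaction hσ hδ Q _ z = Q.ideal.mkQ 1 ⊗ₜ z) :
    ∃ p, BalancedTensor.tmul R _ 1 p = z := by
  obtain ⟨t, ht⟩ := exists_sum_coord z
  refine ⟨∑ i ∈ t, (⟨coord (phi δ Q) i z, coord_mem_phi hσ hδ hz i⟩ : phi δ Q) •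
    Finsupp.single i (1 : phi δ Q), ?_⟩
  conv_rhs => rw [ht t subset_rfl]
  rw [← BalancedTensor.mkRight_apply, map_sum]
  refine Finset.sum_congr rfl fun i _ => ?_
  rw [BalancedTensor.mkRight_apply, ← BalancedTensor.op_smul_tmul, op_smul_eq_mul, one_mul]

theorem eq_zero_of_free {S : Subalgebra R A} {ι : Type*} {p : ι →₀ S}
    (hp : BalancedTensor.tmul R S (1 : A) p = 0) : p = 0 := by
  ext i
  have := congrArg (coord S i) hp
  rw [coord_tmul, one_mul, map_zero] at this
  exact this

variable (hG : IsHopfGalois δ) (hB : IsRightFaithfullyFlat R (coinvariants δ) A)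
  (hQ : IsRightFaithfullyCoflat (Q.ideal.mkQ.lTensor H ∘ₗ Coalgebra.comul (R := R) (A := H)))

include hG hB hQ

theorem exists_one_tmul {V : Type u} [AddCommGroup V] [Module R V] [Module (phi δ Q) V]
    [IsScalarTower R (phi δ Q) V] {z : BalancedTensor R (phi δ Q) A V}
    (hz : inducedCoaction hσ hδ Q _ z = Q.ideal.mkQ 1 ⊗ₜ z) :
    ∃ v, BalancedTensor.tmul R _ 1 v = z := by
  let p : (V →₀ phi δ Q) →ₗ[phi δ Q] V := Finsupp.linearCombination (phi δ Q) id
  have hp : Function.Surjective p := Finsupp.linearCombination_id_surjective _ _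
  obtain ⟨x, hx, rfl⟩ := (hopfModule_surjective_iff hσ hδ hG hB hQ
    (isHopfModule_induced hσ hδ Q _) (isHopfModule_induced hσ hδ Q _) (inducedMap Q p)
    (inducedMap_colinear hσ hδ Q p)).1 (BalancedTensor.mapRight_surjective hp) z hz
  obtain ⟨q, rfl⟩ := exists_one_tmul_of_free hσ hδ hx
  exact ⟨p q, (inducedMap_tmul Q p 1 q).symm⟩

include hσ hδ in
theorem eq_zero_of_one_tmul_of_exact {K V ι : Type u} [AddCommGroup K] [Module R K]
    [Module (phi δ Q) K] [IsScalarTower R (phi δ Q) K] [AddCommGroup V] [Module R V]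
    [Module (phi δ Q) V] [IsScalarTower R (phi δ Q) V] {i : K →ₗ[phi δ Q] (ι →₀ phi δ Q)}
    {p : (ι →₀ phi δ Q) →ₗ[phi δ Q] V} (hip : Function.Exact i p) (hp : Function.Surjective p)
    {v : V} (hv : BalancedTensor.tmul R (phi δ Q) (1 : A) v = 0) : v = 0 := by
  have hex : Function.Exact (inducedMap (δ := δ) Q i) (inducedMap (δ := δ) Q p) :=
    BalancedTensor.mapRight_exact hip hp
  have h := (hopfModule_exact_iff hσ hδ hG hB hQ (isHopfModule_induced hσ hδ Q K)
    (isHopfModule_induced hσ hδ Q _) (isHopfModule_induced hσ hδ Q V) (inducedMap Q i)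
    (inducedMap Q p) (inducedMap_colinear hσ hδ Q i) (inducedMap_colinear hσ hδ Q p)).1 hex
  obtain ⟨q, rfl⟩ := hp v
  obtain ⟨x, hx, hxq⟩ := (h _ (inducedCoaction_one_tmul hσ hδ Q _ q)).1
    ((inducedMap_tmul Q p 1 q).trans hv)
  obtain ⟨k, rfl⟩ := exists_one_tmul hσ hδ hG hB hQ hx
  rw [inducedMap_tmul] at hxq
  have hk : i k - q = 0 := by
    apply eq_zero_of_free (R := R)
    rw [← BalancedTensor.mkRight_apply, map_sub, BalancedTensor.mkRight_apply,
      BalancedTensor.mkRight_apply, hxq, sub_self]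
  rw [← sub_eq_zero.1 hk]
  exact (hip _).2 ⟨k, rfl⟩

include hσ hδ in
theorem eq_zero_of_one_tmul {V : Type u} [AddCommGroup V] [Module R V] [Module (phi δ Q) V]
    [IsScalarTower R (phi δ Q) V] {v : V}
    (hv : BalancedTensor.tmul R (phi δ Q) (1 : A) v = 0) : v = 0 :=
  eq_zero_of_one_tmul_of_exact
    (K := LinearMap.ker (Finsupp.linearCombination (phi δ Q) (id : V → V))) hσ hδ hG hB hQ
    (LinearMap.exact_subtype_ker_map (Finsupp.linearCombination (phi δ Q) (id : V → V)))
    (Finsupp.linearCombination_id_surjective _ _) hv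

include hσ hδ in
/-- `A` is faithfully flat over `A^{co Q}`. -/
theorem isRightFaithfullyFlat_phi : IsRightFaithfullyFlat R (phi δ Q) A := by
  intro X Y Z _ _ _ _ _ _ _ _ _ _ _ _ f g
  have h := hopfModule_exact_iff hσ hδ hG hB hQ (isHopfModule_induced hσ hδ Q X)
    (isHopfModule_induced hσ hδ Q Y) (isHopfModule_induced hσ hδ Q Z) (inducedMap Q f)
    (inducedMap Q g) (inducedMap_colinear hσ hδ Q f) (inducedMap_colinear hσ hδ Q g)
  refine Iff.trans ?_ h.symm
  have inj : ∀ {V : Type u} [AddCommGroup V] [Module R V] [Module (phi δ Q) V]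
      [IsScalarTower R (phi δ Q) V] {v v' : V}, BalancedTensor.tmul R (phi δ Q) (1 : A) v =
      BalancedTensor.tmul R (phi δ Q) (1 : A) v' → v = v' := by
    intro V _ _ _ _ v v' hv
    refine sub_eq_zero.1 (eq_zero_of_one_tmul hσ hδ hG hB hQ ?_)
    rw [← BalancedTensor.mkRight_apply, map_sub, BalancedTensor.mkRight_apply,
      BalancedTensor.mkRight_apply, hv, sub_self]
  have e1 : ∀ y, inducedMap Q g (BalancedTensor.tmul R _ 1 y) = 0 ↔ g y = 0 := by
    intro y
    rw [inducedMap_tmul]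
    refine ⟨eq_zero_of_one_tmul hσ hδ hG hB hQ, fun h => ?_⟩
    rw [h, BalancedTensor.tmul_zero]
  have e2 : ∀ y, (∃ x, inducedCoaction hσ hδ Q X x = Q.ideal.mkQ 1 ⊗ₜ x ∧
      inducedMap Q f x = BalancedTensor.tmul R _ 1 y) ↔ y ∈ Set.range f := by
    intro y
    constructor
    · rintro ⟨x, hx, hxy⟩
      obtain ⟨x, rfl⟩ := exists_one_tmul hσ hδ hG hB hQ hx
      rw [inducedMap_tmul] at hxy
      exact ⟨x, inj hxy⟩
    · rintro ⟨x, rfl⟩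
      exact ⟨_, inducedCoaction_one_tmul hσ hδ Q X x, inducedMap_tmul Q f 1 x⟩
  constructor
  · intro hfg z hz
    obtain ⟨y, rfl⟩ := exists_one_tmul hσ hδ hG hB hQ hz
    rw [e1, e2]
    exact hfg y
  · intro H y
    rw [← e1, ← e2]
    exact H _ (inducedCoaction_one_tmul hσ hδ Q Y y)

include hσ hδ in
/-- The canonical map of `A^{co Q}` is bijective. -/
theorem canonicalMap_phi_bijective : Function.Bijective (canonicalMap (quotCoaction δ Q) (phi δ Q)
    (quotCoaction_mul_of_mem δ Q le_rfl)) := by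
  let κ : BalancedTensor R (phi δ Q) A A →ₗ[A] A ⊗[R] (H ⧸ Q.ideal) :=
    { toFun := canonicalMap (quotCoaction δ Q) (phi δ Q) (quotCoaction_mul_of_mem δ Q le_rfl)
      map_add' := map_add _
      map_smul' := fun a z => by
        induction z using BalancedTensor.induction_on with
        | zero => simp
        | add x y hx hy => simp only [smul_add, map_add, hx, hy]
        | tmul b c =>
          rw [BalancedTensor.smul_tmul, canonicalMap_tmul, canonicalMap_tmul, mul_smul]
          rfl }
  have hκ : ∀ b, κ (BalancedTensor.tmul R _ 1 b) = quotCoaction δ Q b := fun b =>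
    (canonicalMap_tmul (quotCoaction δ Q) (phi δ Q)
      (quotCoaction_mul_of_mem δ Q le_rfl) 1 b).trans (one_smul _ _)
  have hreg := isHopfModule_regular hσ hδ Q
  have hcol := inducedCoaction_colinear hσ hδ Q hreg.map_act κ (fun b => by
    rw [hκ, regularCoaction_quotCoaction hσ hδ])
  constructor
  · refine (hopfModule_injective_iff hσ hδ hG hB hQ (isHopfModule_induced hσ hδ Q A) hreg κ
      hcol).2 fun x hx hx0 => ?_
    obtain ⟨b, rfl⟩ := exists_one_tmul hσ hδ hG hB hQ hx
    rw [hκ] at hx0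
    have hb : b = 0 := by
      have h1 := hδ.lTensor_counit_apply b
      have h2 : (Coalgebra.counit (R := R) (A := H)).lTensor A (δ.toLinearMap b) =
          (Coalgebra.counit (R := R) (A := H ⧸ Q.ideal)).lTensor A (quotCoaction δ Q b) := by
        rw [quotCoaction, LinearMap.comp_apply, ← LinearMap.lTensor_comp_apply]
        rfl
      rw [h2, hx0, map_zero] at h1
      simpa using (congrArg (TensorProduct.rid R A) h1).symm
    rw [hb, BalancedTensor.tmul_zero]
  · refine (hopfModule_surjective_iff hσ hδ hG hB hQ (isHopfModule_induced hσ hδ Q A) hreg κ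
      hcol).2 fun y hy => ?_
    obtain ⟨b, rfl⟩ := eq_quotCoaction_of_regularCoaction hσ hδ Q hy
    exact ⟨_, inducedCoaction_one_tmul hσ hδ Q A b, hκ b⟩

end Descent

/-! ### The Galois correspondence for right admissible objects -/

section Connection

variable {R H A : Type*} [CommRing R] [Ring H] [Algebra R H] [Ring A] [Algebra R A]
  [Coalgebra R H] {δ : A →ₐ[R] A ⊗[R] H}

theorem le_psi {S : Subalgebra R A} {Q : GenQuot R H} (h : S ≤ phi δ Q) : Q ≤ psi δ S :=
  (GenQuot.isLUB_sSup _).1 h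

theorem GaloisConnectionExists.le_phi_psi (h : GaloisConnectionExists δ) (S : Subalgebra R A) :
    S ≤ phi δ (psi δ S) := by
  obtain ⟨ψ, -, hψ, h₁, h₂⟩ := h
  have : psi δ S = ψ S := (GenQuot.isLUB_sSup _).unique
    ⟨fun Q hQ => (h₂ Q).trans (hψ hQ), fun Q hQ => hQ (h₁ S)⟩
  rw [this]
  exact h₁ S

theorem coinvariants_le_phi (Q : GenQuot R H) : coinvariants δ ≤ phi δ Q := by
  intro a ha
  have ha' : δ a = a ⊗ₜ[R] 1 := ha
  change Q.ideal.mkQ.lTensor A (δ a) = _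
  rw [ha', LinearMap.lTensor_tmul]

theorem quotCoaction_one (Q : GenQuot R H) : quotCoaction δ Q 1 = 1 ⊗ₜ Q.ideal.mkQ 1 := by
  change Q.ideal.mkQ.lTensor A (δ 1) = _
  rw [map_one, Algebra.TensorProduct.one_def, LinearMap.lTensor_tmul]

theorem assoc_rTensor_quotCoaction {Q' : Type*} [AddCommGroup Q'] [Module R Q']
    (q : H →ₗ[R] Q') (Q : GenQuot R H) (hδ : IsRightCoaction δ.toLinearMap) :
    (TensorProduct.assoc R A Q' (H ⧸ Q.ideal)).toLinearMap ∘ₗ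
      (q.lTensor A ∘ₗ δ.toLinearMap).rTensor (H ⧸ Q.ideal) ∘ₗ quotCoaction δ Q =
      (TensorProduct.map q Q.ideal.mkQ ∘ₗ Coalgebra.comul (R := R) (A := H)).lTensor A ∘ₗ
        δ.toLinearMap := by
  have key : ∀ x : A ⊗[R] H, TensorProduct.assoc R A Q' (H ⧸ Q.ideal)
      ((q.lTensor A ∘ₗ δ.toLinearMap).rTensor (H ⧸ Q.ideal) (Q.ideal.mkQ.lTensor A x)) =
      (TensorProduct.map q Q.ideal.mkQ).lTensor A
        (TensorProduct.assoc R A H H (δ.toLinearMap.rTensor H x)) := by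
    intro x
    induction x with
    | zero => simp
    | add x y hx hy => simp only [map_add, hx, hy]
    | tmul a h =>
      simp only [LinearMap.lTensor_tmul, LinearMap.rTensor_tmul, LinearMap.comp_apply]
      generalize δ.toLinearMap a = y
      induction y with
      | zero => simp
      | add x y hx hy => simp only [map_add, TensorProduct.add_tmul, hx, hy]
      | tmul b k => simp
  ext a
  have := LinearMap.congr_fun hδ.coassoc a
  simp only [LinearMap.comp_apply, LinearEquiv.coe_coe] at this
  simp only [LinearMap.comp_apply, LinearEquiv.coe_coe, quotCoaction, key, this,
    LinearMap.lTensor_comp]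

theorem restrictsToBijection_of_forall {R H A : Type u} [CommRing R] [Ring H] [Algebra R H]
    [Coalgebra R H] [Ring A] [Algebra R A] {δ : A →ₐ[R] A ⊗[R] H} {s : Set (Subalgebra R A)}
    {t : Set (GenQuot R H)} (hs : ∀ S ∈ s, psi δ S ∈ t ∧ phi δ (psi δ S) = S)
    (ht : ∀ Q ∈ t, phi δ Q ∈ s ∧ psi δ (phi δ Q) = Q) : RestrictsToBijection δ s t := by
  have h : Set.InvOn (phi δ) (psi δ) s t := ⟨fun S hS => (hs S hS).2, fun Q hQ => (ht Q hQ).2⟩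
  have h₁ : Set.MapsTo (psi δ) s t := fun S hS => (hs S hS).1
  have h₂ : Set.MapsTo (phi δ) t s := fun Q hQ => (ht Q hQ).1
  exact ⟨h.bijOn h₁ h₂, h.symm.bijOn h₂ h₁, h⟩

end Connection

section Regular

variable {R C : Type*} [CommRing R] [AddCommGroup C] [Module R C] [Coalgebra R C]

/-- `X ≅ C □_C X`. -/
def regularCotensorEquiv {X : Type*} [AddCommGroup X] [Module R X] {ρ : X →ₗ[R] C ⊗[R] X}
    (hρ : IsLeftCoaction ρ) : X ≃ₗ[R] cotensor (Coalgebra.comul (R := R) (A := C)) ρ :=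
  LinearEquiv.ofBijective
    (ρ.codRestrict _ fun x => LinearMap.congr_fun hρ.coassoc x) (by
    have hc : ∀ x, TensorProduct.lid R X ((Coalgebra.counit (R := R) (A := C)).rTensor X (ρ x)) = x :=
      fun x => by
        have := LinearMap.congr_fun hρ.counit x
        rw [LinearMap.comp_apply] at this
        rw [this]
        simp
    constructor
    · intro x y hxy
      rw [← hc x, ← hc y]
      exact congrArg (fun z => TensorProduct.lid R X
        ((Coalgebra.counit (R := R) (A := C)).rTensor X z)) (congrArg Subtype.val hxy)
    · rintro ⟨z, hz⟩
      refine ⟨TensorProduct.lid R X ((Coalgebra.counit (R := R) (A := C)).rTensor X z),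
        Subtype.ext ?_⟩
      have hz' : TensorProduct.assoc R C C X ((Coalgebra.comul (R := R)).rTensor X z) =
        ρ.lTensor C z := hz
      have h₁ : ∀ z : C ⊗[R] X, ρ (TensorProduct.lid R X
          ((Coalgebra.counit (R := R) (A := C)).rTensor X z)) = TensorProduct.lid R _
          ((Coalgebra.counit (R := R) (A := C)).rTensor _ (ρ.lTensor C z)) := by
        intro z
        induction z with
        | zero => simp
        | add x y hx hy => simp only [map_add, hx, hy]
        | tmul c x => simp
      have h₂ : ∀ z : C ⊗[R] X, TensorProduct.lid R _
          ((Coalgebra.counit (R := R) (A := C)).rTensor _ (TensorProduct.assoc R C C X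
            ((Coalgebra.comul (R := R)).rTensor X z))) = z := by
        intro z
        have h₃ : ∀ y : (C ⊗[R] C) ⊗[R] X, TensorProduct.lid R _
            ((Coalgebra.counit (R := R) (A := C)).rTensor _ (TensorProduct.assoc R C C X y)) =
            ((TensorProduct.lid R C).toLinearMap ∘ₗ
              (Coalgebra.counit (R := R) (A := C)).rTensor C).rTensor X y := by
          intro y
          induction y with
          | zero => simp
          | add x y hx hy => simp only [map_add, hx, hy]
          | tmul c x =>
            induction c with
            | zero => simp
            | add x y hx hy => simp only [map_add, TensorProduct.add_tmul, hx, hy]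
            | tmul c d => simp [TensorProduct.smul_tmul']
        rw [h₃, ← LinearMap.rTensor_comp_apply, LinearMap.comp_assoc,
          Coalgebra.rTensor_counit_comp_comul]
        have : (TensorProduct.lid R C).toLinearMap ∘ₗ TensorProduct.mk R R C 1 =
          LinearMap.id := by ext; simp
        rw [this, LinearMap.rTensor_id, LinearMap.id_apply]
      change ρ _ = z
      rw [h₁, ← hz', h₂])

theorem regularCotensor_exact_iff {X Y Z : Type*} [AddCommGroup X] [AddCommGroup Y]
    [AddCommGroup Z] [Module R X] [Module R Y] [Module R Z]
    {ρX : X →ₗ[R] C ⊗[R] X} {ρY : Y →ₗ[R] C ⊗[R] Y} {ρZ : Z →ₗ[R] C ⊗[R] Z}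
    (hX : IsLeftCoaction ρX) (hY : IsLeftCoaction ρY) (hZ : IsLeftCoaction ρZ)
    (f : X →ₗ[R] Y) (g : Y →ₗ[R] Z)
    (hf : ρY ∘ₗ f = f.lTensor C ∘ₗ ρX) (hg : ρZ ∘ₗ g = g.lTensor C ∘ₗ ρY) :
    Function.Exact (cotensorMapRight (Coalgebra.comul (R := R) (A := C)) f hf)
      (cotensorMapRight (Coalgebra.comul (R := R) (A := C)) g hg) ↔ Function.Exact f g :=
  Function.Exact.iff_of_ladder_linearEquiv (e₁ := regularCotensorEquiv hX)
    (e₂ := regularCotensorEquiv hY) (e₃ := regularCotensorEquiv hZ)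
    (LinearMap.ext fun x => Subtype.ext (LinearMap.congr_fun hf x).symm)
    (LinearMap.ext fun x => Subtype.ext (LinearMap.congr_fun hg x).symm)

end Regular

section Correspondence

variable {R H A : Type u} [CommRing R] [Ring H] [Bialgebra R H] [Ring A] [Algebra R A]
  {δ : A →ₐ[R] A ⊗[R] H}

theorem phi_psi_of_isRightAdmissible {S : Subalgebra R A} (hS : IsRightAdmissible δ S) :
    phi δ (psi δ S) = S := by
  obtain ⟨hle, hbij⟩ := hS.can_bijective
  refine le_antisymm (fun a ha => hS.faithfullyFlat.mem_of_tmul_eq (hbij.1 ?_)) hle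
  have ha' : quotCoaction δ (psi δ S) a = a ⊗ₜ[R] (psi δ S).ideal.mkQ 1 := ha
  rw [canonicalMap_tmul, canonicalMap_tmul, ha', quotCoaction_one, one_smul,
    TensorProduct.smul_tmul', smul_eq_mul, mul_one]

theorem isRightAdmissible_psi (hδ : IsRightCoaction δ.toLinearMap) (hG : IsHopfGalois δ)
    (hB : IsRightFaithfullyFlat R (coinvariants δ) A) (hA : Module.FaithfullyFlat R A)
    {S : Subalgebra R A} (hS : IsRightAdmissible δ S) : (psi δ S).IsRightAdmissible := by
  refine ⟨hS.flat, ?_⟩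
  obtain ⟨hle, hbij⟩ := hS.can_bijective
  intro X Y Z _ _ _ _ _ _ ρX ρY ρZ hX hY hZ f g hf hg
  have h₁ := cotensor_exact_iff (coaction_mul_of_mem δ)
    (quotCoaction_mul_of_mem δ (psi δ S) (coinvariants_le_phi _))
    (ρC := (psi δ S).ideal.mkQ.lTensor H ∘ₗ Coalgebra.comul (R := R) (A := H)) (by
      have := assoc_rTensor_quotCoaction LinearMap.id (psi δ S) hδ
      rwa [LinearMap.lTensor_id, LinearMap.id_comp] at this) hA hB hG f g hf hg
  have h₂ := cotensor_exact_iff (quotCoaction_mul_of_mem δ (psi δ S) hle)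
    (quotCoaction_mul_of_mem δ (psi δ S) hle)
    (ρC := Coalgebra.comul (R := R) (A := H ⧸ (psi δ S).ideal)) (by
      refine (assoc_rTensor_quotCoaction (psi δ S).ideal.mkQ (psi δ S) hδ).trans ?_
      rw [quotCoaction, ← LinearMap.comp_assoc, ← LinearMap.lTensor_comp]
      rfl) hA hS.faithfullyFlat hbij f g hf hg
  exact (regularCotensor_exact_iff hX hY hZ f g hf hg).symm.trans (h₂.symm.trans h₁)

variable {σ : H →ₗ[R] H}

theorem psi_phi_of_isRightAdmissible (hσ : IsSkewAntipode σ) (hδ : IsRightCoaction δ.toLinearMap)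
    (hG : IsHopfGalois δ) (hB : IsRightFaithfullyFlat R (coinvariants δ) A)
    (hA : Module.FaithfullyFlat R A) (hconn : GaloisConnectionExists δ)
    {Q : GenQuot R H} (hQ : Q.IsRightAdmissible) : psi δ (phi δ Q) = Q := by
  set P := psi δ (phi δ Q) with hP
  have hQP : P.ideal ≤ Q.ideal := le_psi (δ := δ) le_rfl
  have hle : phi δ Q ≤ phi δ P := hconn.le_phi_psi _
  have hinj := (canonicalMap_phi_bijective hσ hδ hG hB hQ.2).1
  let c := canonicalMap (quotCoaction δ P) (phi δ Q) (quotCoaction_mul_of_mem δ P hle)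
  have hc : ∀ z, (Submodule.factor hQP).lTensor A (c z) = canonicalMap (quotCoaction δ Q) (phi δ Q)
      (quotCoaction_mul_of_mem δ Q le_rfl) z := by
    intro z
    induction z using BalancedTensor.induction_on with
    | zero => simp
    | add x y hx hy => simp only [map_add, hx, hy]
    | tmul a b =>
      rw [canonicalMap_tmul, canonicalMap_tmul, quotCoaction, quotCoaction, LinearMap.comp_apply,
        LinearMap.comp_apply]
      generalize δ.toLinearMap b = y
      induction y with
      | zero => simp
      | add x y hx hy => simp only [map_add, smul_add, hx, hy]
      | tmul b h => simp [TensorProduct.smul_tmul']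
  have hsurj : Function.Surjective c := by
    intro y
    obtain ⟨y, rfl⟩ := LinearMap.lTensor_surjective A P.ideal.mkQ_surjective y
    obtain ⟨z, rfl⟩ := hG.2 y
    induction z using BalancedTensor.induction_on with
    | zero => exact ⟨0, by simp⟩
    | add x y hx hy =>
      obtain ⟨x', hx⟩ := hx
      obtain ⟨y', hy⟩ := hy
      exact ⟨x' + y', by simp only [map_add, hx, hy]⟩
    | tmul a b =>
      refine ⟨BalancedTensor.tmul R _ a b, ?_⟩
      rw [canonicalMap_tmul, canonicalMap_tmul, quotCoaction, LinearMap.comp_apply]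
      generalize δ.toLinearMap b = y
      induction y with
      | zero => simp
      | add x y hx hy => simp only [map_add, smul_add, hx, hy]
      | tmul b h => simp [TensorProduct.smul_tmul']
  have hA' : Function.Injective ((Submodule.factor hQP).lTensor A) := by
    intro x y hxy
    obtain ⟨x, rfl⟩ := hsurj x
    obtain ⟨y, rfl⟩ := hsurj y
    rw [hc, hc] at hxy
    rw [hinj hxy]
  have hfac := (Module.FaithfullyFlat.lTensor_injective_iff_injective R A _).1 hA'
  refine GenQuot.ext (le_antisymm hQP fun x hx => ?_)
  rw [← Submodule.Quotient.mk_eq_zero]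
  refine hfac ?_
  rw [map_zero]
  exact (Submodule.Quotient.mk_eq_zero _).2 hx

/-- The correspondence between right admissible subalgebras and right admissible quotients. -/
theorem restrictsToBijection_right (hσ : IsSkewAntipode σ) (hδ : IsRightCoaction δ.toLinearMap)
    (hG : IsHopfGalois δ) (hB : IsRightFaithfullyFlat R (coinvariants δ) A)
    (hA : Module.FaithfullyFlat R A) (hconn : GaloisConnectionExists δ) :
    RestrictsToBijection δ {S | IsRightAdmissible δ S} {Q | Q.IsRightAdmissible} := by
  refine restrictsToBijection_of_forall (fun S hS =>
    ⟨isRightAdmissible_psi hδ hG hB hA hS, phi_psi_of_isRightAdmissible hS⟩) fun Q hQ => ?_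
  have h := psi_phi_of_isRightAdmissible hσ hδ hG hB hA hconn hQ
  refine ⟨⟨coinvariants_le_phi Q, isRightFaithfullyFlat_phi hσ hδ hG hB hQ.2, ?_, ?_⟩, h⟩
  · have hbij := canonicalMap_phi_bijective hσ hδ hG hB hQ.2
    have key : ∀ P, P = Q → ∃ hS : phi δ Q ≤ phi δ P, Function.Bijective (canonicalMap
        (quotCoaction δ P) (phi δ Q) (quotCoaction_mul_of_mem δ P hS)) := by
      rintro P rfl
      exact ⟨le_rfl, hbij⟩
    exact key _ h
  · rw [h]
    exact hQ.1

end Correspondence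

/-! ### The antipode and the opposite bialgebra -/

section Antipode

open HopfAlgebra Coalgebra

variable {R H : Type*} [CommRing R] [Ring H] [HopfAlgebra R H]

/-- The map `(p ⊗ q) ⊗ (r ⊗ s) ↦ S(q) r ⊗ S(p) s`. -/
def antipodeMulSwap : (H ⊗[R] H) ⊗[R] (H ⊗[R] H) →ₗ[R] H ⊗[R] H :=
  LinearMap.mul' R (H ⊗[R] H) ∘ₗ (TensorProduct.map (antipode R) (antipode R) ∘ₗ
    (TensorProduct.comm R H H).toLinearMap).rTensor (H ⊗[R] H)

theorem antipodeMulSwap_tmul (p q r s : H) :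
    antipodeMulSwap (R := R) ((p ⊗ₜ q) ⊗ₜ (r ⊗ₜ s)) =
      (antipode R q * r) ⊗ₜ (antipode R p * s) := by
  simp [antipodeMulSwap]

theorem antipodeMulSwap_comul_comul (h : H) :
    antipodeMulSwap (TensorProduct.map comul comul (comul (R := R) h)) =
      algebraMap R (H ⊗[R] H) (counit h) := by
  have key₁ : ∀ (p s : H) (y : H ⊗[R] H), antipodeMulSwap ((TensorProduct.assoc R H H (H ⊗[R] H)).symm
      (p ⊗ₜ TensorProduct.assoc R H H H (y ⊗ₜ s))) =
      LinearMap.mul' R H ((antipode R).rTensor H y) ⊗ₜ (antipode R p * s) := by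
    intro p s y
    induction y with
    | zero => simp
    | add x y hx hy =>
      simp only [map_add, TensorProduct.add_tmul, TensorProduct.tmul_add, hx, hy]
    | tmul q r => simp [antipodeMulSwap_tmul]
  have key₂ : ∀ (p t : H), antipodeMulSwap ((TensorProduct.assoc R H H (H ⊗[R] H)).symm
      (p ⊗ₜ TensorProduct.assoc R H H H ((comul (R := R)).rTensor H (comul (R := R) t)))) =
      1 ⊗ₜ (antipode R p * t) := by
    intro p t
    have : ∀ y : H ⊗[R] H, antipodeMulSwap ((TensorProduct.assoc R H H (H ⊗[R] H)).symm
        (p ⊗ₜ TensorProduct.assoc R H H H ((comul (R := R)).rTensor H y))) =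
        1 ⊗ₜ (antipode R p * TensorProduct.lid R H ((counit (R := R)).rTensor H y)) := by
      intro y
      induction y with
      | zero => simp
      | add x y hx hy => simp only [map_add, mul_add, TensorProduct.tmul_add, hx, hy]
      | tmul u s =>
        rw [LinearMap.rTensor_tmul, key₁, mul_antipode_rTensor_comul_apply]
        simp [Algebra.algebraMap_eq_smul_one, TensorProduct.smul_tmul]
    rw [this, rTensor_counit_comul]
    simp
  have key₃ : ∀ y : H ⊗[R] H, antipodeMulSwap ((TensorProduct.assoc R H H (H ⊗[R] H)).symm
      (((TensorProduct.assoc R H H H).toLinearMap ∘ₗ (comul (R := R)).rTensor H ∘ₗ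
        comul (R := R)).lTensor H y)) =
      1 ⊗ₜ LinearMap.mul' R H ((antipode R).rTensor H y) := by
    intro y
    induction y with
    | zero => simp
    | add x y hx hy => simp only [map_add, TensorProduct.tmul_add, hx, hy]
    | tmul p t => simpa using key₂ p t
  have key₄ : ∀ y : H ⊗[R] H, TensorProduct.map comul comul y =
      (TensorProduct.assoc R H H (H ⊗[R] H)).symm (((comul (R := R)).lTensor H).lTensor H
        (TensorProduct.assoc R H H H ((comul (R := R)).rTensor H y))) := by
    intro y
    rw [LinearEquiv.eq_symm_apply]
    induction y with
    | zero => simp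
    | add x y hx hy => simp only [map_add, hx, hy]
    | tmul a b =>
      rw [TensorProduct.map_tmul, LinearMap.rTensor_tmul]
      generalize comul (R := R) a = x
      induction x with
      | zero => simp
      | add x y hx hy => simp only [map_add, TensorProduct.add_tmul, hx, hy]
      | tmul p q => simp
  rw [key₄, coassoc_apply, ← LinearMap.lTensor_comp_apply, ← coassoc, key₃,
    mul_antipode_rTensor_comul_apply]
  simp [Algebra.algebraMap_eq_smul_one, Algebra.TensorProduct.one_def]

theorem comul_antipode (h : H) : comul (R := R) (antipode R h) =
    TensorProduct.comm R H H (TensorProduct.map (antipode R) (antipode R) (comul h)) := by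
  have h₁ : WithConv.toConv ((TensorProduct.map (antipode R) (antipode R) ∘ₗ
      (TensorProduct.comm R H H).toLinearMap) ∘ₗ comul (R := R)) *
      WithConv.toConv (comul (R := R) (A := H)) = 1 := by
    ext h
    rw [LinearMap.convMul_apply]
    refine Eq.trans ?_ (antipodeMulSwap_comul_comul h)
    rw [antipodeMulSwap, LinearMap.comp_apply, ← LinearMap.comp_apply (LinearMap.rTensor _ _),
      LinearMap.rTensor_comp_map]
  have h₂ := left_inv_eq_right_inv h₁ LinearMap.comul_right_inv
  have h₃ := congrArg (fun f => f.ofConv h) h₂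
  refine h₃.symm.trans ?_
  change TensorProduct.map (antipode R) (antipode R) (TensorProduct.comm R H H (comul h)) = _
  exact TensorProduct.map_comm _ _ _

/-- The inverse of a bijective antipode. -/
def antipodeInv (h : Function.Bijective (antipode R : H → H)) : H →ₗ[R] H :=
  (LinearEquiv.ofBijective (antipode R) h).symm.toLinearMap

theorem antipode_antipodeInv (hS : Function.Bijective (antipode R : H → H)) (h : H) :
    antipode R (antipodeInv hS h) = h :=
  (LinearEquiv.ofBijective (antipode R) hS).apply_symm_apply h

theorem antipodeInv_antipode (hS : Function.Bijective (antipode R : H → H)) (h : H) :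
    antipodeInv hS (antipode R h) = h :=
  hS.1 (antipode_antipodeInv hS _)

theorem antipode_mul'_antipodeInv_rTensor (hS : Function.Bijective (antipode R : H → H))
    (y : H ⊗[R] H) : antipode R (LinearMap.mul' R H ((antipodeInv hS).rTensor H
      (TensorProduct.comm R H H y))) = LinearMap.mul' R H ((antipode R).rTensor H y) := by
  induction y with
  | zero => simp
  | add x y hx hy => simp only [map_add, hx, hy]
  | tmul a b => simp [antipode_mul_antidistrib, antipode_antipodeInv]

theorem antipode_mul'_antipodeInv_lTensor (hS : Function.Bijective (antipode R : H → H))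
    (y : H ⊗[R] H) : antipode R (LinearMap.mul' R H ((antipodeInv hS).lTensor H
      (TensorProduct.comm R H H y))) = LinearMap.mul' R H ((antipode R).lTensor H y) := by
  induction y with
  | zero => simp
  | add x y hx hy => simp only [map_add, hx, hy]
  | tmul a b => simp [antipode_mul_antidistrib, antipode_antipodeInv]

theorem antipode_algebraMap (r : R) : antipode R (algebraMap R H r) = algebraMap R H r := by
  rw [Algebra.algebraMap_eq_smul_one, map_smul, antipode_one]

theorem isSkewAntipode_antipodeInv (hS : Function.Bijective (antipode R : H → H)) :
    IsSkewAntipode (antipodeInv hS) where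
  map_one := hS.1 (by rw [antipode_antipodeInv, antipode_one])
  map_mul g h := hS.1 (by rw [antipode_mul_antidistrib]; simp only [antipode_antipodeInv])
  counit h := by rw [← counit_antipode, antipode_antipodeInv]
  comul h := by
    conv_rhs => rw [← antipode_antipodeInv hS h, comul_antipode]
    generalize comul (R := R) (antipodeInv hS h) = y
    induction y with
    | zero => simp
    | add x y hx hy => simp only [map_add, ← hx, ← hy]
    | tmul a b => simp [antipodeInv_antipode]
  mul_rTensor_comm h := hS.1 (by
    rw [antipode_mul'_antipodeInv_rTensor, mul_antipode_rTensor_comul_apply, antipode_algebraMap])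
  mul_lTensor_comm h := hS.1 (by
    rw [antipode_mul'_antipodeInv_lTensor, mul_antipode_lTensor_comul_apply, antipode_algebraMap])

end Antipode

section Opposite

open HopfAlgebra Coalgebra

variable {R H : Type*} [CommRing R] [Ring H]

/-- The opposite bialgebra: opposite product, same comultiplication. -/
instance bialgebraMulOpposite [Bialgebra R H] : Bialgebra R Hᵐᵒᵖ :=
  Bialgebra.mk' R Hᵐᵒᵖ (Bialgebra.counit_one (R := R) (A := H))
    (fun {a b} => by
      simp [MulOpposite.counit_def, mul_comm])
    (by simp [MulOpposite.comul_def, Algebra.TensorProduct.one_def])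
    (fun {a b} => by
      change TensorProduct.map (opLinearEquiv R).toLinearMap (opLinearEquiv R).toLinearMap
        (comul (R := R) (unop b * unop a)) = TensorProduct.map (opLinearEquiv R).toLinearMap
        (opLinearEquiv R).toLinearMap (comul (R := R) (unop a)) * TensorProduct.map
        (opLinearEquiv R).toLinearMap (opLinearEquiv R).toLinearMap (comul (R := R) (unop b))
      rw [Bialgebra.comul_mul]
      generalize comul (R := R) (unop a) = x
      generalize comul (R := R) (unop b) = y
      induction x with
      | zero => simp
      | add x x' hx hy => simp only [map_add, mul_add, add_mul, hx, hy]
      | tmul p q =>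
        induction y with
        | zero => simp
        | add x x' hx hy => simp only [map_add, mul_add, add_mul, hx, hy]
        | tmul r s => simp)

variable [HopfAlgebra R H]

variable (R H) in
/-- The antipode, as an endomorphism of `Hᵐᵒᵖ`. -/
def antipodeOp : Hᵐᵒᵖ →ₗ[R] Hᵐᵒᵖ :=
  (opLinearEquiv R).toLinearMap ∘ₗ antipode R ∘ₗ (opLinearEquiv R).symm.toLinearMap

theorem antipodeOp_op (h : H) : antipodeOp R H (op h) = op (antipode R h) := rfl

theorem comul_op (h : H) : comul (R := R) (op h) = TensorProduct.map
    (opLinearEquiv R).toLinearMap (opLinearEquiv R).toLinearMap (comul (R := R) h) := rfl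

theorem isSkewAntipode_antipodeOp : IsSkewAntipode (antipodeOp R H) where
  map_one := congrArg op antipode_one
  map_mul g h := congrArg op (antipode_mul_antidistrib (unop h) (unop g))
  counit h := counit_antipode (R := R) (unop h)
  comul h := by
    induction h using MulOpposite.rec' with | h h => ?_
    rw [antipodeOp_op, comul_op, comul_op, comul_antipode]
    generalize comul (R := R) h = y
    induction y with
    | zero => simp
    | add x y hx hy => simp only [map_add, hx, hy]
    | tmul a b => simp [antipodeOp_op]
  mul_rTensor_comm h := by
    induction h using MulOpposite.rec' with | h h => ?_
    refine Eq.trans ?_ (congrArg op (mul_antipode_lTensor_comul_apply (R := R) h))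
    rw [comul_op]
    generalize comul (R := R) h = y
    induction y with
    | zero => simp
    | add x y hx hy => simp only [map_add, op_add, hx, hy]
    | tmul a b => simp [antipodeOp_op]
  mul_lTensor_comm h := by
    induction h using MulOpposite.rec' with | h h => ?_
    refine Eq.trans ?_ (congrArg op (mul_antipode_rTensor_comul_apply (R := R) h))
    rw [comul_op]
    generalize comul (R := R) h = y
    induction y with
    | zero => simp
    | add x y hx hy => simp only [map_add, op_add, hx, hy]
    | tmul a b => simp [antipodeOp_op]

end Opposite

/-! ### Faithful flatness and the opposite algebra -/

section FlatOp

variable {R A : Type*} [CommRing R] [Ring A] [Algebra R A] (S : Subalgebra R A)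

/-- `op a ⊗ x ↦ x ⊗ a` as an isomorphism `Aᵒᵖ ⊗_{Sᵒᵖ} X ≅ X ⊗_S A`. -/
def BalancedTensor.opEquiv {X : Type*} [AddCommGroup X] [Module R X] [Module (↥S)ᵐᵒᵖ X]
    [Module S.op X] (hX : ∀ (s : S) (x : X), S.linearEquivOp s • x = op s • x) :
    BalancedTensor R S.op Aᵐᵒᵖ X ≃ₗ[R] BalancedTensor R S X A :=
  Submodule.Quotient.equiv _ _ (TensorProduct.congr (opLinearEquiv R).symm (LinearEquiv.refl R X)
      ≪≫ₗ TensorProduct.comm R A X) (by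
    apply le_antisymm
    · rw [balancedRel, Submodule.map_span, Submodule.span_le]
      rintro _ ⟨_, ⟨m, s, x, rfl⟩, rfl⟩
      refine (Submodule.neg_mem_iff _).1 (Submodule.subset_span
        ⟨x, S.linearEquivOp.symm s, unop m, ?_⟩)
      rw [← hX, LinearEquiv.apply_symm_apply, map_sub, neg_sub]
      rfl
    · rw [balancedRel, Submodule.span_le]
      rintro _ ⟨x, s, a, rfl⟩
      refine ⟨-((op (S.linearEquivOp s) • op a) ⊗ₜ x - op a ⊗ₜ (S.linearEquivOp s • x)),
        neg_mem (Submodule.subset_span ⟨_, _, _, rfl⟩), ?_⟩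
      rw [neg_sub, hX, map_sub]
      rfl)

theorem mapRight_op_exact_iff {X Y Z : Type*} [AddCommGroup X] [AddCommGroup Y] [AddCommGroup Z]
    [Module R X] [Module R Y] [Module R Z]
    [Module (↥S)ᵐᵒᵖ X] [Module (↥S)ᵐᵒᵖ Y] [Module (↥S)ᵐᵒᵖ Z]
    [IsScalarTower R (↥S)ᵐᵒᵖ X] [IsScalarTower R (↥S)ᵐᵒᵖ Y] [IsScalarTower R (↥S)ᵐᵒᵖ Z]
    [Module S.op X] [Module S.op Y] [Module S.op Z]
    [IsScalarTower R S.op X] [IsScalarTower R S.op Y] [IsScalarTower R S.op Z]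
    (hX : ∀ (s : S) (x : X), S.linearEquivOp s • x = op s • x)
    (hY : ∀ (s : S) (x : Y), S.linearEquivOp s • x = op s • x)
    (hZ : ∀ (s : S) (x : Z), S.linearEquivOp s • x = op s • x)
    {f : X →ₗ[(↥S)ᵐᵒᵖ] Y} {g : Y →ₗ[(↥S)ᵐᵒᵖ] Z} {f' : X →ₗ[S.op] Y} {g' : Y →ₗ[S.op] Z}
    (hf : ∀ x, f' x = f x) (hg : ∀ y, g' y = g y) :
    Function.Exact (BalancedTensor.mapLeft (R := R) A f) (BalancedTensor.mapLeft (R := R) A g) ↔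
      Function.Exact (BalancedTensor.mapRight (R := R) Aᵐᵒᵖ f')
        (BalancedTensor.mapRight (R := R) Aᵐᵒᵖ g') :=
  Function.Exact.iff_of_ladder_linearEquiv (e₁ := BalancedTensor.opEquiv S hX)
    (e₂ := BalancedTensor.opEquiv S hY) (e₃ := BalancedTensor.opEquiv S hZ)
    (BalancedTensor.linearMap_ext fun m x =>
      congrArg (fun y => BalancedTensor.tmul R S y (unop m)) (hf x).symm)
    (BalancedTensor.linearMap_ext fun m x =>
      congrArg (fun y => BalancedTensor.tmul R S y (unop m)) (hg x).symm)

theorem isRightFaithfullyFlat_op_iff {R A : Type u} [CommRing R] [Ring A] [Algebra R A]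
    (S : Subalgebra R A) :
    IsRightFaithfullyFlat R S.op Aᵐᵒᵖ ↔ IsLeftFaithfullyFlat R S A := by
  constructor
  · intro h X Y Z _ _ _ _ _ _ _ _ _ _ _ _ f g
    let φ : S.op →+* (↥S)ᵐᵒᵖ := S.mopAlgEquivOp.symm.toRingEquiv.toRingHom
    let _ : Module S.op X := Module.compHom X φ
    let _ : Module S.op Y := Module.compHom Y φ
    let _ : Module S.op Z := Module.compHom Z φ
    have : IsScalarTower R S.op X := ⟨fun r s x => smul_assoc r (φ s) x⟩
    have : IsScalarTower R S.op Y := ⟨fun r s x => smul_assoc r (φ s) x⟩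
    have : IsScalarTower R S.op Z := ⟨fun r s x => smul_assoc r (φ s) x⟩
    let f' : X →ₗ[S.op] Y :=
      { toFun := f, map_add' := f.map_add, map_smul' := fun s x => f.map_smul (φ s) x }
    let g' : Y →ₗ[S.op] Z :=
      { toFun := g, map_add' := g.map_add, map_smul' := fun s x => g.map_smul (φ s) x }
    exact (h X Y Z f' g').trans (mapRight_op_exact_iff S (fun _ _ => rfl) (fun _ _ => rfl)
      (fun _ _ => rfl) (fun _ => rfl) (fun _ => rfl)).symm
  · intro h X Y Z _ _ _ _ _ _ _ _ _ _ _ _ f g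
    let φ : (↥S)ᵐᵒᵖ →+* S.op := S.mopAlgEquivOp.toRingEquiv.toRingHom
    let _ : Module (↥S)ᵐᵒᵖ X := Module.compHom X φ
    let _ : Module (↥S)ᵐᵒᵖ Y := Module.compHom Y φ
    let _ : Module (↥S)ᵐᵒᵖ Z := Module.compHom Z φ
    have : IsScalarTower R (↥S)ᵐᵒᵖ X := ⟨fun r s x => smul_assoc r (φ s) x⟩
    have : IsScalarTower R (↥S)ᵐᵒᵖ Y := ⟨fun r s x => smul_assoc r (φ s) x⟩
    have : IsScalarTower R (↥S)ᵐᵒᵖ Z := ⟨fun r s x => smul_assoc r (φ s) x⟩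
    let f' : X →ₗ[(↥S)ᵐᵒᵖ] Y :=
      { toFun := f, map_add' := f.map_add, map_smul' := fun s x => f.map_smul (φ s) x }
    let g' : Y →ₗ[(↥S)ᵐᵒᵖ] Z :=
      { toFun := g, map_add' := g.map_add, map_smul' := fun s x => g.map_smul (φ s) x }
    exact (h X Y Z f' g').trans (mapRight_op_exact_iff S (fun _ _ => rfl) (fun _ _ => rfl)
      (fun _ _ => rfl) (fun _ => rfl) (fun _ => rfl))

end FlatOp

/-! ### Faithful coflatness and anti-isomorphisms of coalgebras -/

section Swap

open Coalgebra

variable {R C C' : Type*} [CommRing R] [AddCommGroup C] [Module R C]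
  [AddCommGroup C'] [Module R C']

variable {X Y Z : Type*} [AddCommGroup X] [Module R X] [AddCommGroup Y] [Module R Y]
  [AddCommGroup Z] [Module R Z]

/-- A right `C`-coaction, viewed as a left coaction along `e : C ≃ C'`. -/
def swapCoaction (e : C ≃ₗ[R] C') (d : X →ₗ[R] X ⊗[R] C) : X →ₗ[R] C' ⊗[R] X :=
  (TensorProduct.congr (LinearEquiv.refl R X) e ≪≫ₗ TensorProduct.comm R X C').toLinearMap ∘ₗ d

theorem swapCoaction_apply (e : C ≃ₗ[R] C') (d : X →ₗ[R] X ⊗[R] C) (x : X) :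
    swapCoaction e d x = (TensorProduct.congr (LinearEquiv.refl R X) e ≪≫ₗ
      TensorProduct.comm R X C') (d x) := rfl

theorem exists_swapCoaction_eq (e : C ≃ₗ[R] C') (ρ : X →ₗ[R] C' ⊗[R] X) :
    ∃ d, swapCoaction e d = ρ :=
  ⟨(TensorProduct.congr (LinearEquiv.refl R X) e ≪≫ₗ
    TensorProduct.comm R X C').symm.toLinearMap ∘ₗ ρ, LinearMap.ext fun x => by
      rw [swapCoaction_apply]
      exact LinearEquiv.apply_symm_apply _ _⟩

theorem swapCoaction_colinear_iff (e : C ≃ₗ[R] C') {dX : X →ₗ[R] X ⊗[R] C}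
    {dY : Y →ₗ[R] Y ⊗[R] C} {f : X →ₗ[R] Y} :
    swapCoaction e dY ∘ₗ f = f.lTensor C' ∘ₗ swapCoaction e dX ↔ dY ∘ₗ f = f.rTensor C ∘ₗ dX := by
  have key : ∀ y : X ⊗[R] C, f.lTensor C' ((TensorProduct.congr (LinearEquiv.refl R X) e ≪≫ₗ
      TensorProduct.comm R X C') y) = (TensorProduct.congr (LinearEquiv.refl R Y) e ≪≫ₗ
      TensorProduct.comm R Y C') (f.rTensor C y) := by
    intro y
    induction y with
    | zero => simp
    | add x y hx hy => simp only [map_add, hx, hy]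
    | tmul x c => simp
  simp only [LinearMap.ext_iff, LinearMap.comp_apply, swapCoaction_apply, key,
    EmbeddingLike.apply_eq_iff_eq]

variable {M M' : Type*} [AddCommGroup M] [Module R M] [AddCommGroup M'] [Module R M']

theorem mem_cotensor_swap_iff {e : C ≃ₗ[R] C'} {w : M ≃ₗ[R] M'} {r : M →ₗ[R] C ⊗[R] M}
    {d' : M' →ₗ[R] M' ⊗[R] C'} (hw : ∀ m, d' (w m) = TensorProduct.comm R C' M'
      (TensorProduct.map e.toLinearMap w.toLinearMap (r m)))
    (d : X →ₗ[R] X ⊗[R] C) (z : X ⊗[R] M) :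
    (TensorProduct.comm R X M ≪≫ₗ TensorProduct.congr w (LinearEquiv.refl R X)) z ∈
      cotensor d' (swapCoaction e d) ↔ z ∈ cotensor d r := by
  let Ψ : X ⊗[R] (C ⊗[R] M) ≃ₗ[R] M' ⊗[R] (C' ⊗[R] X) :=
    (TensorProduct.assoc R X C M).symm ≪≫ₗ TensorProduct.comm R (X ⊗[R] C) M ≪≫ₗ
      TensorProduct.congr w (TensorProduct.congr (LinearEquiv.refl R X) e ≪≫ₗ
        TensorProduct.comm R X C')
  have h₁ : TensorProduct.assoc R M' C' X (d'.rTensor X ((TensorProduct.comm R X M ≪≫ₗ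
      TensorProduct.congr w (LinearEquiv.refl R X)) z)) = Ψ (r.lTensor X z) := by
    induction z with
    | zero => simp
    | add x y hx hy => simp only [map_add, hx, hy]
    | tmul x m =>
      simp only [LinearEquiv.trans_apply, TensorProduct.congr_tmul, TensorProduct.comm_tmul,
        LinearMap.rTensor_tmul, LinearMap.lTensor_tmul, hw]
      generalize r m = y
      induction y with
      | zero => simp
      | add x y hx hy =>
        simp only [map_add, TensorProduct.add_tmul, TensorProduct.tmul_add, hx, hy]
      | tmul a b => simp [Ψ]
  have h₂ : (swapCoaction e d).lTensor M' ((TensorProduct.comm R X M ≪≫ₗ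
      TensorProduct.congr w (LinearEquiv.refl R X)) z) =
      Ψ (TensorProduct.assoc R X C M (d.rTensor M z)) := by
    clear h₁
    induction z with
    | zero => simp
    | add x y hx hy => simp only [map_add, hx, hy]
    | tmul x m => simp [Ψ, swapCoaction_apply]
  change TensorProduct.assoc R M' C' X _ = (swapCoaction e d).lTensor M' _ ↔
    TensorProduct.assoc R X C M _ = r.lTensor X z
  rw [h₁, h₂, EmbeddingLike.apply_eq_iff_eq]
  exact eq_comm

/-- `X □_C M ≅ M' □_{C'} X`, where `C'` and `M'` are mirror images of `C` and `M`. -/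
def cotensorSwapEquiv {e : C ≃ₗ[R] C'} {w : M ≃ₗ[R] M'} {r : M →ₗ[R] C ⊗[R] M}
    {d' : M' →ₗ[R] M' ⊗[R] C'} (hw : ∀ m, d' (w m) = TensorProduct.comm R C' M'
      (TensorProduct.map e.toLinearMap w.toLinearMap (r m))) (d : X →ₗ[R] X ⊗[R] C) :
    cotensor d r ≃ₗ[R] cotensor d' (swapCoaction e d) :=
  (TensorProduct.comm R X M ≪≫ₗ TensorProduct.congr w (LinearEquiv.refl R X)).ofSubmodules _ _ (by
    ext y
    rw [Submodule.mem_map_equiv, ← mem_cotensor_swap_iff hw, LinearEquiv.apply_symm_apply])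

theorem lTensor_comm_congr (w : M ≃ₗ[R] M') (f : X →ₗ[R] Y) (z : X ⊗[R] M) :
    f.lTensor M' ((TensorProduct.comm R X M ≪≫ₗ
      TensorProduct.congr w (LinearEquiv.refl R X)) z) = (TensorProduct.comm R Y M ≪≫ₗ
      TensorProduct.congr w (LinearEquiv.refl R Y)) (f.rTensor M z) := by
  induction z with
  | zero => simp
  | add x y hx hy => simp only [map_add, hx, hy]
  | tmul x m => simp

theorem cotensor_swap_exact_iff {e : C ≃ₗ[R] C'} {w : M ≃ₗ[R] M'} {r : M →ₗ[R] C ⊗[R] M}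
    {d' : M' →ₗ[R] M' ⊗[R] C'} (hw : ∀ m, d' (w m) = TensorProduct.comm R C' M'
      (TensorProduct.map e.toLinearMap w.toLinearMap (r m)))
    {dX : X →ₗ[R] X ⊗[R] C} {dY : Y →ₗ[R] Y ⊗[R] C} {dZ : Z →ₗ[R] Z ⊗[R] C}
    {f : X →ₗ[R] Y} {g : Y →ₗ[R] Z} (hf : dY ∘ₗ f = f.rTensor C ∘ₗ dX)
    (hg : dZ ∘ₗ g = g.rTensor C ∘ₗ dY)
    (hf' : swapCoaction e dY ∘ₗ f = f.lTensor C' ∘ₗ swapCoaction e dX)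
    (hg' : swapCoaction e dZ ∘ₗ g = g.lTensor C' ∘ₗ swapCoaction e dY) :
    Function.Exact (cotensorMapRight d' f hf') (cotensorMapRight d' g hg') ↔
      Function.Exact (cotensorMapLeft r f hf) (cotensorMapLeft r g hg) :=
  Function.Exact.iff_of_ladder_linearEquiv (e₁ := cotensorSwapEquiv hw dX)
    (e₂ := cotensorSwapEquiv hw dY) (e₃ := cotensorSwapEquiv hw dZ)
    (LinearMap.ext fun x => Subtype.ext (lTensor_comm_congr w f x.1))
    (LinearMap.ext fun x => Subtype.ext (lTensor_comm_congr w g x.1))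

variable [Coalgebra R C] [Coalgebra R C']

/-- `e` is an anti-isomorphism of coalgebras. -/
structure IsAntiCoalgEquiv (e : C ≃ₗ[R] C') : Prop where
  counit : ∀ c, Coalgebra.counit (R := R) (e c) = Coalgebra.counit c
  comul : ∀ c, Coalgebra.comul (R := R) (e c) =
    TensorProduct.comm R C' C' (TensorProduct.map e.toLinearMap e.toLinearMap (Coalgebra.comul c))

theorem IsAntiCoalgEquiv.symm {e : C ≃ₗ[R] C'} (he : IsAntiCoalgEquiv e) :
    IsAntiCoalgEquiv e.symm where
  counit c := by rw [← he.counit, e.apply_symm_apply]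
  comul c := by
    conv_rhs => rw [← e.apply_symm_apply c, he.comul]
    generalize Coalgebra.comul (R := R) (e.symm c) = y
    induction y with
    | zero => simp
    | add x y hx hy => simp only [map_add, ← hx, ← hy]
    | tmul a b => simp

theorem isLeftCoaction_swapCoaction_iff {e : C ≃ₗ[R] C'} (he : IsAntiCoalgEquiv e)
    {d : X →ₗ[R] X ⊗[R] C} : IsLeftCoaction (swapCoaction e d) ↔ IsRightCoaction d := by
  let Ψ : X ⊗[R] (C ⊗[R] C) ≃ₗ[R] C' ⊗[R] (C' ⊗[R] X) :=
    (TensorProduct.assoc R X C C).symm ≪≫ₗ TensorProduct.comm R (X ⊗[R] C) C ≪≫ₗ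
      TensorProduct.congr e (TensorProduct.congr (LinearEquiv.refl R X) e ≪≫ₗ
        TensorProduct.comm R X C')
  have h₁ : ∀ y : X ⊗[R] C, TensorProduct.assoc R C' C' X ((comul (R := R)).rTensor X
      ((TensorProduct.congr (LinearEquiv.refl R X) e ≪≫ₗ TensorProduct.comm R X C') y)) =
      Ψ ((comul (R := R)).lTensor X y) := by
    intro y
    induction y with
    | zero => simp
    | add x y hx hy => simp only [map_add, hx, hy]
    | tmul x c =>
      simp only [LinearEquiv.trans_apply, TensorProduct.congr_tmul, TensorProduct.comm_tmul,
        LinearMap.rTensor_tmul, LinearMap.lTensor_tmul, he.comul]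
      generalize comul (R := R) c = z
      induction z with
      | zero => simp
      | add x y hx hy =>
        simp only [map_add, TensorProduct.add_tmul, TensorProduct.tmul_add, hx, hy]
      | tmul a b => simp [Ψ]
  have h₂ : ∀ y : X ⊗[R] C, (swapCoaction e d).lTensor C'
      ((TensorProduct.congr (LinearEquiv.refl R X) e ≪≫ₗ TensorProduct.comm R X C') y) =
      Ψ (TensorProduct.assoc R X C C (d.rTensor C y)) := by
    intro y
    induction y with
    | zero => simp
    | add x y hx hy => simp only [map_add, hx, hy]
    | tmul x c => simp [Ψ, swapCoaction_apply]
  have h₃ : ∀ y : X ⊗[R] C, (counit (R := R)).rTensor X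
      ((TensorProduct.congr (LinearEquiv.refl R X) e ≪≫ₗ TensorProduct.comm R X C') y) =
      TensorProduct.comm R X R ((counit (R := R)).lTensor X y) := by
    intro y
    induction y with
    | zero => simp
    | add x y hx hy => simp only [map_add, hx, hy]
    | tmul x c => simp [he.counit]
  have h₄ : ∀ x : X, TensorProduct.mk R R X 1 x =
      TensorProduct.comm R X R ((TensorProduct.mk R X R).flip 1 x) := fun x => rfl
  constructor
  · rintro ⟨ha, hc⟩
    simp only [LinearMap.ext_iff, LinearMap.comp_apply, swapCoaction_apply, LinearEquiv.coe_coe,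
      h₁, h₂, h₃, h₄, EmbeddingLike.apply_eq_iff_eq] at ha hc
    exact ⟨LinearMap.ext fun x => (ha x).symm, LinearMap.ext hc⟩
  · rintro ⟨ha, hc⟩
    simp only [LinearMap.ext_iff, LinearMap.comp_apply, LinearEquiv.coe_coe] at ha hc
    constructor
    · ext x
      simp only [LinearMap.comp_apply, swapCoaction_apply, LinearEquiv.coe_coe, h₁, h₂, ha]
    · ext x
      simp only [LinearMap.comp_apply, swapCoaction_apply, h₃, h₄, hc]

theorem isRightFaithfullyCoflat_swap_iff {R C C' M M' : Type u} [CommRing R] [AddCommGroup C]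
    [Module R C] [Coalgebra R C] [AddCommGroup C'] [Module R C'] [Coalgebra R C']
    [AddCommGroup M] [Module R M] [AddCommGroup M'] [Module R M']
    {e : C ≃ₗ[R] C'} (he : IsAntiCoalgEquiv e) {w : M ≃ₗ[R] M'} {r : M →ₗ[R] C ⊗[R] M}
    {d' : M' →ₗ[R] M' ⊗[R] C'} (hw : ∀ m, d' (w m) = TensorProduct.comm R C' M'
      (TensorProduct.map e.toLinearMap w.toLinearMap (r m))) :
    IsRightFaithfullyCoflat d' ↔ IsLeftFaithfullyCoflat r := by
  constructor
  · intro h X Y Z _ _ _ _ _ _ dX dY dZ hX hY hZ f g hf hg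
    rw [← isLeftCoaction_swapCoaction_iff he] at hX hY hZ
    have hf' := (swapCoaction_colinear_iff e).2 hf
    have hg' := (swapCoaction_colinear_iff e).2 hg
    exact (h X Y Z _ _ _ hX hY hZ f g hf' hg').trans (cotensor_swap_exact_iff hw hf hg hf' hg')
  · intro h X Y Z _ _ _ _ _ _ ρX ρY ρZ hX hY hZ f g hf' hg'
    obtain ⟨dX, rfl⟩ := exists_swapCoaction_eq e ρX
    obtain ⟨dY, rfl⟩ := exists_swapCoaction_eq e ρY
    obtain ⟨dZ, rfl⟩ := exists_swapCoaction_eq e ρZ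
    rw [isLeftCoaction_swapCoaction_iff he] at hX hY hZ
    have hf := (swapCoaction_colinear_iff e).1 hf'
    have hg := (swapCoaction_colinear_iff e).1 hg'
    exact (h X Y Z _ _ _ hX hY hZ f g hf hg).trans
      (cotensor_swap_exact_iff hw hf hg hf' hg').symm

end Swap

/-! ### Transport of generalised quotients along anti-isomorphisms -/

section Transport

variable {R H K : Type*} [CommRing R] [Ring H] [Algebra R H] [Coalgebra R H]
  [Ring K] [Algebra R K] [Coalgebra R K]

/-- The image of a generalised quotient under an isomorphism of algebras which is an
anti-isomorphism of coalgebras. -/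
def GenQuot.transport (E : H ≃ₐ[R] K) (hE : IsAntiCoalgEquiv E.toLinearEquiv)
    (Q : GenQuot R H) : GenQuot R K where
  ideal := Q.ideal.map E.toLinearEquiv.toLinearMap
  isCoideal := by
    refine ⟨?_, ?_⟩
    · rintro _ ⟨x, hx, rfl⟩
      exact (hE.counit x).trans (Submodule.IsCoideal.counit_eq_zero hx)
    · rintro _ ⟨x, hx, rfl⟩
      let ē := Submodule.Quotient.equiv Q.ideal (Q.ideal.map E.toLinearEquiv.toLinearMap)
        E.toLinearEquiv rfl
      have key : ∀ y : H ⊗[R] H, TensorProduct.map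
          (Q.ideal.map E.toLinearEquiv.toLinearMap).mkQ
          (Q.ideal.map E.toLinearEquiv.toLinearMap).mkQ (TensorProduct.comm R K K
          (TensorProduct.map E.toLinearEquiv.toLinearMap E.toLinearEquiv.toLinearMap y)) =
          TensorProduct.comm R _ _ (TensorProduct.map ē.toLinearMap ē.toLinearMap
            (TensorProduct.map Q.ideal.mkQ Q.ideal.mkQ y)) := by
        intro y
        induction y with
        | zero => simp
        | add x y hx hy => simp only [map_add, hx, hy]
        | tmul a b => rfl
      have h := hE.comul x
      rw [LinearEquiv.coe_coe, h, key, Submodule.IsCoideal.map_mkQ_comul_eq_zero hx, map_zero,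
        map_zero]
  mul_mem := by
    rintro _ ⟨x, hx, rfl⟩ h
    exact ⟨x * E.symm h, Q.mul_mem x hx _, by simp⟩

/-- The isomorphism of quotients induced by `E`. -/
def GenQuot.transportEquiv (E : H ≃ₐ[R] K) (hE : IsAntiCoalgEquiv E.toLinearEquiv)
    (Q : GenQuot R H) : (H ⧸ Q.ideal) ≃ₗ[R] (K ⧸ (Q.transport E hE).ideal) :=
  Submodule.Quotient.equiv _ _ E.toLinearEquiv rfl

theorem GenQuot.isAntiCoalgEquiv_transportEquiv (E : H ≃ₐ[R] K)
    (hE : IsAntiCoalgEquiv E.toLinearEquiv) (Q : GenQuot R H) :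
    IsAntiCoalgEquiv (Q.transportEquiv E hE) where
  counit c := by
    obtain ⟨h, rfl⟩ := Q.ideal.mkQ_surjective c
    exact hE.counit h
  comul c := by
    obtain ⟨h, rfl⟩ := Q.ideal.mkQ_surjective c
    have h₁ : Coalgebra.comul (R := R) (Q.transportEquiv E hE (Q.ideal.mkQ h)) =
      TensorProduct.map (Q.transport E hE).ideal.mkQ (Q.transport E hE).ideal.mkQ
        (Coalgebra.comul (R := R) (E.toLinearEquiv h)) := rfl
    have h₂ : Coalgebra.comul (R := R) (Q.ideal.mkQ h) = TensorProduct.map Q.ideal.mkQ Q.ideal.mkQ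
      (Coalgebra.comul (R := R) h) := rfl
    rw [h₁, h₂, hE.comul]
    generalize Coalgebra.comul (R := R) h = y
    induction y with
    | zero => simp
    | add x y hx hy => simp only [map_add, hx, hy]
    | tmul a b => rfl

/-- `GenQuot.transport` as an isomorphism of ordered sets. -/
def GenQuot.transportIso (E : H ≃ₐ[R] K) (hE : IsAntiCoalgEquiv E.toLinearEquiv) :
    GenQuot R H ≃o GenQuot R K where
  toFun := GenQuot.transport E hE
  invFun := GenQuot.transport E.symm hE.symm
  left_inv Q := GenQuot.ext (Submodule.ext fun x =>
    ⟨by rintro ⟨_, ⟨y, hy, rfl⟩, rfl⟩; simpa using hy, fun hx => ⟨E x, ⟨x, hx, rfl⟩, by simp⟩⟩)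
  right_inv Q := GenQuot.ext (Submodule.ext fun x =>
    ⟨by rintro ⟨_, ⟨y, hy, rfl⟩, rfl⟩; simpa using hy, fun hx => ⟨E.symm x, ⟨x, hx, rfl⟩, by simp⟩⟩)
  map_rel_iff' {Q₁ Q₂} := Submodule.map_le_map_iff_of_injective E.injective Q₂.ideal Q₁.ideal

theorem GenQuot.isRightAdmissible_transport_iff {R H K : Type u} [CommRing R] [Ring H]
    [Algebra R H] [Coalgebra R H] [Ring K] [Algebra R K] [Coalgebra R K] (E : H ≃ₐ[R] K)
    (hE : IsAntiCoalgEquiv E.toLinearEquiv) (Q : GenQuot R H) :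
    (Q.transport E hE).IsRightAdmissible ↔ Q.IsLeftAdmissible := by
  refine and_congr (Module.Flat.equiv_iff (Q.transportEquiv E hE)).symm
    (isRightFaithfullyCoflat_swap_iff (Q.isAntiCoalgEquiv_transportEquiv E hE)
      (w := E.toLinearEquiv) fun m => ?_)
  rw [LinearMap.comp_apply, LinearMap.comp_apply, hE.comul]
  generalize Coalgebra.comul (R := R) m = y
  induction y with
  | zero => simp
  | add x y hx hy => simp only [map_add, hx, hy]
  | tmul a b => rfl

end Transport

/-! ### The opposite comodule algebra -/

section OpCoaction

variable {R H A : Type*} [CommRing R] [Ring H] [Ring A] [Algebra R A]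

theorem opCoaction_op [Algebra R H] (δ : A →ₐ[R] A ⊗[R] H) (a : A) : opCoaction δ (op a) =
    TensorProduct.map (opLinearEquiv R).toLinearMap (opLinearEquiv R).toLinearMap (δ a) := by
  change (Algebra.TensorProduct.opAlgEquiv R R A H).symm (op (δ a)) = _
  generalize δ a = y
  induction y with
  | zero => simp
  | add x y hx hy => simp only [map_add, op_add, hx, hy]
  | tmul b h => simp

theorem coinvariants_opCoaction [Algebra R H] (δ : A →ₐ[R] A ⊗[R] H) :
    coinvariants (opCoaction δ) = (coinvariants δ).op := by
  ext a
  induction a using MulOpposite.rec' with | h a => ?_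
  change opCoaction δ (op a) = op a ⊗ₜ 1 ↔ δ a = a ⊗ₜ 1
  rw [opCoaction_op]
  exact (TensorProduct.congr (opLinearEquiv R) (opLinearEquiv R) :
    A ⊗[R] H ≃ₗ[R] Aᵐᵒᵖ ⊗[R] Hᵐᵒᵖ).injective.eq_iff (a := δ a) (b := a ⊗ₜ 1)

set_option synthInstance.maxHeartbeats 100000 in
theorem isRightCoaction_opCoaction [Bialgebra R H] {δ : A →ₐ[R] A ⊗[R] H}
    (hδ : IsRightCoaction δ.toLinearMap) : IsRightCoaction (opCoaction δ).toLinearMap where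
  coassoc := by
    ext a
    induction a using MulOpposite.rec' with | h a => ?_
    let Ψ : A ⊗[R] (H ⊗[R] H) →ₗ[R] Aᵐᵒᵖ ⊗[R] (Hᵐᵒᵖ ⊗[R] Hᵐᵒᵖ) :=
      TensorProduct.map (opLinearEquiv R).toLinearMap (TensorProduct.map
        (opLinearEquiv R).toLinearMap (opLinearEquiv R).toLinearMap)
    have h₁ : ∀ y : A ⊗[R] H, TensorProduct.assoc R Aᵐᵒᵖ Hᵐᵒᵖ Hᵐᵒᵖ
        ((opCoaction δ).toLinearMap.rTensor Hᵐᵒᵖ (TensorProduct.map (opLinearEquiv R).toLinearMap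
          (opLinearEquiv R).toLinearMap y)) =
        Ψ (TensorProduct.assoc R A H H (δ.toLinearMap.rTensor H y)) := by
      intro y
      induction y with
      | zero => simp
      | add x y hx hy => simp only [map_add, hx, hy]
      | tmul b h =>
        simp only [TensorProduct.map_tmul, LinearMap.rTensor_tmul, LinearEquiv.coe_coe,
          coe_opLinearEquiv, AlgHom.toLinearMap_apply, opCoaction_op]
        generalize δ b = y
        induction y with
        | zero => simp
        | add x y hx hy => simp only [map_add, TensorProduct.add_tmul, hx, hy]
        | tmul c k => simp [Ψ]
    have h₂ : ∀ y : A ⊗[R] H, (Coalgebra.comul (R := R)).lTensor Aᵐᵒᵖ (TensorProduct.map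
        (opLinearEquiv R).toLinearMap (opLinearEquiv R).toLinearMap y) =
        Ψ ((Coalgebra.comul (R := R)).lTensor A y) := by
      intro y
      induction y with
      | zero => simp
      | add x y hx hy => simp only [map_add, hx, hy]
      | tmul b h => rfl
    have h₃ := LinearMap.congr_fun hδ.coassoc a
    simp only [LinearMap.comp_apply, LinearEquiv.coe_coe, AlgHom.toLinearMap_apply] at h₃
    simp only [LinearMap.comp_apply, LinearEquiv.coe_coe, AlgHom.toLinearMap_apply,
      opCoaction_op, h₁, h₂, h₃]
  counit := by
    ext a
    induction a using MulOpposite.rec' with | h a => ?_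
    have h₁ : ∀ y : A ⊗[R] H, (Coalgebra.counit (R := R)).lTensor Aᵐᵒᵖ (TensorProduct.map
        (opLinearEquiv R).toLinearMap (opLinearEquiv R).toLinearMap y) =
        (opLinearEquiv R).toLinearMap.rTensor R ((Coalgebra.counit (R := R)).lTensor A y) := by
      intro y
      induction y with
      | zero => simp
      | add x y hx hy => simp only [map_add, hx, hy]
      | tmul b h => rfl
    have h₂ := hδ.lTensor_counit_apply a
    rw [AlgHom.toLinearMap_apply] at h₂
    simp only [LinearMap.comp_apply, AlgHom.toLinearMap_apply, opCoaction_op, h₁, h₂]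
    rfl

variable [HopfAlgebra R H] (hS : Function.Bijective (HopfAlgebra.antipode R : H → H))

/-- A bijective antipode, as an isomorphism of algebras `H ≅ Hᵒᵖ`. -/
def antipodeEquivOp : H ≃ₐ[R] Hᵐᵒᵖ :=
  AlgEquiv.ofBijective (HopfAlgebra.antipodeAlgHomOp R H) (op_bijective.comp hS)

theorem isAntiCoalgEquiv_antipodeEquivOp :
    IsAntiCoalgEquiv (antipodeEquivOp hS).toLinearEquiv where
  counit h := HopfAlgebra.counit_antipode (R := R) h
  comul h := by
    change Coalgebra.comul (R := R) (op (HopfAlgebra.antipode R h)) = _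
    rw [comul_op, comul_antipode]
    generalize Coalgebra.comul (R := R) h = y
    induction y with
    | zero => simp
    | add x y hx hy => simp only [map_add, hx, hy]
    | tmul a b => rfl

/-- The generalised quotient of `Hᵒᵖ` by the image of the kernel of `Q` under the antipode. -/
def opQuot : GenQuot R H ≃o GenQuot R Hᵐᵒᵖ :=
  GenQuot.transportIso (antipodeEquivOp hS) (isAntiCoalgEquiv_antipodeEquivOp hS)

variable {δ : A →ₐ[R] A ⊗[R] H} (hδ : IsRightCoaction δ.toLinearMap)

include hδ

theorem phi_opCoaction (Q : GenQuot R H) :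
    phi (opCoaction δ) (opQuot hS Q) = (phi δ Q).op := by
  ext a
  induction a using MulOpposite.rec' with | h a => ?_
  rw [mem_phi_iff_twist isSkewAntipode_antipodeOp (opCoaction δ) _ (isRightCoaction_opCoaction hδ),
    twist_apply, opCoaction_op]
  let ē := Q.transportEquiv (antipodeEquivOp hS) (isAntiCoalgEquiv_antipodeEquivOp hS)
  let Φ : A ⊗[R] (H ⧸ Q.ideal) ≃ₗ[R] (Hᵐᵒᵖ ⧸ (opQuot hS Q).ideal) ⊗[R] Aᵐᵒᵖ :=
    TensorProduct.congr (opLinearEquiv R) ē ≪≫ₗ TensorProduct.comm R _ _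
  have h₁ : ∀ y : A ⊗[R] H, (opQuot hS Q).ideal.mkQ.rTensor Aᵐᵒᵖ (TensorProduct.comm R Aᵐᵒᵖ Hᵐᵒᵖ
      ((antipodeOp R H).lTensor Aᵐᵒᵖ (TensorProduct.map (opLinearEquiv R).toLinearMap
        (opLinearEquiv R).toLinearMap y))) = Φ (Q.ideal.mkQ.lTensor A y) := by
    intro y
    induction y with
    | zero => simp
    | add x y hx hy => simp only [map_add, hx, hy]
    | tmul b h => rfl
  have h₂ : (opQuot hS Q).ideal.mkQ 1 ⊗ₜ[R] op a = Φ (a ⊗ₜ Q.ideal.mkQ 1) := by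
    have : ē (Q.ideal.mkQ 1) = (opQuot hS Q).ideal.mkQ 1 :=
      congrArg (opQuot hS Q).ideal.mkQ (map_one (antipodeEquivOp hS))
    rw [← this]
    rfl
  rw [h₁, h₂, Φ.injective.eq_iff]
  rfl

theorem psi_opCoaction (S : Subalgebra R A) :
    psi (opCoaction δ) S.op = opQuot hS (psi δ S) := by
  have h : {P | S.op ≤ phi (opCoaction δ) P} = opQuot hS '' {Q | S ≤ phi δ Q} := by
    ext P
    obtain ⟨Q, rfl⟩ := (opQuot hS).surjective P
    rw [(opQuot hS).injective.mem_set_image, Set.mem_ofPred_eq, Set.mem_ofPred_eq,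
      phi_opCoaction hS hδ, Subalgebra.op_le_op_iff]
  refine (GenQuot.isLUB_sSup _).unique ?_
  rw [h, (opQuot hS).isLUB_image']
  exact GenQuot.isLUB_sSup _

include hS in
theorem galoisConnectionExists_opCoaction (h : GaloisConnectionExists δ) :
    GaloisConnectionExists (opCoaction δ) := by
  obtain ⟨ψ, hφ, hψ, h₁, h₂⟩ := h
  refine ⟨fun T => opQuot hS (ψ T.unop), ?_, ?_, fun T => ?_, fun P => ?_⟩
  · intro P P' hP
    obtain ⟨Q, rfl⟩ := (opQuot hS).surjective P
    obtain ⟨Q', rfl⟩ := (opQuot hS).surjective P'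
    rw [phi_opCoaction hS hδ, phi_opCoaction hS hδ, Subalgebra.op_le_op_iff]
    exact hφ ((opQuot hS).le_iff_le.1 hP)
  · intro T T' hT
    exact (opQuot hS).monotone (hψ (Subalgebra.unop_le_unop_iff.2 hT))
  · rw [phi_opCoaction hS hδ]
    exact Subalgebra.le_op_iff.2 (h₁ T.unop)
  · obtain ⟨Q, rfl⟩ := (opQuot hS).surjective P
    rw [phi_opCoaction hS hδ]
    exact (opQuot hS).monotone (h₂ Q)

end OpCoaction

section Main

variable {R H A : Type u} [CommRing R] [Ring H] [Ring A] [Algebra R A] [HopfAlgebra R H]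
  (hS : Function.Bijective (HopfAlgebra.antipode R : H → H)) {δ : A →ₐ[R] A ⊗[R] H}
  (hδ : IsRightCoaction δ.toLinearMap)

theorem isRightAdmissible_opQuot_iff (Q : GenQuot R H) :
    (opQuot hS Q).IsRightAdmissible ↔ Q.IsLeftAdmissible :=
  GenQuot.isRightAdmissible_transport_iff (antipodeEquivOp hS)
    (isAntiCoalgEquiv_antipodeEquivOp hS) Q

include hS hδ

theorem isRightAdmissible_op_iff (S : Subalgebra R A) :
    IsRightAdmissible (opCoaction δ) S.op ↔ IsLeftAdmissible δ S := by
  have h₁ : coinvariants (opCoaction δ) ≤ S.op ↔ coinvariants δ ≤ S := by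
    rw [coinvariants_opCoaction, Subalgebra.op_le_op_iff]
  have h₂ : Module.Flat R (Hᵐᵒᵖ ⧸ (psi (opCoaction δ) S.op).ideal) ↔
      Module.Flat R (H ⧸ (psi δ S).ideal) := by
    rw [psi_opCoaction hS hδ]
    exact (Module.Flat.equiv_iff ((psi δ S).transportEquiv (antipodeEquivOp hS)
      (isAntiCoalgEquiv_antipodeEquivOp hS))).symm
  exact ⟨fun h => ⟨h₁.1 h.1, (isRightFaithfullyFlat_op_iff S).1 h.2, h.3, h₂.1 h.4⟩,
    fun h => ⟨h₁.2 h.1, (isRightFaithfullyFlat_op_iff S).2 h.2, h.3, h₂.2 h.4⟩⟩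

/-- The correspondence between left admissible subalgebras and left admissible quotients. -/
theorem restrictsToBijection_left (hG : IsHopfGalois (opCoaction δ))
    (hB : IsLeftFaithfullyFlat R (coinvariants δ) A) (hA : Module.FaithfullyFlat R A)
    (hconn : GaloisConnectionExists δ) :
    RestrictsToBijection δ {S | IsLeftAdmissible δ S} {Q | Q.IsLeftAdmissible} := by
  have hB' : IsRightFaithfullyFlat R (coinvariants (opCoaction δ)) Aᵐᵒᵖ := by
    rw [coinvariants_opCoaction]
    exact (isRightFaithfullyFlat_op_iff _).2 hB
  have hA' : Module.FaithfullyFlat R Aᵐᵒᵖ :=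
    Module.FaithfullyFlat.of_linearEquiv R A (opLinearEquiv R).symm
  have h := restrictsToBijection_right isSkewAntipode_antipodeOp (isRightCoaction_opCoaction hδ)
    hG hB' hA' (galoisConnectionExists_opCoaction hS hδ hconn)
  refine restrictsToBijection_of_forall (fun S hSadm => ?_) fun Q hQ => ?_
  · have hS' : S.op ∈ {T | IsRightAdmissible (opCoaction δ) T} :=
      (isRightAdmissible_op_iff hS hδ S).2 hSadm
    have h₁ := h.1.mapsTo hS'
    have h₂ := h.2.2.1 hS'
    rw [psi_opCoaction hS hδ] at h₁ h₂
    rw [phi_opCoaction hS hδ] at h₂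
    exact ⟨(isRightAdmissible_opQuot_iff hS _).1 h₁, Subalgebra.opEquiv.injective h₂⟩
  · have hQ' : opQuot hS Q ∈ {P | GenQuot.IsRightAdmissible P} :=
      (isRightAdmissible_opQuot_iff hS Q).2 hQ
    have h₁ := h.2.1.mapsTo hQ'
    have h₂ := h.2.2.2 hQ'
    rw [phi_opCoaction hS hδ] at h₁ h₂
    rw [psi_opCoaction hS hδ] at h₂
    exact ⟨(isRightAdmissible_op_iff hS hδ _).1 h₁, (opQuot hS).injective h₂⟩

end Main

end HopfGalois

end

theorem mainTheorem3 {R H A : Type u} [CommRing R] [Ring H] [HopfAlgebra R H]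
    [Ring A] [Algebra R A]
    (hantipode : Function.Bijective (HopfAlgebra.antipode R : H → H))
    (δ : A →ₐ[R] A ⊗[R] H) (hδ : IsRightCoaction δ.toLinearMap)
    (hGalois : IsHopfGalois δ) (hGalois_op : IsHopfGalois (opCoaction δ))
    (hleft : IsLeftFaithfullyFlat R (coinvariants δ) A)
    (hright : IsRightFaithfullyFlat R (coinvariants δ) A)
    (hconn : GaloisConnectionExists δ)
    (hflat : Module.FaithfullyFlat R A) :
    RestrictsToBijection δ {S | IsLeftAdmissible δ S} {Q | Q.IsLeftAdmissible} ∧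
    RestrictsToBijection δ {S | IsRightAdmissible δ S} {Q | Q.IsRightAdmissible} ∧
    RestrictsToBijection δ {S | IsLeftAdmissible δ S ∧ IsRightAdmissible δ S}
      {Q | Q.IsLeftAdmissible ∧ Q.IsRightAdmissible} := by
  have hl := restrictsToBijection_left hantipode hδ hGalois_op hleft hflat hconn
  have hr := restrictsToBijection_right (isSkewAntipode_antipodeInv hantipode) hδ hGalois hright
    hflat hconn
  exact ⟨hl, hr, restrictsToBijection_of_forall
    (fun S hS => ⟨⟨hl.1.mapsTo hS.1, hr.1.mapsTo hS.2⟩, hl.2.2.1 hS.1⟩)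
    fun Q hQ => ⟨⟨hl.2.1.mapsTo hQ.1, hr.2.1.mapsTo hQ.2⟩, hl.2.2.2 hQ.1⟩⟩
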